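/- Let $(M,g)$ be a compact Riemannian manifold of dimension $m$ (smooth, without boundary) with Riemannian measure $v_g$, let $(N,h)$ be a smooth Riemannian manifold, and let $\nabla$, $\nabla^N$ be their Levi-Civita connections. For a smooth map $\varphi:M\to N$ let $\overline\nabla$ be the connection induced on $\varphi^{-1}TN$, let $d$ and $\delta$ be the exterior derivative and the codifferential on $\varphi^{-1}TN$-valued differential forms defined by the induced connections, and let $\{e_i\}_{i=1}^m$ be local orthonormal frames on $M$. Put $$\tau(\varphi)=\sum_{i=1}^m\{\overline\nabla_{e_i}(d\varphi(e_i))-d\varphi(\nabla_{e_i}e_i)\},\qquad \overline\Delta V=-\sum_{i=1}^m\{\overline\nabla_{e_i}\overline\nabla_{e_i}V-\overline\nabla_{\nabla_{e_i}e_i}V\},$$ $$J(V)=\overline\Delta V-\sum_{i=1}^m R^N(V,d\varphi(e_i))d\varphi(e_i),\qquad R^N(X,Y)=\nabla^N_X\nabla^N_Y-\nabla^N_Y\nabla^N_X-\nabla^N_{[X,Y]},$$ for $V\in\Gamma(\varphi^{-1}TN)$, and let the trienergy be $$E_3(\varphi)=\frac12\int_M|(d+\delta)(d+\delta)(d+\delta)\varphi|^2\,v_g,\qquad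 (d+\delta)\varphi:=d\varphi .$$ Let $\varphi_t$ $(-\epsilon<t<\epsilon)$ be a smooth variation of $\varphi=\varphi_0$, that is, $(t,x)\mapsto\varphi_t(x)$ is a smooth map $(-\epsilon,\epsilon)\times M\to N$, with variation vector field $V(x)=\frac{d}{dt}\big|_{t=0}\varphi_t(x)$. Then all integrands above and below are integrable (for every $\varphi_t$ in the case of $E_3$), $E_3(\varphi_t)=\frac12\int_M|\overline\nabla\tau(\varphi_t)|^2\,v_g$ for every $t\in(-\epsilon,\epsilon)$, where $|\overline\nabla W|^2=\sum_i|\overline\nabla_{e_i}W|^2$, the function $t\mapsto E_3(\varphi_t)$ is differentiable at $t=0$, and $$\frac{d}{dt}\Big|_{t=0}E_3(\varphi_t)=-\int_M\langle\tau_3(\varphi),V\rangle\,v_g,\qquad \tau_3(\varphi)=J(\overline\Delta(\tau(\varphi)))-\sum_{i=1}^m R^N(\overline\nabla_{e_i}\tau(\varphi),\tau(\varphi))\,d\varphi(e_i).$$ -/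

import Mathlib

open Bundle Set MeasureTheory
open scoped Manifold ContDiff

noncomputable section

namespace Riem

/-- The standard Euclidean model space of dimension `k`. -/
abbrev Model (k : ℕ) : Type := EuclideanSpace ℝ (Fin k)

section Tangent

variable {k : ℕ} {N : Type*} [TopologicalSpace N] [ChartedSpace (Model k) N]

instance finiteDimensionalTangentSpace (q : N) : FiniteDimensional ℝ (TangentSpace (𝓡 k) q) :=
  inferInstanceAs (FiniteDimensional ℝ (Model k))

/-- The extension of a tangent vector `u` at `q` to the vector field around `q` which has constant
coefficients in the preferred chart at `q`. -/
def constField [IsManifold (𝓡 k) ∞ N] {q : N} (u : TangentSpace (𝓡 k) q) (q' : N) :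
    TangentSpace (𝓡 k) q' :=
  FiberBundle.extend (Model k) (E := fun p : N ↦ TangentSpace (𝓡 k) p) u q'

variable [RiemannianBundle (fun q : N ↦ TangentSpace (𝓡 k) q)]

variable (k) in
/-- An orthonormal basis `e₁, …, e_k` of the tangent space at `q`. -/
def onb (q : N) :
    OrthonormalBasis (Fin (Module.finrank ℝ (TangentSpace (𝓡 k) q))) ℝ (TangentSpace (𝓡 k) q) :=
  stdOrthonormalBasis ℝ (TangentSpace (𝓡 k) q)

variable [IsManifold (𝓡 k) ∞ N]

/-- The Christoffel symbols of the first kind at `q` in the preferred chart at `q`, i.e.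
`½ (u⟨∂_v, ∂_w⟩ + v⟨∂_u, ∂_w⟩ - w⟨∂_u, ∂_v⟩)`, where `∂_u`, `∂_v`, `∂_w` are the vector fields
with constant coefficients `u`, `v`, `w` in that chart. -/
def christoffelFirst (q : N) (u v w : TangentSpace (𝓡 k) q) : ℝ :=
  (1 / 2) * (mvfderiv (𝓡 k) (fun q' : N ↦ inner ℝ (constField v q') (constField w q')) q u
    + mvfderiv (𝓡 k) (fun q' : N ↦ inner ℝ (constField u q') (constField w q')) q v
    - mvfderiv (𝓡 k) (fun q' : N ↦ inner ℝ (constField u q') (constField v q')) q w)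

/-- The Christoffel symbols of the second kind at `q` in the preferred chart at `q`: the vector
`Γ(u, v)` with `⟨Γ(u, v), w⟩ = christoffelFirst q u v w` for all `w`. -/
def christoffel (q : N) (u v : TangentSpace (𝓡 k) q) : TangentSpace (𝓡 k) q :=
  ∑ i, christoffelFirst q u v (onb k q i) • onb k q i

end Tangent

section Along

variable {m n : ℕ}
  {M : Type*} [TopologicalSpace M] [ChartedSpace (Model m) M]
  {N : Type*} [TopologicalSpace N] [ChartedSpace (Model n) N] [IsManifold (𝓡 n) ∞ N]
  [RiemannianBundle (fun q : N ↦ TangentSpace (𝓡 n) q)]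

variable (m n) in
/-- The connection `∇̄` induced on `φ⁻¹TN` by the Levi-Civita connection of `N`:
`covAlong m n φ W x X` is `∇̄_X W` at `x`, for a section `W` of `φ⁻¹TN` and `X` in `T_xM`.
In the preferred chart at `φ x` it is the derivative of the components of `W` in the direction
`X` plus the Christoffel term `Γ(dφ(X), W)`. -/
def covAlong (φ : M → N) (W : ∀ x, TangentSpace (𝓡 n) (φ x)) (x : M)
    (X : TangentSpace (𝓡 m) x) : TangentSpace (𝓡 n) (φ x) :=
  (trivializationAt (Model n) (fun q : N ↦ TangentSpace (𝓡 n) q) (φ x)).symm (φ x)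
      (mvfderiv (𝓡 m) (fun x' : M ↦
        (trivializationAt (Model n) (fun q : N ↦ TangentSpace (𝓡 n) q) (φ x)
          ⟨φ x', W x'⟩).2) x X)
    + christoffel (φ x) (mfderiv (𝓡 m) (𝓡 n) φ x X) (W x)

end Along

section LeviCivita

variable {k : ℕ} {N : Type*} [TopologicalSpace N] [ChartedSpace (Model k) N]
  [IsManifold (𝓡 k) ∞ N] [RiemannianBundle (fun q : N ↦ TangentSpace (𝓡 k) q)]

/-- The Levi-Civita connection: `lcConn Y x X` is `∇_X Y` at `x`. -/
def lcConn (Y : ∀ q : N, TangentSpace (𝓡 k) q) (q : N) (X : TangentSpace (𝓡 k) q) :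
    TangentSpace (𝓡 k) q :=
  covAlong k k (fun q' : N ↦ q') Y q X

/-- The curvature tensor
`R(u, v) w = ∇_U ∇_V W - ∇_V ∇_U W - ∇_[U,V] W`,
where `U`, `V`, `W` extend `u`, `v`, `w`. -/
def curvature (q : N) (u v w : TangentSpace (𝓡 k) q) : TangentSpace (𝓡 k) q :=
  lcConn (fun q' ↦ lcConn (constField w) q' (constField v q')) q u
    - lcConn (fun q' ↦ lcConn (constField w) q' (constField u q')) q v
    - lcConn (constField w) q (VectorField.mlieBracket (𝓡 k) (constField u) (constField v) q)

variable (k) in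
/-- The vector field `∂_i` of the preferred chart at `q`. -/
def coordField (q : N) (i : Fin k) (q' : N) : TangentSpace (𝓡 k) q' :=
  (trivializationAt (Model k) (fun p : N ↦ TangentSpace (𝓡 k) p) q).symm q'
    (EuclideanSpace.single i (1 : ℝ))

variable [MeasurableSpace N]

variable (k) in
/-- The Riemannian measure on the domain of the preferred chart at `q`, extended by zero:
`√(det g_ij) dy¹ … dy^k` in the coordinates of that chart. -/
def chartVolume (q : N) : Measure N :=
  ((volume.restrict (extChartAt (𝓡 k) q).target).withDensity fun y ↦
      ENNReal.ofReal (Real.sqrt (Matrix.of fun i j : Fin k ↦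
        (inner ℝ (coordField k q i ((extChartAt (𝓡 k) q).symm y))
          (coordField k q j ((extChartAt (𝓡 k) q).symm y)) : ℝ)).det)).map
    (extChartAt (𝓡 k) q).symm

variable (k N) in
/-- The Riemannian measure `v_g`: the least measure which dominates the Riemannian measures of the
chart domains. As those agree on overlaps, it restricts to each of them. -/
def riemannianVolume : Measure N := ⨆ q : N, chartVolume k q

end LeviCivita

section Maps

variable (m n : ℕ)
  {M : Type*} [TopologicalSpace M] [ChartedSpace (Model m) M] [IsManifold (𝓡 m) ∞ M]
  [RiemannianBundle (fun x : M ↦ TangentSpace (𝓡 m) x)]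
  {N : Type*} [TopologicalSpace N] [ChartedSpace (Model n) N] [IsManifold (𝓡 n) ∞ N]
  [RiemannianBundle (fun q : N ↦ TangentSpace (𝓡 n) q)]

/-- The second fundamental form `B(φ)(X, Y) = ∇̄_X (dφ(Y)) - dφ(∇_X Y)`. -/
def secondFundamentalForm (φ : M → N) (x : M) (X Y : TangentSpace (𝓡 m) x) :
    TangentSpace (𝓡 n) (φ x) :=
  covAlong m n φ (fun x' ↦ mfderiv (𝓡 m) (𝓡 n) φ x' (constField Y x')) x X
    - mfderiv (𝓡 m) (𝓡 n) φ x (lcConn (constField Y) x X)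

/-- The tension field `τ(φ) = ∑ B(φ)(e_i, e_i)`. -/
def tension (φ : M → N) (x : M) : TangentSpace (𝓡 n) (φ x) :=
  ∑ i, secondFundamentalForm m n φ x (onb m x i) (onb m x i)

/-- The rough Laplacian `Δ̄V = -∑ (∇̄_{e_i} ∇̄_{e_i} V - ∇̄_{∇_{e_i} e_i} V)`. -/
def roughLaplacian (φ : M → N) (V : ∀ x, TangentSpace (𝓡 n) (φ x)) (x : M) :
    TangentSpace (𝓡 n) (φ x) :=
  -∑ i, (covAlong m n φ (fun x' ↦ covAlong m n φ V x' (constField (onb m x i) x')) x (onb m x i)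
    - covAlong m n φ V x (lcConn (constField (onb m x i)) x (onb m x i)))

/-- The Jacobi operator `J(V) = Δ̄V - ∑ R(V, dφ(e_i)) dφ(e_i)`. -/
def jacobiOperator (φ : M → N) (V : ∀ x, TangentSpace (𝓡 n) (φ x)) (x : M) :
    TangentSpace (𝓡 n) (φ x) :=
  roughLaplacian m n φ V x
    - ∑ i, curvature (φ x) (V x) (mfderiv (𝓡 m) (𝓡 n) φ x (onb m x i))
        (mfderiv (𝓡 m) (𝓡 n) φ x (onb m x i))

/-- The tritension field `τ₃(φ) = J(Δ̄τ(φ)) - ∑ R(∇̄_{e_i} τ(φ), τ(φ)) dφ(e_i)`. -/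
def tritension (φ : M → N) (x : M) : TangentSpace (𝓡 n) (φ x) :=
  jacobiOperator m n φ (roughLaplacian m n φ (tension m n φ)) x
    - ∑ i, curvature (φ x) (covAlong m n φ (tension m n φ) x (onb m x i)) (tension m n φ x)
        (mfderiv (𝓡 m) (𝓡 n) φ x (onb m x i))

/-- Differential forms of degree `p` on `M` with values in `φ⁻¹TN`, as families of functions of `p`
tangent vectors. (All the forms that occur below are multilinear, alternating and smooth if `φ` is
smooth; this is not recorded in the type.) -/
abbrev FormAlong (m n : ℕ) {M : Type*} [TopologicalSpace M] [ChartedSpace (Model m) M]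
    {N : Type*} [TopologicalSpace N] [ChartedSpace (Model n) N] (φ : M → N) (p : ℕ) : Type _ :=
  ∀ x : M, (Fin p → TangentSpace (𝓡 m) x) → TangentSpace (𝓡 n) (φ x)

/-- The induced connection on forms:
`(∇̃_X α)(Y₁, …, Y_p) = ∇̄_X (α(Y₁, …, Y_p)) - ∑_j α(Y₁, …, ∇_X Y_j, …, Y_p)`. -/
def covForm (φ : M → N) {p : ℕ} (α : FormAlong m n φ p) (x : M) (X : TangentSpace (𝓡 m) x)
    (Y : Fin p → TangentSpace (𝓡 m) x) : TangentSpace (𝓡 n) (φ x) :=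
  covAlong m n φ (fun x' ↦ α x' fun j ↦ constField (Y j) x') x X
    - ∑ j, α x (Function.update Y j (lcConn (constField (Y j)) x X))

/-- The exterior derivative
`(dα)(Y₀, …, Y_p) = ∑_i (-1)^i (∇̃_{Y_i} α)(Y₀, …, Ŷ_i, …, Y_p)`. -/
def extD (φ : M → N) {p : ℕ} (α : FormAlong m n φ p) : FormAlong m n φ (p + 1) := fun x Y ↦
  ∑ i : Fin (p + 1), (-1 : ℝ) ^ (i : ℕ) • covForm m n φ α x (Y i) (i.removeNth Y)

/-- The codifferential `(δα)(Y₁, …, Y_p) = -∑_i (∇̃_{e_i} α)(e_i, Y₁, …, Y_p)`. -/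
def codiff (φ : M → N) {p : ℕ} (α : FormAlong m n φ (p + 1)) : FormAlong m n φ p := fun x Y ↦
  -∑ i, covForm m n φ α x (onb m x i) (Fin.cons (onb m x i) Y)

/-- The operator `d + δ` on forms of mixed degree (`δ = 0` on forms of degree `0`). -/
def dPlusDelta (φ : M → N) (Ω : ∀ p, FormAlong m n φ p) : ∀ p, FormAlong m n φ p
  | 0 => codiff m n φ (Ω 1)
  | p + 1 => fun x Y ↦ extD m n φ (Ω p) x Y + codiff m n φ (Ω (p + 2)) x Y

/-- `(d + δ)φ = dφ`, a form of degree one. -/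
def differentialForm (φ : M → N) : ∀ p, FormAlong m n φ p
  | 1 => fun x Y ↦ mfderiv (𝓡 m) (𝓡 n) φ x (Y 0)
  | _ => fun _ _ ↦ 0

/-- The squared norm at `x` of a form `Ω` of mixed degree:
the sum over all degrees `p ≤ m` of `(1 / p!) ∑ |Ω(e_{i₁}, …, e_{i_p})|²`. -/
def formNormSq (φ : M → N) (Ω : ∀ p, FormAlong m n φ p) (x : M) : ℝ :=
  ∑ p ∈ Finset.range (m + 1), (1 / (p.factorial : ℝ)) *
    ∑ i : Fin p → Fin (Module.finrank ℝ (TangentSpace (𝓡 m) x)),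
      ‖Ω p x fun j ↦ onb m x (i j)‖ ^ 2

/-- `|(d + δ)(d + δ)(d + δ)φ|²` at `x`. -/
def trienergyDensity (φ : M → N) (x : M) : ℝ :=
  formNormSq m n φ (dPlusDelta m n φ (dPlusDelta m n φ (differentialForm m n φ))) x

/-- `|∇̄W|² = ∑ |∇̄_{e_i} W|²` at `x`. -/
def covNormSq (φ : M → N) (W : ∀ x, TangentSpace (𝓡 n) (φ x)) (x : M) : ℝ :=
  ∑ i, ‖covAlong m n φ W x (onb m x i)‖ ^ 2

/-- The trienergy `E₃(φ) = ½ ∫ |(d + δ)(d + δ)(d + δ)φ|² v_g`. -/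
def trienergy [MeasurableSpace M] (φ : M → N) : ℝ :=
  (1 / 2) * ∫ x, trienergyDensity m n φ x ∂(riemannianVolume m M)

/-- The variation vector field `V(x) = d/dt|_{t=0} φ_t(x)`, a section of `φ₀⁻¹TN`. -/
def variationField (n : ℕ) {M N : Type*} [TopologicalSpace N] [ChartedSpace (Model n) N]
    (Φ : ℝ → M → N) (x : M) : TangentSpace (𝓡 n) (Φ 0 x) :=
  mfderiv 𝓘(ℝ, ℝ) (𝓡 n) (fun t ↦ Φ t x) 0 (1 : ℝ)

end Maps

end Riem

end

/-!
The second fundamental form `∇̄dφ` is symmetric, so `d(dφ) = 0` and `(d + δ)dφ = δdφ = -τ(φ)`; the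
differential of a section is its covariant derivative, so `(d + δ)³φ = -∇̄τ(φ)` and
`E₃(φ) = ½ ∫ |∇̄τ(φ)|²`.

Along a variation with velocity `V`, commuting `∇̄_{∂/∂t}` with `∇̄_{e_i}` gives the pointwise
identity `½ ∂/∂t |∇̄τ|² = div α - ⟨τ₃(φ_t), V⟩`, where
`α = ⟨∇̄τ, ∇̄_{∂/∂t} τ⟩ + ⟨∇̄V, Δ̄τ⟩ - ⟨∇̄Δ̄τ, V⟩`: the curvature terms produced by the commutations
are those of `τ₃`, by the pair symmetry of the curvature tensor and
`∇̄_{∂/∂t} τ = ∑ {∇̄_{e_i} ∇̄_{e_i} V - ∇̄_{∇_{e_i} e_i} V + R(V, dφ(e_i)) dφ(e_i)} = -J(V)`.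
It remains to integrate over `M`, where the divergence contributes nothing.

In charts a vector field along a map is a function into a vector space, and covariant
derivatives along maps defined on space-time `ℝ × M` are explicit first-order operators, so the
pointwise identity is a computation with vector-valued functions.
-/

noncomputable section

set_option maxSynthPendingDepth 4

namespace Riem

section SecondDerivative

variable {E : Type*} [NormedAddCommGroup E] [NormedSpace ℝ E]
  {F : Type*} [NormedAddCommGroup F] [NormedSpace ℝ F] {f : E → F} {z : E}

lemma contDiffAt_fderiv (hf : ContDiffAt ℝ ∞ f z) : ContDiffAt ℝ ∞ (fderiv ℝ f) z :=
  hf.fderiv_right (by simp)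

lemma contDiffAt_fderiv_apply (hf : ContDiffAt ℝ ∞ f z) (ξ : E) :
    ContDiffAt ℝ ∞ (fun z ↦ fderiv ℝ f z ξ) z :=
  (contDiffAt_fderiv hf).clm_apply contDiffAt_const

lemma differentiableAt_fderiv (hf : ContDiffAt ℝ 2 f z) : DifferentiableAt ℝ (fderiv ℝ f) z :=
  (hf.fderiv_right (m := 1) (by norm_num)).differentiableAt (by simp)

lemma differentiableAt_fderiv_apply (hf : ContDiffAt ℝ 2 f z) (ξ : E) :
    DifferentiableAt ℝ (fun z ↦ fderiv ℝ f z ξ) z :=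
  (differentiableAt_fderiv hf).clm_apply (differentiableAt_const _)

lemma fderiv_fderiv_comm (hf : ContDiffAt ℝ 2 f z) (ξ η : E) :
    fderiv ℝ (fderiv ℝ f) z ξ η = fderiv ℝ (fderiv ℝ f) z η ξ :=
  hf.isSymmSndFDerivAt (by simp) ξ η

lemma fderiv_clm_apply_const {H : Type*} [NormedAddCommGroup H] [NormedSpace ℝ H]
    {A : E → H →L[ℝ] F} (hA : DifferentiableAt ℝ A z) (ξ : E) (v : H) :
    fderiv ℝ (fun z ↦ A z v) z ξ = fderiv ℝ A z ξ v := by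
  rw [fderiv_clm_apply hA (differentiableAt_const _)]
  simp

lemma fderiv_clm_apply_apply_const {H : Type*} [NormedAddCommGroup H] [NormedSpace ℝ H]
    {A : E → F →L[ℝ] F →L[ℝ] H} (hA : DifferentiableAt ℝ A z) (ξ : E) (v w : F) :
    fderiv ℝ (fun z ↦ A z v w) z ξ = fderiv ℝ A z ξ v w := by
  rw [fderiv_clm_apply_const (hA.clm_apply (differentiableAt_const _)), fderiv_clm_apply_const hA]

lemma fderiv_comp_clm_apply_apply {H : Type*} [NormedAddCommGroup H] [NormedSpace ℝ H]
    {A : F → F →L[ℝ] F →L[ℝ] H} {V W : E → F} (hA : DifferentiableAt ℝ A (f z))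
    (hf : DifferentiableAt ℝ f z) (hV : DifferentiableAt ℝ V z) (hW : DifferentiableAt ℝ W z)
    (ξ : E) :
    fderiv ℝ (fun z ↦ A (f z) (V z) (W z)) z ξ =
      fderiv ℝ A (f z) (fderiv ℝ f z ξ) (V z) (W z) + A (f z) (fderiv ℝ V z ξ) (W z)
        + A (f z) (V z) (fderiv ℝ W z ξ) := by
  have hAf : DifferentiableAt ℝ (fun z ↦ A (f z)) z := hA.comp z hf
  have chain : fderiv ℝ (fun z ↦ A (f z)) z = (fderiv ℝ A (f z)).comp (fderiv ℝ f z) :=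
    fderiv_comp z hA hf
  rw [fderiv_clm_apply (hAf.clm_apply hV) hW, fderiv_clm_apply hAf hV, chain]
  simp only [add_apply, ContinuousLinearMap.comp_apply, ContinuousLinearMap.flip_apply]
  abel

end SecondDerivative

section Connection

variable {E : Type*} [NormedAddCommGroup E] [NormedSpace ℝ E]
  {F : Type*} [NormedAddCommGroup F] [NormedSpace ℝ F]

/-- The covariant derivative `ξ ↦ ∇_ξ W` of a vector field `W` along a map `f` into a vector space,
for the connection with Christoffel symbols `Γ`. -/
def covDeriv (Γ : F → F →L[ℝ] F →L[ℝ] F) (f W : E → F) (z : E) : E →L[ℝ] F :=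
  fderiv ℝ W z + ((Γ (f z)).flip (W z)).comp (fderiv ℝ f z)

/-- The curvature tensor `R(u, v) w` at `y` of the connection with Christoffel symbols `Γ`. -/
def curvTensor (Γ : F → F →L[ℝ] F →L[ℝ] F) (y u v w : F) : F :=
  fderiv ℝ Γ y u v w - fderiv ℝ Γ y v u w + Γ y u (Γ y v w) - Γ y v (Γ y u w)

/-- The trace `∑ (∇_{e_i} A)(e_i)` of the covariant derivative of a one-form `A` with values in
vector fields along `f`, where the fields `e_i` are constant and `ζ` stands for `∑ ∇_{e_i} e_i`. -/
def covTrace {ι : Type*} [Fintype ι] (Γ : F → F →L[ℝ] F →L[ℝ] F) (f : E → F) (A : E → E →L[ℝ] F)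
    (e : ι → E) (ζ z : E) : F :=
  ∑ i, covDeriv Γ f (fun z ↦ A z (e i)) z (e i) - A z ζ

variable {Γ : F → F →L[ℝ] F →L[ℝ] F} {f W : E → F} {z : E}

lemma covDeriv_apply (ξ : E) :
    covDeriv Γ f W z ξ = fderiv ℝ W z ξ + Γ (f z) (fderiv ℝ f z ξ) (W z) := rfl

lemma contDiffAt_covDeriv (hΓ : ContDiffAt ℝ ∞ Γ (f z)) (hf : ContDiffAt ℝ ∞ f z)
    (hW : ContDiffAt ℝ ∞ W z) : ContDiffAt ℝ ∞ (covDeriv Γ f W) z := by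
  have hflip : ContDiffAt ℝ ∞ (fun z ↦ (Γ (f z)).flip) z :=
    (ContinuousLinearMap.flipₗᵢ ℝ F F F).toContinuousLinearEquiv.contDiff.contDiffAt.comp z
      (hΓ.comp z hf)
  exact (contDiffAt_fderiv hW).add ((hflip.clm_apply hW).clm_comp (contDiffAt_fderiv hf))

lemma contDiffAt_covDeriv_apply (hΓ : ContDiffAt ℝ ∞ Γ (f z)) (hf : ContDiffAt ℝ ∞ f z)
    (hW : ContDiffAt ℝ ∞ W z) (ξ : E) : ContDiffAt ℝ ∞ (fun z ↦ covDeriv Γ f W z ξ) z :=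
  (contDiffAt_covDeriv hΓ hf hW).clm_apply contDiffAt_const

lemma covDeriv_sub {W₁ W₂ : E → F} (h₁ : DifferentiableAt ℝ W₁ z) (h₂ : DifferentiableAt ℝ W₂ z) :
    covDeriv Γ f (fun z ↦ W₁ z - W₂ z) z = covDeriv Γ f W₁ z - covDeriv Γ f W₂ z := by
  ext ξ
  simp only [covDeriv_apply, fderiv_fun_sub h₁ h₂, sub_apply, map_sub]
  abel

lemma covDeriv_sum {ι : Type*} (s : Finset ι) (W : ι → E → F)
    (h : ∀ i ∈ s, DifferentiableAt ℝ (W i) z) :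
    covDeriv Γ f (fun z ↦ ∑ i ∈ s, W i z) z = ∑ i ∈ s, covDeriv Γ f (W i) z := by
  ext ξ
  simp only [covDeriv_apply, fderiv_fun_sum h, sum_apply, map_sum, Finset.sum_add_distrib]

lemma covDeriv_congr {f' W' : E → F} (hf : f =ᶠ[nhds z] f') (hW : W =ᶠ[nhds z] W') :
    covDeriv Γ f W z = covDeriv Γ f' W' z := by
  simp only [covDeriv, hf.fderiv_eq, hf.eq_of_nhds, hW.fderiv_eq, hW.eq_of_nhds]

lemma fderiv_covDeriv_apply (hΓ : DifferentiableAt ℝ Γ (f z)) (hf : ContDiffAt ℝ 2 f z)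
    (hW : ContDiffAt ℝ 2 W z) (ξ η : E) :
    fderiv ℝ (fun z ↦ covDeriv Γ f W z η) z ξ =
      fderiv ℝ (fderiv ℝ W) z ξ η
        + fderiv ℝ Γ (f z) (fderiv ℝ f z ξ) (fderiv ℝ f z η) (W z)
        + Γ (f z) (fderiv ℝ (fderiv ℝ f) z ξ η) (W z)
        + Γ (f z) (fderiv ℝ f z η) (fderiv ℝ W z ξ) := by
  have hfd := hf.differentiableAt (by simp)
  have hWd := hW.differentiableAt (by simp)
  have hdf := differentiableAt_fderiv_apply hf η
  have hΓW : DifferentiableAt ℝ (fun z ↦ Γ (f z) (fderiv ℝ f z η) (W z)) z :=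
    ((hΓ.comp z hfd).clm_apply hdf).clm_apply hWd
  simp only [covDeriv_apply]
  rw [fderiv_fun_add (differentiableAt_fderiv_apply hW η) hΓW, add_apply,
    fderiv_comp_clm_apply_apply hΓ hfd hdf hWd, fderiv_clm_apply_const (differentiableAt_fderiv hW),
    fderiv_clm_apply_const (differentiableAt_fderiv hf)]
  abel

lemma covDeriv_covDeriv_sub_swap (hΓ : DifferentiableAt ℝ Γ (f z)) (hf : ContDiffAt ℝ 2 f z)
    (hW : ContDiffAt ℝ 2 W z) (ξ η : E) :
    covDeriv Γ f (fun z ↦ covDeriv Γ f W z η) z ξ - covDeriv Γ f (fun z ↦ covDeriv Γ f W z ξ) z η =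
      curvTensor Γ (f z) (fderiv ℝ f z ξ) (fderiv ℝ f z η) (W z) := by
  have outer (ξ η : E) : covDeriv Γ f (fun z ↦ covDeriv Γ f W z η) z ξ =
      fderiv ℝ (fun z ↦ covDeriv Γ f W z η) z ξ
        + Γ (f z) (fderiv ℝ f z ξ) (fderiv ℝ W z η + Γ (f z) (fderiv ℝ f z η) (W z)) := rfl
  rw [outer, outer, fderiv_covDeriv_apply hΓ hf hW, fderiv_covDeriv_apply hΓ hf hW,
    fderiv_fderiv_comm hW ξ η, fderiv_fderiv_comm hf ξ η, curvTensor]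
  simp only [map_add]
  abel

lemma covDeriv_fderiv_comm (hsymm : ∀ u v, Γ (f z) u v = Γ (f z) v u) (hf : ContDiffAt ℝ 2 f z)
    (ξ η : E) :
    covDeriv Γ f (fun z ↦ fderiv ℝ f z η) z ξ = covDeriv Γ f (fun z ↦ fderiv ℝ f z ξ) z η := by
  simp only [covDeriv_apply, fderiv_clm_apply_const (differentiableAt_fderiv hf)]
  rw [fderiv_fderiv_comm hf, hsymm]

lemma curvTensor_swap (Γ : F → F →L[ℝ] F →L[ℝ] F) (y u v w : F) :
    curvTensor Γ y u v w = -curvTensor Γ y v u w := by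
  simp only [curvTensor]; abel

lemma curvTensor_bianchi {y : F} (hΓ : DifferentiableAt ℝ Γ y)
    (hsymm : ∀ᶠ y in nhds y, ∀ u v, Γ y u v = Γ y v u) (u v w : F) :
    curvTensor Γ y u v w + curvTensor Γ y v w u + curvTensor Γ y w u v = 0 := by
  have hdsymm (a b c : F) : fderiv ℝ Γ y a b c = fderiv ℝ Γ y a c b := by
    rw [← fderiv_clm_apply_apply_const hΓ, ← fderiv_clm_apply_apply_const hΓ]
    exact DFunLike.congr_fun (Filter.EventuallyEq.fderiv_eq (hsymm.mono fun y h ↦ h b c)) a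
  have hs := hsymm.self_of_nhds
  simp only [curvTensor]
  rw [hdsymm u v w, hdsymm v w u, hdsymm w u v, hs v w, hs u w, hs u v]
  abel

end Connection

section Metric

variable {F : Type*} [NormedAddCommGroup F] [NormedSpace ℝ F]

/-- `G` is a smooth Riemannian metric on the open subset `D` of a vector space. -/
structure IsMetricOn (G : F → F →L[ℝ] F →L[ℝ] ℝ) (D : Set F) : Prop where
  isOpen : IsOpen D
  contDiffOn : ContDiffOn ℝ ∞ G D
  symm : ∀ y ∈ D, ∀ u v, G y u v = G y v u
  pos : ∀ y ∈ D, ∀ u, u ≠ 0 → 0 < G y u u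

/-- The Christoffel symbols of the first kind
`(u, v, w) ↦ ½ (∂_u G(v, w) + ∂_v G(u, w) - ∂_w G(u, v))` of the metric `G`. -/
def koszul (G : F → F →L[ℝ] F →L[ℝ] ℝ) (y : F) : F →L[ℝ] F →L[ℝ] F →L[ℝ] ℝ :=
  letI flip : (F →L[ℝ] F →L[ℝ] ℝ) →L[ℝ] (F →L[ℝ] F →L[ℝ] ℝ) :=
    (ContinuousLinearMap.flipₗᵢ ℝ F F ℝ).toContinuousLinearEquiv
  (1 / 2 : ℝ) • (fderiv ℝ G y + (fderiv ℝ G y).flip - flip.comp (fderiv ℝ G y).flip)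

/-- The Christoffel symbols of the second kind of the metric `G`, as a connection. -/
def leviCivita (G : F → F →L[ℝ] F →L[ℝ] ℝ) (y : F) : F →L[ℝ] F →L[ℝ] F :=
  ((ContinuousLinearMap.compL ℝ F (F →L[ℝ] ℝ) F) (G y).inverse).comp (koszul G y)

lemma koszul_apply (G : F → F →L[ℝ] F →L[ℝ] ℝ) (y u v w : F) :
    koszul G y u v w =
      (1 / 2) * (fderiv ℝ G y u v w + fderiv ℝ G y v u w - fderiv ℝ G y w u v) := by
  simp [koszul]

lemma leviCivita_apply (G : F → F →L[ℝ] F →L[ℝ] ℝ) (y u v : F) :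
    leviCivita G y u v = (G y).inverse (koszul G y u v) := rfl

lemma contDiffAt_koszul {G : F → F →L[ℝ] F →L[ℝ] ℝ} {y : F} (hG : ContDiffAt ℝ ∞ G y) :
    ContDiffAt ℝ ∞ (koszul G) y := by
  have hflip : ContDiffAt ℝ ∞ (fun y ↦ (fderiv ℝ G y).flip) y :=
    (ContinuousLinearMap.flipₗᵢ ℝ F F (F →L[ℝ] ℝ)).toContinuousLinearEquiv.contDiff.contDiffAt.comp
      y (contDiffAt_fderiv hG)
  exact (contDiffAt_const (c := (1 / 2 : ℝ))).smul
    (((contDiffAt_fderiv hG).add hflip).sub (contDiffAt_const.clm_comp hflip))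

namespace IsMetricOn

variable {G : F → F →L[ℝ] F →L[ℝ] ℝ} {D : Set F}

lemma contDiffAt (hG : IsMetricOn G D) {y : F} (hy : y ∈ D) : ContDiffAt ℝ ∞ G y :=
  hG.contDiffOn.contDiffAt (hG.isOpen.mem_nhds hy)

lemma differentiableAt (hG : IsMetricOn G D) {y : F} (hy : y ∈ D) : DifferentiableAt ℝ G y :=
  (hG.contDiffAt hy).differentiableAt (by simp)

lemma ext (hG : IsMetricOn G D) {y : F} (hy : y ∈ D) {u v : F} (h : ∀ w, G y u w = G y v w) :
    u = v := by
  by_contra hne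
  have hpos := hG.pos y hy (u - v) (sub_ne_zero.2 hne)
  simp only [map_sub, sub_apply, h, sub_self] at hpos
  exact hpos.false

lemma fderiv_symm (hG : IsMetricOn G D) {y : F} (hy : y ∈ D) (u v w : F) :
    fderiv ℝ G y u v w = fderiv ℝ G y u w v := by
  rw [← fderiv_clm_apply_apply_const (hG.differentiableAt hy),
    ← fderiv_clm_apply_apply_const (hG.differentiableAt hy)]
  refine DFunLike.congr_fun (Filter.EventuallyEq.fderiv_eq ?_) u
  filter_upwards [hG.isOpen.mem_nhds hy] with y' hy' using hG.symm y' hy' v w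

variable [FiniteDimensional ℝ F]

lemma isInvertible (hG : IsMetricOn G D) {y : F} (hy : y ∈ D) : (G y).IsInvertible := by
  have hinj : Function.Injective (G y : F →ₗ[ℝ] (F →L[ℝ] ℝ)) := fun u v huv ↦
    hG.ext hy fun w ↦ DFunLike.congr_fun huv w
  have hrank : Module.finrank ℝ F = Module.finrank ℝ (F →L[ℝ] ℝ) := by
    rw [← (LinearMap.toContinuousLinearMap : (F →ₗ[ℝ] ℝ) ≃ₗ[ℝ] (F →L[ℝ] ℝ)).finrank_eq]
    exact (Subspace.dual_finrank_eq (K := ℝ) (V := F)).symm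
  exact ⟨(LinearEquiv.ofInjectiveOfFinrankEq _ hinj hrank).toContinuousLinearEquiv, rfl⟩

lemma apply_leviCivita (hG : IsMetricOn G D) {y : F} (hy : y ∈ D) (u v w : F) :
    G y (leviCivita G y u v) w =
      (1 / 2) * (fderiv ℝ G y u v w + fderiv ℝ G y v u w - fderiv ℝ G y w u v) := by
  rw [leviCivita_apply, (hG.isInvertible hy).self_apply_inverse, koszul_apply]

lemma contDiffAt_inverse (hG : IsMetricOn G D) {y : F} (hy : y ∈ D) :
    ContDiffAt ℝ ∞ (fun y ↦ (G y).inverse) y := by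
  have : CompleteSpace F := FiniteDimensional.complete ℝ F
  exact (hG.isInvertible hy).contDiffAt_map_inverse.comp y (hG.contDiffAt hy)

lemma contDiffAt_leviCivita (hG : IsMetricOn G D) {y : F} (hy : y ∈ D) :
    ContDiffAt ℝ ∞ (leviCivita G) y :=
  ((ContinuousLinearMap.compL ℝ F (F →L[ℝ] ℝ) F).contDiff.contDiffAt.comp y
    (hG.contDiffAt_inverse hy)).clm_comp (contDiffAt_koszul (hG.contDiffAt hy))

lemma leviCivita_symm (hG : IsMetricOn G D) {y : F} (hy : y ∈ D) (u v : F) :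
    leviCivita G y u v = leviCivita G y v u := by
  refine hG.ext hy fun w ↦ ?_
  rw [hG.apply_leviCivita hy, hG.apply_leviCivita hy, hG.fderiv_symm hy w u v]
  ring

section Along

variable {E : Type*} [NormedAddCommGroup E] [NormedSpace ℝ E] {f V W : E → F} {z : E}

lemma fderiv_along (hG : IsMetricOn G D) (hz : f z ∈ D) (hf : DifferentiableAt ℝ f z)
    (hV : DifferentiableAt ℝ V z) (hW : DifferentiableAt ℝ W z) (ξ : E) :
    fderiv ℝ (fun z ↦ G (f z) (V z) (W z)) z ξ =
      G (f z) (covDeriv (leviCivita G) f V z ξ) (W z)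
        + G (f z) (V z) (covDeriv (leviCivita G) f W z ξ) := by
  rw [fderiv_comp_clm_apply_apply (hG.differentiableAt hz) hf hV hW]
  simp only [covDeriv_apply, add_apply, map_add, hG.apply_leviCivita hz]
  rw [hG.symm _ hz (V z) (leviCivita G (f z) (fderiv ℝ f z ξ) (W z)), hG.apply_leviCivita hz,
    hG.fderiv_symm hz (fderiv ℝ f z ξ) (W z) (V z),
    hG.fderiv_symm hz (W z) (fderiv ℝ f z ξ) (V z),
    hG.fderiv_symm hz (V z) (fderiv ℝ f z ξ) (W z)]
  ring

lemma fderiv_fderiv_along (hG : IsMetricOn G D) (hz : f z ∈ D) (hf : ContDiffAt ℝ ∞ f z)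
    (hV : ContDiffAt ℝ ∞ V z) (hW : ContDiffAt ℝ ∞ W z) (ξ η : E) :
    fderiv ℝ (fderiv ℝ (fun z ↦ G (f z) (V z) (W z))) z ξ η =
      G (f z) (covDeriv (leviCivita G) f (fun z ↦ covDeriv (leviCivita G) f V z η) z ξ) (W z)
        + G (f z) (covDeriv (leviCivita G) f V z η) (covDeriv (leviCivita G) f W z ξ)
        + (G (f z) (covDeriv (leviCivita G) f V z ξ) (covDeriv (leviCivita G) f W z η)
        + G (f z) (V z)
            (covDeriv (leviCivita G) f (fun z ↦ covDeriv (leviCivita G) f W z η) z ξ)) := by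
  have hGf : ContDiffAt ℝ ∞ (fun z ↦ G (f z)) z := (hG.contDiffAt hz).comp z hf
  have hΓ := hG.contDiffAt_leviCivita hz
  have hfd := hf.differentiableAt (by simp)
  have hVd := hV.differentiableAt (by simp)
  have hWd := hW.differentiableAt (by simp)
  have hV' := contDiffAt_covDeriv_apply hΓ hf hV η
  have hW' := contDiffAt_covDeriv_apply hΓ hf hW η
  have hfirst : (fun z ↦ fderiv ℝ (fun z ↦ G (f z) (V z) (W z)) z η) =ᶠ[nhds z] fun z ↦
      G (f z) (covDeriv (leviCivita G) f V z η) (W z)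
        + G (f z) (V z) (covDeriv (leviCivita G) f W z η) := by
    filter_upwards [hf.continuousAt.preimage_mem_nhds (hG.isOpen.mem_nhds hz),
      (hf.of_le (m := 1) (by simp)).eventually (by simp),
      (hV.of_le (m := 1) (by simp)).eventually (by simp),
      (hW.of_le (m := 1) (by simp)).eventually (by simp)] with z' hz' hf' hV' hW'
    exact hG.fderiv_along hz' (hf'.differentiableAt (by simp)) (hV'.differentiableAt (by simp))
      (hW'.differentiableAt (by simp)) η
  rw [← fderiv_clm_apply_const (differentiableAt_fderiv
      (((hGf.clm_apply hV).clm_apply hW).of_le ENat.LEInfty.out)), hfirst.fderiv_eq,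
    fderiv_fun_add (((hGf.clm_apply hV').clm_apply hW).differentiableAt (by simp))
      (((hGf.clm_apply hV).clm_apply hW').differentiableAt (by simp)), add_apply,
    hG.fderiv_along hz hfd (hV'.differentiableAt (by simp)) hWd,
    hG.fderiv_along hz hfd hVd (hW'.differentiableAt (by simp))]

lemma apply_curvTensor_skew_along (hG : IsMetricOn G D) (hz : f z ∈ D) (hf : ContDiffAt ℝ ∞ f z)
    (hV : ContDiffAt ℝ ∞ V z) (hW : ContDiffAt ℝ ∞ W z) (ξ η : E) :
    G (f z) (curvTensor (leviCivita G) (f z) (fderiv ℝ f z ξ) (fderiv ℝ f z η) (V z)) (W z) =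
      -G (f z) (V z)
        (curvTensor (leviCivita G) (f z) (fderiv ℝ f z ξ) (fderiv ℝ f z η) (W z)) := by
  have hΓ := (hG.contDiffAt_leviCivita hz).differentiableAt (by simp)
  have hf₂ : ContDiffAt ℝ 2 f z := hf.of_le ENat.LEInfty.out
  have hsmooth : ContDiffAt ℝ ∞ (fun z ↦ G (f z) (V z) (W z)) z :=
    (((hG.contDiffAt hz).comp z hf).clm_apply hV).clm_apply hW
  have hcomm := fderiv_fderiv_comm (hsmooth.of_le ENat.LEInfty.out) ξ η
  rw [hG.fderiv_fderiv_along hz hf hV hW, hG.fderiv_fderiv_along hz hf hV hW] at hcomm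
  rw [← covDeriv_covDeriv_sub_swap hΓ hf₂ (hV.of_le ENat.LEInfty.out),
    ← covDeriv_covDeriv_sub_swap hΓ hf₂ (hW.of_le ENat.LEInfty.out)]
  simp only [map_sub, sub_apply]
  linarith

end Along

lemma apply_curvTensor_skew (hG : IsMetricOn G D) {y : F} (hy : y ∈ D) (u v w x : F) :
    G y (curvTensor (leviCivita G) y u v w) x = -G y (curvTensor (leviCivita G) y u v x) w := by
  have h := hG.apply_curvTensor_skew_along (f := fun y ↦ y) (V := fun _ ↦ w) (W := fun _ ↦ x) hy
    contDiffAt_id contDiffAt_const contDiffAt_const u v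
  simp only [fderiv_fun_id, ContinuousLinearMap.id_apply] at h
  rw [h, hG.symm y hy]

lemma apply_curvTensor_bianchi (hG : IsMetricOn G D) {y : F} (hy : y ∈ D) (u v w x : F) :
    G y (curvTensor (leviCivita G) y u v w) x + G y (curvTensor (leviCivita G) y v w u) x
      + G y (curvTensor (leviCivita G) y w u v) x = 0 := by
  have hsymm : ∀ᶠ y in nhds y, ∀ u v, leviCivita G y u v = leviCivita G y v u := by
    filter_upwards [hG.isOpen.mem_nhds hy] with y' hy' using hG.leviCivita_symm hy'
  have hΓ := (hG.contDiffAt_leviCivita hy).differentiableAt (by simp)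
  have h := curvTensor_bianchi hΓ hsymm u v w
  simpa using congrArg (fun a ↦ G y a x) h

end IsMetricOn

lemma pair_symm_of_skew_of_bianchi {α 𝕜 : Type*} [Field 𝕜] [LinearOrder 𝕜] [IsStrictOrderedRing 𝕜]
    {R : α → α → α → α → 𝕜} (hswap : ∀ u v w x, R u v w x = -R v u w x)
    (hskew : ∀ u v w x, R u v w x = -R u v x w)
    (hbianchi : ∀ u v w x, R u v w x + R v w u x + R w u v x = 0) (u v w x : α) :
    R u v w x = R w x u v := by
  -- The sum of the four Bianchi identities, one for each choice of the last argument.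
  linarith [hbianchi u v w x, hbianchi v w x u, hbianchi w x u v, hbianchi x u v w,
    hskew v w u x, hskew w u v x, hskew w x v u, hskew x v w u, hskew x u w v, hskew u v x w,
    hswap x v w u, hswap u w x v, hswap w u x v, hskew u w x v, hswap u w v x, hswap v x u w,
    hskew v x u w]

namespace IsMetricOn

variable {G : F → F →L[ℝ] F →L[ℝ] ℝ} {D : Set F} [FiniteDimensional ℝ F]

lemma apply_curvTensor_pair (hG : IsMetricOn G D) {y : F} (hy : y ∈ D) (u v w x : F) :
    G y (curvTensor (leviCivita G) y u v w) x = G y (curvTensor (leviCivita G) y w x u) v :=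
  pair_symm_of_skew_of_bianchi (R := fun u v w x ↦ G y (curvTensor (leviCivita G) y u v w) x)
    (fun u v w x ↦ by rw [curvTensor_swap, map_neg, neg_apply]) (hG.apply_curvTensor_skew hy)
    (hG.apply_curvTensor_bianchi hy) u v w x

lemma fderiv_leviCivita_of_pullback (hG : IsMetricOn G D) {F' : Type*} [NormedAddCommGroup F']
    [NormedSpace ℝ F'] [FiniteDimensional ℝ F'] {G' : F' → F' →L[ℝ] F' →L[ℝ] ℝ} {D' : Set F'}
    (hG' : IsMetricOn G' D') {ψ : F' → F} {y : F'} (hy : y ∈ D') (hψy : ψ y ∈ D)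
    (hψ : ContDiffAt ℝ 2 ψ y) (hsurj : Function.Surjective (fderiv ℝ ψ y))
    (hpull : ∀ᶠ y' in nhds y, ∀ u v, G' y' u v = G (ψ y') (fderiv ℝ ψ y' u) (fderiv ℝ ψ y' v))
    (u v : F') :
    fderiv ℝ ψ y (leviCivita G' y u v) =
      leviCivita G (ψ y) (fderiv ℝ ψ y u) (fderiv ℝ ψ y v) + fderiv ℝ (fderiv ℝ ψ) y u v := by
  have hd (a b c : F') : fderiv ℝ G' y a b c =
      fderiv ℝ G (ψ y) (fderiv ℝ ψ y a) (fderiv ℝ ψ y b) (fderiv ℝ ψ y c)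
        + G (ψ y) (fderiv ℝ (fderiv ℝ ψ) y a b) (fderiv ℝ ψ y c)
        + G (ψ y) (fderiv ℝ ψ y b) (fderiv ℝ (fderiv ℝ ψ) y a c) := by
    rw [← fderiv_clm_apply_apply_const (hG'.differentiableAt hy),
      Filter.EventuallyEq.fderiv_eq (hpull.mono fun y' h ↦ h b c),
      fderiv_comp_clm_apply_apply (hG.differentiableAt hψy) (hψ.differentiableAt (by simp))
        (differentiableAt_fderiv_apply hψ b) (differentiableAt_fderiv_apply hψ c),
      fderiv_clm_apply_const (differentiableAt_fderiv hψ),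
      fderiv_clm_apply_const (differentiableAt_fderiv hψ)]
  refine hG.ext hψy fun w ↦ ?_
  obtain ⟨w, rfl⟩ := hsurj w
  rw [← hpull.self_of_nhds, hG'.apply_leviCivita hy, map_add, add_apply, hG.apply_leviCivita hψy,
    hd, hd, hd, fderiv_fderiv_comm hψ v u, fderiv_fderiv_comm hψ w u, fderiv_fderiv_comm hψ w v,
    hG.symm _ hψy (fderiv ℝ ψ y v), hG.symm _ hψy (fderiv ℝ ψ y u)]
  ring

end IsMetricOn

end Metric

section Variation

variable {E : Type*} [NormedAddCommGroup E] [NormedSpace ℝ E]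
  {F : Type*} [NormedAddCommGroup F] [NormedSpace ℝ F] {ι : Type*} [Fintype ι]

lemma covDeriv_covTrace_fderiv {Γ : F → F →L[ℝ] F →L[ℝ] F} {f : E → F} {z : E}
    (hΓ : ContDiffAt ℝ ∞ Γ (f z)) (hsymm : ∀ᶠ y in nhds (f z), ∀ u v, Γ y u v = Γ y v u)
    (hf : ContDiffAt ℝ ∞ f z) (T : E) (e : ι → E) (ζ : E) :
    covDeriv Γ f (covTrace Γ f (fderiv ℝ f) e ζ) z T =
      covTrace Γ f (covDeriv Γ f fun z ↦ fderiv ℝ f z T) e ζ z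
        + ∑ i, curvTensor Γ (f z) (fderiv ℝ f z T) (fderiv ℝ f z (e i)) (fderiv ℝ f z (e i)) := by
  have hf₂ : ContDiffAt ℝ 2 f z := hf.of_le ENat.LEInfty.out
  have hdf := contDiffAt_fderiv_apply hf
  have hsecond (i : ι) :
      DifferentiableAt ℝ (fun z ↦ covDeriv Γ f (fun z ↦ fderiv ℝ f z (e i)) z (e i)) z :=
    (contDiffAt_covDeriv_apply hΓ hf (hdf _) _).differentiableAt (by simp)
  have hcomm (i : ι) :
      covDeriv Γ f (fun z ↦ covDeriv Γ f (fun z ↦ fderiv ℝ f z (e i)) z (e i)) z T =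
        covDeriv Γ f (fun z ↦ covDeriv Γ f (fun z ↦ fderiv ℝ f z T) z (e i)) z (e i)
          + curvTensor Γ (f z) (fderiv ℝ f z T) (fderiv ℝ f z (e i)) (fderiv ℝ f z (e i)) := by
    have hswap : (fun z ↦ covDeriv Γ f (fun z ↦ fderiv ℝ f z (e i)) z T) =ᶠ[nhds z]
        fun z ↦ covDeriv Γ f (fun z ↦ fderiv ℝ f z T) z (e i) := by
      filter_upwards [hf.continuousAt.eventually hsymm, hf₂.eventually (by simp)] with z' hz' hf'
      exact covDeriv_fderiv_comm hz' hf' T (e i)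
    rw [← covDeriv_covDeriv_sub_swap (hΓ.differentiableAt (by simp)) hf₂
      ((hdf (e i)).of_le ENat.LEInfty.out) T (e i), covDeriv_congr .rfl hswap]
    abel
  unfold covTrace
  rw [covDeriv_sub (DifferentiableAt.fun_sum fun i _ ↦ hsecond i)
    ((hdf ζ).differentiableAt (by simp)), covDeriv_sum _ _ fun i _ ↦ hsecond i, sub_apply,
    sum_apply, covDeriv_fderiv_comm hsymm.self_of_nhds hf₂ T ζ,
    Finset.sum_congr rfl fun i _ ↦ hcomm i, Finset.sum_add_distrib]
  abel

/-- The divergence `∑ (∇_{e_i} α)(e_i)` of a one-form `α`, where the fields `e_i` are constant and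
`ζ` stands for `∑ ∇_{e_i} e_i`. -/
def coordDiv (e : ι → E) (ζ : E) (α : E → E →L[ℝ] ℝ) (z : E) : ℝ :=
  ∑ i, fderiv ℝ (fun z ↦ α z (e i)) z (e i) - α z ζ

/-- The one-form `⟨A, B⟩` for a one-form `A` with values in vector fields along `f` and a vector
field `B` along `f`. -/
def metricPairing (G : F → F →L[ℝ] F →L[ℝ] ℝ) (f : E → F) (A : E → E →L[ℝ] F) (B : E → F)
    (z : E) : E →L[ℝ] ℝ :=
  ((G (f z)).flip (B z)).comp (A z)

/-- The one-form whose divergence is the difference of the integrands of the first variation of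
the trienergy; here `Λ` is the rough Laplacian of the tension field `τ` and `T` is the direction
of the variation. -/
def variationForm (G : F → F →L[ℝ] F →L[ℝ] ℝ) (f τ Λ : E → F) (T z : E) : E →L[ℝ] ℝ :=
  metricPairing G f (covDeriv (leviCivita G) f τ) (fun z ↦ covDeriv (leviCivita G) f τ z T) z
    + metricPairing G f (covDeriv (leviCivita G) f fun z ↦ fderiv ℝ f z T) Λ z
    - metricPairing G f (covDeriv (leviCivita G) f Λ) (fun z ↦ fderiv ℝ f z T) z

lemma metricPairing_apply (G : F → F →L[ℝ] F →L[ℝ] ℝ) (f : E → F) (A : E → E →L[ℝ] F)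
    (B : E → F) (z ξ : E) : metricPairing G f A B z ξ = G (f z) (A z ξ) (B z) := rfl

lemma coordDiv_add {α β : E → E →L[ℝ] ℝ} {z : E} (hα : DifferentiableAt ℝ α z)
    (hβ : DifferentiableAt ℝ β z) (e : ι → E) (ζ : E) :
    coordDiv e ζ (fun z ↦ α z + β z) z = coordDiv e ζ α z + coordDiv e ζ β z := by
  have hc (v : E) : DifferentiableAt ℝ (fun _ : E ↦ v) z := differentiableAt_const v
  simp only [coordDiv, add_apply, fderiv_fun_add (hα.clm_apply (hc _)) (hβ.clm_apply (hc _)),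
    Finset.sum_add_distrib]
  abel

lemma coordDiv_sub {α β : E → E →L[ℝ] ℝ} {z : E} (hα : DifferentiableAt ℝ α z)
    (hβ : DifferentiableAt ℝ β z) (e : ι → E) (ζ : E) :
    coordDiv e ζ (fun z ↦ α z - β z) z = coordDiv e ζ α z - coordDiv e ζ β z := by
  have hc (v : E) : DifferentiableAt ℝ (fun _ : E ↦ v) z := differentiableAt_const v
  simp only [coordDiv, sub_apply, fderiv_fun_sub (hα.clm_apply (hc _)) (hβ.clm_apply (hc _)),
    Finset.sum_sub_distrib]
  abel

lemma contDiffAt_metricPairing {G : F → F →L[ℝ] F →L[ℝ] ℝ} {f B : E → F} {A : E → E →L[ℝ] F}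
    {z : E} (hG : ContDiffAt ℝ ∞ G (f z)) (hf : ContDiffAt ℝ ∞ f z) (hA : ContDiffAt ℝ ∞ A z)
    (hB : ContDiffAt ℝ ∞ B z) : ContDiffAt ℝ ∞ (metricPairing G f A B) z := by
  have hflip : ContDiffAt ℝ ∞ (fun z ↦ (G (f z)).flip) z :=
    (ContinuousLinearMap.flipₗᵢ ℝ F F ℝ).toContinuousLinearEquiv.contDiff.contDiffAt.comp z
      (hG.comp z hf)
  exact (hflip.clm_apply hB).clm_comp hA

variable [FiniteDimensional ℝ F] {G : F → F →L[ℝ] F →L[ℝ] ℝ} {D : Set F} {f : E → F} {z : E}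

lemma contDiffAt_variationForm (hG : IsMetricOn G D) {τ Λ : E → F} (hz : f z ∈ D)
    (hf : ContDiffAt ℝ ∞ f z) (hτ : ContDiffAt ℝ ∞ τ z) (hΛ : ContDiffAt ℝ ∞ Λ z) (T : E) :
    ContDiffAt ℝ ∞ (variationForm G f τ Λ T) z := by
  have hΓ := hG.contDiffAt_leviCivita hz
  have hV := contDiffAt_fderiv_apply hf T
  have hpair {A : E → E →L[ℝ] F} {B : E → F} (hA : ContDiffAt ℝ ∞ A z) (hB : ContDiffAt ℝ ∞ B z) :=
    contDiffAt_metricPairing (hG.contDiffAt hz) hf hA hB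
  exact ((hpair (contDiffAt_covDeriv hΓ hf hτ) (contDiffAt_covDeriv_apply hΓ hf hτ T)).add
    (hpair (contDiffAt_covDeriv hΓ hf hV) hΛ)).sub (hpair (contDiffAt_covDeriv hΓ hf hΛ) hV)

namespace IsMetricOn

lemma coordDiv_metricPairing (hG : IsMetricOn G D) {A : E → E →L[ℝ] F} {B : E → F} (hz : f z ∈ D)
    (hf : DifferentiableAt ℝ f z) (hA : DifferentiableAt ℝ A z) (hB : DifferentiableAt ℝ B z)
    (e : ι → E) (ζ : E) :
    coordDiv e ζ (metricPairing G f A B) z =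
      G (f z) (covTrace (leviCivita G) f A e ζ z) (B z)
        + ∑ i, G (f z) (A z (e i)) (covDeriv (leviCivita G) f B z (e i)) := by
  have hAe (i : ι) : DifferentiableAt ℝ (fun z ↦ A z (e i)) z :=
    hA.clm_apply (differentiableAt_const _)
  simp only [coordDiv, metricPairing_apply, hG.fderiv_along hz hf (hAe _) hB, covTrace, map_sub,
    map_sum, sub_apply, sum_apply, Finset.sum_add_distrib]
  ring

variable {τ : E → F}

lemma half_fderiv_sum_covDeriv_sq (hG : IsMetricOn G D) (hz : f z ∈ D) (hf : ContDiffAt ℝ ∞ f z)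
    (hτ : ContDiffAt ℝ ∞ τ z) (T : E) (e : ι → E) :
    (1 / 2) * fderiv ℝ (fun z ↦ ∑ i, G (f z) (covDeriv (leviCivita G) f τ z (e i))
        (covDeriv (leviCivita G) f τ z (e i))) z T =
      ∑ i, G (f z) (covDeriv (leviCivita G) f τ z (e i))
          (covDeriv (leviCivita G) f (fun z ↦ covDeriv (leviCivita G) f τ z T) z (e i))
        + ∑ i, G (f z) (curvTensor (leviCivita G) (f z) (covDeriv (leviCivita G) f τ z (e i)) (τ z)
            (fderiv ℝ f z (e i))) (fderiv ℝ f z T) := by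
  have hΓ := hG.contDiffAt_leviCivita hz
  have hfd := hf.differentiableAt (by simp)
  have hGf : DifferentiableAt ℝ (fun z ↦ G (f z)) z := (hG.differentiableAt hz).comp z hfd
  have hdτ (i : ι) : DifferentiableAt ℝ (fun z ↦ covDeriv (leviCivita G) f τ z (e i)) z :=
    (contDiffAt_covDeriv_apply hΓ hf hτ _).differentiableAt (by simp)
  have hpair (i : ι) :
      G (f z) (curvTensor (leviCivita G) (f z) (fderiv ℝ f z T) (fderiv ℝ f z (e i)) (τ z))
          (covDeriv (leviCivita G) f τ z (e i)) =
        G (f z) (curvTensor (leviCivita G) (f z) (covDeriv (leviCivita G) f τ z (e i)) (τ z)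
          (fderiv ℝ f z (e i))) (fderiv ℝ f z T) := by
    rw [hG.apply_curvTensor_pair hz (fderiv ℝ f z T), hG.apply_curvTensor_skew hz (τ z),
      curvTensor_swap _ _ (τ z), map_neg, neg_apply, neg_neg]
  rw [fderiv_fun_sum fun i _ ↦ (hGf.clm_apply (hdτ i)).clm_apply (hdτ i), sum_apply,
    Finset.mul_sum, ← Finset.sum_add_distrib]
  refine Finset.sum_congr rfl fun i _ ↦ ?_
  rw [← hpair, ← covDeriv_covDeriv_sub_swap (hΓ.differentiableAt (by simp))
    (hf.of_le ENat.LEInfty.out) (hτ.of_le ENat.LEInfty.out), map_sub, sub_apply,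
    hG.fderiv_along hz hfd (hdτ i) (hdτ i),
    hG.symm _ hz (covDeriv (leviCivita G) f (fun z ↦ covDeriv (leviCivita G) f τ z (e i)) z T),
    hG.symm _ hz (covDeriv (leviCivita G) f (fun z ↦ covDeriv (leviCivita G) f τ z T) z (e i))]
  ring

lemma half_fderiv_sum_covDeriv_sq_eq_coordDiv (hG : IsMetricOn G D) {Λ : E → F} (hz : f z ∈ D)
    (hf : ContDiffAt ℝ ∞ f z) (hτ : ContDiffAt ℝ ∞ τ z) (hΛ : ContDiffAt ℝ ∞ Λ z)
    (T : E) (e : ι → E) (ζ : E)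
    (hdτ : covDeriv (leviCivita G) f τ z T =
      covTrace (leviCivita G) f (covDeriv (leviCivita G) f fun z ↦ fderiv ℝ f z T) e ζ z
        + ∑ i, curvTensor (leviCivita G) (f z) (fderiv ℝ f z T) (fderiv ℝ f z (e i))
            (fderiv ℝ f z (e i)))
    (hΛτ : Λ z = -covTrace (leviCivita G) f (covDeriv (leviCivita G) f τ) e ζ z) :
    (1 / 2) * fderiv ℝ (fun z ↦ ∑ i, G (f z) (covDeriv (leviCivita G) f τ z (e i))
        (covDeriv (leviCivita G) f τ z (e i))) z T =
      coordDiv e ζ (variationForm G f τ Λ T) z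
        - G (f z) (-covTrace (leviCivita G) f (covDeriv (leviCivita G) f Λ) e ζ z
            - ∑ i, curvTensor (leviCivita G) (f z) (Λ z) (fderiv ℝ f z (e i)) (fderiv ℝ f z (e i))
            - ∑ i, curvTensor (leviCivita G) (f z) (covDeriv (leviCivita G) f τ z (e i)) (τ z)
                (fderiv ℝ f z (e i)))
          (fderiv ℝ f z T) := by
  have hΓ := hG.contDiffAt_leviCivita hz
  have hfd := hf.differentiableAt (by simp)
  have hV := contDiffAt_fderiv_apply hf T
  have hdiff {A : E → E →L[ℝ] F} {B : E → F} (hA : ContDiffAt ℝ ∞ A z)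
      (hB : ContDiffAt ℝ ∞ B z) : DifferentiableAt ℝ (metricPairing G f A B) z :=
    (contDiffAt_metricPairing (hG.contDiffAt hz) hf hA hB).differentiableAt (by simp)
  have hprod {A : E → E →L[ℝ] F} {B : E → F} (hA : ContDiffAt ℝ ∞ A z) (hB : ContDiffAt ℝ ∞ B z) :=
    hG.coordDiv_metricPairing hz hfd (hA.differentiableAt (by simp))
      (hB.differentiableAt (by simp)) e ζ
  have hτ' := contDiffAt_covDeriv hΓ hf hτ
  have hτT := contDiffAt_covDeriv_apply hΓ hf hτ T
  have hV' := contDiffAt_covDeriv hΓ hf hV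
  have hΛ' := contDiffAt_covDeriv hΓ hf hΛ
  have hτΛ : G (f z) (covTrace (leviCivita G) f (covDeriv (leviCivita G) f τ) e ζ z)
        (covDeriv (leviCivita G) f τ z T) =
      -(G (f z) (covTrace (leviCivita G) f (covDeriv (leviCivita G) f fun z ↦ fderiv ℝ f z T) e ζ z)
          (Λ z)
        + ∑ i, G (f z) (curvTensor (leviCivita G) (f z) (Λ z) (fderiv ℝ f z (e i))
            (fderiv ℝ f z (e i))) (fderiv ℝ f z T)) := by
    rw [hG.symm _ hz, ← neg_eq_iff_eq_neg.2 hΛτ, hdτ]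
    simp only [map_add, map_neg, map_sum, add_apply, sum_apply]
    refine congrArg _ (congrArg _ (Finset.sum_congr rfl fun i _ ↦ ?_))
    rw [hG.apply_curvTensor_pair hz (Λ z), hG.apply_curvTensor_skew hz,
      curvTensor_swap, map_neg, neg_apply, neg_neg]
  have hsymm : ∑ i, G (f z) (covDeriv (leviCivita G) f (fun z ↦ fderiv ℝ f z T) z (e i))
        (covDeriv (leviCivita G) f Λ z (e i)) =
      ∑ i, G (f z) (covDeriv (leviCivita G) f Λ z (e i))
        (covDeriv (leviCivita G) f (fun z ↦ fderiv ℝ f z T) z (e i)) :=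
    Finset.sum_congr rfl fun i _ ↦ hG.symm _ hz _ _
  rw [hG.half_fderiv_sum_covDeriv_sq hz hf hτ]
  unfold variationForm
  rw [coordDiv_sub ((hdiff hτ' hτT).fun_add (hdiff hV' hΛ)) (hdiff hΛ' hV),
    coordDiv_add (hdiff hτ' hτT) (hdiff hV' hΛ), hprod hτ' hτT, hprod hV' hΛ, hprod hΛ' hV, hτΛ,
    hsymm]
  simp only [map_sub, map_neg, map_sum, sub_apply, neg_apply, sum_apply]
  ring

end IsMetricOn

end Variation

section Jacobi

variable {ι : Type*} [Fintype ι] [DecidableEq ι]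

lemma trace_adjugate_mul {R : Type*} [CommRing R] (A B : Matrix ι ι R) :
    (A.adjugate * B).trace = ∑ σ : Equiv.Perm ι, Equiv.Perm.sign σ •
      ∑ i, (∏ j ∈ Finset.univ.erase i, A (σ j) j) • B (σ i) i := by
  have hdiag (i : ι) : (A.adjugate * B) i i = (A.updateCol i fun j ↦ B j i).det := by
    rw [← Matrix.cramer_apply, Matrix.cramer_eq_adjugate_mulVec]
    rfl
  simp only [Matrix.trace, Matrix.diag_apply, hdiag, Matrix.det_apply, Finset.smul_sum]
  rw [Finset.sum_comm]
  refine Finset.sum_congr rfl fun σ _ ↦ Finset.sum_congr rfl fun i _ ↦ ?_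
  rw [← Finset.prod_erase_mul _ _ (Finset.mem_univ i), smul_eq_mul, Matrix.updateCol_self]
  congr 2
  exact Finset.prod_congr rfl fun j hj ↦ by rw [Matrix.updateCol_ne (Finset.ne_of_mem_erase hj)]

lemma fderiv_det {E : Type*} [NormedAddCommGroup E] [NormedSpace ℝ E] {A : E → Matrix ι ι ℝ} {z : E}
    (hA : ∀ i j, DifferentiableAt ℝ (fun z ↦ A z i j) z) (ξ : E) :
    fderiv ℝ (fun z ↦ (A z).det) z ξ =
      ((A z).adjugate * Matrix.of fun i j ↦ fderiv ℝ (fun z ↦ A z i j) z ξ).trace := by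
  have hdet : HasFDerivAt (fun z ↦ (A z).det) (∑ σ : Equiv.Perm ι, Equiv.Perm.sign σ •
      ∑ i, (∏ j ∈ Finset.univ.erase i, A z (σ j) j) • fderiv ℝ (fun z ↦ A z (σ i) i) z) z := by
    simp only [Matrix.det_apply]
    exact HasFDerivAt.fun_sum fun σ _ ↦
      (HasFDerivAt.finsetProd fun i _ ↦ (hA (σ i) i).hasFDerivAt).const_smul _
  rw [hdet.fderiv, trace_adjugate_mul]
  simp only [sum_apply, smul_apply, Matrix.of_apply]

end Jacobi

section Frame

variable {F : Type*} [NormedAddCommGroup F] [NormedSpace ℝ F] {ι : Type*} [Fintype ι]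

/-- `e` is a Parseval frame for the bilinear form `g`, as every orthonormal basis is. -/
def IsParsevalFrame (g : F →L[ℝ] F →L[ℝ] ℝ) (e : ι → F) : Prop :=
  ∀ u, ∑ i, g u (e i) • e i = u

lemma IsParsevalFrame.inverse_apply {g : F →L[ℝ] F →L[ℝ] ℝ} {e : ι → F} (he : IsParsevalFrame g e)
    (hg : g.IsInvertible) (l : F →L[ℝ] ℝ) : g.inverse l = ∑ i, l (e i) • e i := by
  rw [← he (g.inverse l)]
  simp only [hg.self_apply_inverse]

end Frame

section Trace

variable {k : ℕ}

/-- The coordinate vector `∂_a` of Euclidean space. -/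
abbrev coordVec (a : Fin k) : Model k := EuclideanSpace.single a (1 : ℝ)

/-- The Gram matrix `(g_ab)` of the bilinear form `g` in the coordinate vectors. -/
def gram (g : Model k →L[ℝ] Model k →L[ℝ] ℝ) : Matrix (Fin k) (Fin k) ℝ :=
  Matrix.of fun a b ↦ g (coordVec a) (coordVec b)

/-- The inverse matrix `(g^ab)` of the Gram matrix of the bilinear form `g`. -/
def invGram (g : Model k →L[ℝ] Model k →L[ℝ] ℝ) : Matrix (Fin k) (Fin k) ℝ :=
  Matrix.of fun a b ↦ g.inverse (EuclideanSpace.proj a) b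

/-- The trace `∑ g^ab B_ab` of the bilinear map `B` with respect to the bilinear form `g`. -/
def metricTrace {H : Type*} [NormedAddCommGroup H] [NormedSpace ℝ H]
    (g : Model k →L[ℝ] Model k →L[ℝ] ℝ) (B : Model k →L[ℝ] Model k →L[ℝ] H) : H :=
  ∑ a, ∑ b, invGram g a b • B (coordVec a) (coordVec b)

variable {g : Model k →L[ℝ] Model k →L[ℝ] ℝ} {ι : Type*} [Fintype ι] {e : ι → Model k}

lemma sum_coord_smul_coordVec (u : Model k) : ∑ a, u a • coordVec a = u := by
  ext b
  simp [coordVec, Pi.single_apply]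

lemma sum_coord_smul_apply {H : Type*} [AddCommGroup H] [Module ℝ H] [TopologicalSpace H]
    (L : Model k →L[ℝ] H) (u : Model k) : ∑ a, u a • L (coordVec a) = L u := by
  conv_rhs => rw [← sum_coord_smul_coordVec u]
  simp only [map_sum, map_smul]

lemma apply_eq_sum_gram (g : Model k →L[ℝ] Model k →L[ℝ] ℝ) (u v : Model k) :
    g u v = ∑ a, ∑ b, u a * gram g a b * v b := by
  rw [← sum_coord_smul_apply g u, sum_apply]
  refine Finset.sum_congr rfl fun a _ ↦ ?_
  rw [smul_apply, ← sum_coord_smul_apply (g _) v, Finset.smul_sum]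
  exact Finset.sum_congr rfl fun b _ ↦ by simp only [smul_eq_mul, gram, Matrix.of_apply]; ring

lemma det_gram_pos (hsymm : ∀ u v, g u v = g v u) (hpos : ∀ u, u ≠ 0 → 0 < g u u) :
    0 < (gram g).det := by
  refine Matrix.PosDef.det_pos (Matrix.PosDef.of_dotProduct_mulVec_pos ?_ fun x hx ↦ ?_)
  · ext a b
    simp [gram, hsymm (coordVec a)]
  · have hx' : (WithLp.toLp 2 x : Model k) ≠ 0 := fun h ↦ hx (congrArg WithLp.ofLp h)
    have hxx := hpos _ hx'
    rw [apply_eq_sum_gram] at hxx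
    simpa [dotProduct, Matrix.mulVec, Finset.mul_sum, mul_assoc] using hxx

lemma invGram_mul_gram (hg : g.IsInvertible) : invGram g * gram g = 1 := by
  ext a c
  have h := hg.self_apply_inverse (EuclideanSpace.proj a)
  rw [Matrix.mul_apply]
  simp only [invGram, gram, Matrix.of_apply]
  have hsum := DFunLike.congr_fun (sum_coord_smul_apply g (g.inverse (EuclideanSpace.proj a)))
    (coordVec c)
  rw [h, sum_apply] at hsum
  simpa [coordVec, Matrix.one_apply] using hsum

lemma adjugate_gram (hg : g.IsInvertible) : (gram g).adjugate = (gram g).det • invGram g :=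
  calc (gram g).adjugate
      = (invGram g * gram g) * (gram g).adjugate := by rw [invGram_mul_gram hg, Matrix.one_mul]
    _ = (gram g).det • invGram g := by
      rw [Matrix.mul_assoc, Matrix.mul_adjugate, Matrix.mul_smul, Matrix.mul_one]

lemma IsParsevalFrame.sum_apply_apply_eq_metricTrace (he : IsParsevalFrame g e)
    (hg : g.IsInvertible) {H : Type*} [NormedAddCommGroup H] [NormedSpace ℝ H]
    (B : Model k →L[ℝ] Model k →L[ℝ] H) : ∑ i, B (e i) (e i) = metricTrace g B := by
  have hinv (a b : Fin k) : invGram g a b = ∑ i, e i a * e i b := by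
    rw [invGram, Matrix.of_apply, he.inverse_apply hg]
    simp
  have hexpand (i : ι) :
      B (e i) (e i) = ∑ a, ∑ b, (e i a * e i b) • B (coordVec a) (coordVec b) := by
    rw [← sum_coord_smul_apply B (e i), sum_apply]
    refine Finset.sum_congr rfl fun a _ ↦ ?_
    rw [smul_apply, ← sum_coord_smul_apply (B _) (e i), Finset.smul_sum]
    simp only [smul_smul]
  simp only [metricTrace, hinv, hexpand, Finset.sum_smul]
  rw [Finset.sum_comm]
  exact Finset.sum_congr rfl fun a _ ↦ Finset.sum_comm

lemma IsParsevalFrame.sum_coord_eq_sum_apply (he : IsParsevalFrame g e)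
    (A : Model k →L[ℝ] Model k) : ∑ b, A (coordVec b) b = ∑ i, g (A (e i)) (e i) := by
  have hcoord (b : Fin k) : A (coordVec b) b = ∑ i, e i b * g (A (coordVec b)) (e i) := by
    conv_lhs => rw [← he (A (coordVec b))]
    simp [mul_comm]
  simp only [hcoord]
  rw [Finset.sum_comm]
  refine Finset.sum_congr rfl fun i _ ↦ ?_
  exact sum_coord_smul_apply ((g.flip (e i)).comp A) (e i)

end Trace

namespace IsMetricOn

variable {k : ℕ} {G : Model k → Model k →L[ℝ] Model k →L[ℝ] ℝ} {D : Set (Model k)} {y : Model k}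

lemma contDiffAt_gram (hG : IsMetricOn G D) (hy : y ∈ D) (a b : Fin k) :
    ContDiffAt ℝ ∞ (fun y ↦ gram (G y) a b) y :=
  ((hG.contDiffAt hy).clm_apply contDiffAt_const).clm_apply contDiffAt_const

lemma det_gram_pos (hG : IsMetricOn G D) (hy : y ∈ D) : 0 < (gram (G y)).det :=
  Riem.det_gram_pos (hG.symm y hy) (hG.pos y hy)

lemma contDiffAt_det_gram (hG : IsMetricOn G D) (hy : y ∈ D) :
    ContDiffAt ℝ ∞ (fun y ↦ (gram (G y)).det) y := by
  simp only [Matrix.det_apply]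
  exact ContDiffAt.sum fun σ _ ↦
    (contDiffAt_prod fun i _ ↦ hG.contDiffAt_gram hy _ _).const_smul _

lemma contDiffAt_sqrt_det_gram (hG : IsMetricOn G D) (hy : y ∈ D) :
    ContDiffAt ℝ ∞ (fun y ↦ √(gram (G y)).det) y :=
  (hG.contDiffAt_det_gram hy).sqrt (hG.det_gram_pos hy).ne'

lemma contDiffAt_metricTrace (hG : IsMetricOn G D) {E : Type*} [NormedAddCommGroup E]
    [NormedSpace ℝ E] {H : Type*} [NormedAddCommGroup H] [NormedSpace ℝ H]
    {p : E → Model k} {B : E → Model k →L[ℝ] Model k →L[ℝ] H} {z : E} (hz : p z ∈ D)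
    (hp : ContDiffAt ℝ ∞ p z) (hB : ∀ u v, ContDiffAt ℝ ∞ (fun z ↦ B z u v) z) :
    ContDiffAt ℝ ∞ (fun z ↦ metricTrace (G (p z)) (B z)) z := by
  have hinv (a b : Fin k) : ContDiffAt ℝ ∞ (fun z ↦ invGram (G (p z)) a b) z :=
    (EuclideanSpace.proj (𝕜 := ℝ) b).contDiff.contDiffAt.comp z
      (((hG.contDiffAt_inverse hz).comp z hp).clm_apply contDiffAt_const)
  exact ContDiffAt.sum fun a _ ↦ ContDiffAt.sum fun b _ ↦
    (hinv a b).smul (hB _ _)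

lemma fderiv_det_gram (hG : IsMetricOn G D) (hy : y ∈ D) (X : Model k) :
    fderiv ℝ (fun y ↦ (gram (G y)).det) y X =
      (gram (G y)).det * metricTrace (G y) (fderiv ℝ G y X) := by
  have hentry (a b : Fin k) : fderiv ℝ (fun y ↦ gram (G y) a b) y X =
      fderiv ℝ G y X (coordVec b) (coordVec a) := by
    rw [← hG.fderiv_symm hy]
    exact fderiv_clm_apply_apply_const (hG.differentiableAt hy) X _ _
  rw [fderiv_det fun a b ↦ (hG.contDiffAt_gram hy a b).differentiableAt (by simp)]
  rw [adjugate_gram (hG.isInvertible hy), Matrix.smul_mul, Matrix.trace_smul, smul_eq_mul]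
  simp only [hentry, metricTrace, Matrix.trace, Matrix.diag_apply, Matrix.mul_apply,
    Matrix.of_apply, smul_eq_mul]

lemma fderiv_sqrt_det_gram (hG : IsMetricOn G D) (hy : y ∈ D) (X : Model k) :
    fderiv ℝ (fun y ↦ √(gram (G y)).det) y X =
      √(gram (G y)).det * ((1 / 2) * metricTrace (G y) (fderiv ℝ G y X)) := by
  have hpos := hG.det_gram_pos hy
  rw [fderiv_sqrt ((hG.contDiffAt_det_gram hy).differentiableAt (by simp)) hpos.ne', smul_apply,
    hG.fderiv_det_gram hy, smul_eq_mul]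
  have hs : √(gram (G y)).det ≠ 0 := (Real.sqrt_pos.2 hpos).ne'
  field_simp
  rw [Real.sq_sqrt hpos.le]

variable {ι : Type*} [Fintype ι] {e : ι → Model k}

lemma sum_fderiv_sqrt_det_gram_mul_inverse (hG : IsMetricOn G D) (hy : y ∈ D)
    (he : IsParsevalFrame (G y) e) {α : Model k → Model k →L[ℝ] ℝ} (hα : DifferentiableAt ℝ α y) :
    ∑ b, fderiv ℝ (fun y ↦ √(gram (G y)).det * (G y).inverse (α y) b) y (coordVec b) =
      √(gram (G y)).det * coordDiv e (∑ i, leviCivita G y (e i) (e i)) α y := by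
  set X : Model k → Model k := fun y ↦ (G y).inverse (α y)
  have hX : DifferentiableAt ℝ X y :=
    ((hG.contDiffAt_inverse hy).differentiableAt (by simp)).clm_apply hα
  have hGX : ∀ y ∈ D, α y = G y (X y) := fun y hy ↦
    ((hG.isInvertible hy).self_apply_inverse _).symm
  have hdα (u v : Model k) :
      fderiv ℝ (fun y ↦ α y v) y u = fderiv ℝ G y u (X y) v + G y (fderiv ℝ X y u) v := by
    have hαX : (fun y ↦ α y v) =ᶠ[nhds y] fun y ↦ G y (X y) v := by
      filter_upwards [hG.isOpen.mem_nhds hy] with y' hy' using by rw [hGX y' hy']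
    have h := fderiv_comp_clm_apply_apply (f := fun y ↦ y) (hG.differentiableAt hy)
      differentiableAt_id hX (differentiableAt_const v) u
    simpa [hαX.fderiv_eq] using h
  have hprod (b : Fin k) : fderiv ℝ (fun y ↦ √(gram (G y)).det * X y b) y (coordVec b) =
      √(gram (G y)).det * fderiv ℝ X y (coordVec b) b
        + X y b • fderiv ℝ (fun y ↦ √(gram (G y)).det) y (coordVec b) := by
    have hXb : HasFDerivAt (fun y ↦ X y b) ((EuclideanSpace.proj b).comp (fderiv ℝ X y)) y :=
      (EuclideanSpace.proj (𝕜 := ℝ) b).hasFDerivAt.comp y hX.hasFDerivAt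
    rw [fderiv_fun_mul ((hG.contDiffAt_sqrt_det_gram hy).differentiableAt (by simp))
      hXb.differentiableAt, hXb.fderiv]
    rfl
  have htrace : metricTrace (G y) (fderiv ℝ G y (X y)) = ∑ i, fderiv ℝ G y (X y) (e i) (e i) :=
    (he.sum_apply_apply_eq_metricTrace (hG.isInvertible hy) _).symm
  rw [Finset.sum_congr rfl fun b _ ↦ hprod b, Finset.sum_add_distrib, ← Finset.mul_sum,
    sum_coord_smul_apply, hG.fderiv_sqrt_det_gram hy, he.sum_coord_eq_sum_apply, htrace, ← mul_add]
  congr 1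
  simp only [coordDiv, hdα, hGX y hy, hG.symm y hy (X y), map_sum, sum_apply,
    hG.apply_leviCivita hy, hG.fderiv_symm hy _ (X y), ← Finset.mul_sum,
    Finset.sum_sub_distrib, Finset.sum_add_distrib]
  ring

end IsMetricOn

section Charts

variable {k : ℕ} {N : Type*} [TopologicalSpace N] [ChartedSpace (Model k) N]

lemma extChartAt_mem_target {q x : N} (hx : x ∈ (chartAt (Model k) q).source) :
    extChartAt (𝓡 k) q x ∈ (extChartAt (𝓡 k) q).target :=
  (extChartAt (𝓡 k) q).map_source (by simpa using hx)

lemma extChartAt_symm_mem_source {q : N} {y : Model k} (hy : y ∈ (extChartAt (𝓡 k) q).target) :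
    (extChartAt (𝓡 k) q).symm y ∈ (chartAt (Model k) q).source := by
  simpa using (extChartAt (𝓡 k) q).map_target hy

lemma extChartAt_symm_extChartAt {q x : N} (hx : x ∈ (chartAt (Model k) q).source) :
    (extChartAt (𝓡 k) q).symm (extChartAt (𝓡 k) q x) = x :=
  (extChartAt (𝓡 k) q).left_inv (by simpa using hx)

lemma target_mem_nhds {q : N} {y : Model k} (hy : y ∈ (extChartAt (𝓡 k) q).target) :
    (extChartAt (𝓡 k) q).target ∈ nhds y := (isOpen_extChartAt_target q).mem_nhds hy

lemma source_mem_nhds {q x : N} (hx : x ∈ (chartAt (Model k) q).source) :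
    (chartAt (Model k) q).source ∈ nhds x := (chartAt (Model k) q).open_source.mem_nhds hx

/-- The change of coordinates from the chart at `r` to the chart at `q`. -/
def chartTransition (k : ℕ) {N : Type*} [TopologicalSpace N] [ChartedSpace (Model k) N] (r q : N)
    (y : Model k) : Model k :=
  extChartAt (𝓡 k) q ((extChartAt (𝓡 k) r).symm y)

lemma chartTransition_extChartAt {r q x : N} (hr : x ∈ (chartAt (Model k) r).source) :
    chartTransition k r q (extChartAt (𝓡 k) r x) = extChartAt (𝓡 k) q x := by
  rw [chartTransition, extChartAt_symm_extChartAt hr]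

variable [IsManifold (𝓡 k) ∞ N]

lemma contMDiffAt_extChartAt_of_mem {q x : N} (hx : x ∈ (chartAt (Model k) q).source) :
    ContMDiffAt (𝓡 k) 𝓘(ℝ, Model k) ∞ (extChartAt (𝓡 k) q) x :=
  contMDiffAt_extChartAt' hx

lemma contMDiffAt_extChartAt_symm {q : N} {y : Model k} (hy : y ∈ (extChartAt (𝓡 k) q).target) :
    ContMDiffAt 𝓘(ℝ, Model k) (𝓡 k) ∞ (extChartAt (𝓡 k) q).symm y :=
  (contMDiffOn_extChartAt_symm q).contMDiffAt (target_mem_nhds hy)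

lemma contDiffAt_chartTransition {r q x : N} (hr : x ∈ (chartAt (Model k) r).source)
    (hq : x ∈ (chartAt (Model k) q).source) :
    ContDiffAt ℝ ∞ (chartTransition k r q) (extChartAt (𝓡 k) r x) := by
  have hsymm := contMDiffAt_extChartAt_symm (extChartAt_mem_target hr)
  have hchart : ContMDiffAt (𝓡 k) 𝓘(ℝ, Model k) ∞ (extChartAt (𝓡 k) q)
      ((extChartAt (𝓡 k) r).symm (extChartAt (𝓡 k) r x)) := by
    rw [extChartAt_symm_extChartAt hr]
    exact contMDiffAt_extChartAt_of_mem hq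
  exact (hchart.comp _ hsymm).contDiffAt

variable (k) in
/-- The components of a tangent vector at `x` in the preferred chart at `q`. -/
def chartCoord (q x : N) : TangentSpace (𝓡 k) x →L[ℝ] Model k :=
  (trivializationAt (Model k) (fun p : N ↦ TangentSpace (𝓡 k) p) q).continuousLinearMapAt ℝ x

variable (k) in
/-- The tangent vector at `x` with given components in the preferred chart at `q`. -/
def ofChartCoord (q x : N) : Model k →L[ℝ] TangentSpace (𝓡 k) x :=
  (trivializationAt (Model k) (fun p : N ↦ TangentSpace (𝓡 k) p) q).symmL ℝ x

lemma chartCoord_ofChartCoord {q x : N} (hx : x ∈ (chartAt (Model k) q).source) (u : Model k) :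
    chartCoord k q x (ofChartCoord k q x u) = u :=
  Trivialization.continuousLinearMapAt_symmL _ hx u

lemma ofChartCoord_chartCoord {q x : N} (hx : x ∈ (chartAt (Model k) q).source)
    (v : TangentSpace (𝓡 k) x) : ofChartCoord k q x (chartCoord k q x v) = v :=
  Trivialization.symmL_continuousLinearMapAt _ hx v

lemma chartCoord_injective {q x : N} (hx : x ∈ (chartAt (Model k) q).source) :
    Function.Injective (chartCoord k q x) :=
  Function.LeftInverse.injective (ofChartCoord_chartCoord hx)

lemma trivializationAt_snd {q x : N} (hx : x ∈ (chartAt (Model k) q).source)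
    (v : TangentSpace (𝓡 k) x) :
    (trivializationAt (Model k) (fun p : N ↦ TangentSpace (𝓡 k) p) q ⟨x, v⟩).2 =
      chartCoord k q x v :=
  (Trivialization.continuousLinearMapAt_apply_of_mem ℝ _ hx v).symm

lemma trivializationAt_symm {q x : N} (hx : x ∈ (chartAt (Model k) q).source) (u : Model k) :
    (trivializationAt (Model k) (fun p : N ↦ TangentSpace (𝓡 k) p) q).symm x u =
      ofChartCoord k q x u :=
  (Trivialization.symmL_apply _ hx u).symm

lemma constField_eq_ofChartCoord {q x : N} (u : TangentSpace (𝓡 k) q)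
    (hx : x ∈ (chartAt (Model k) q).source) :
    constField u x = ofChartCoord k q x (chartCoord k q q u) := by
  rw [constField, FiberBundle.extend, trivializationAt_snd (mem_chart_source _ q),
    trivializationAt_symm hx]

lemma chartCoord_constField {q x : N} (u : TangentSpace (𝓡 k) q)
    (hx : x ∈ (chartAt (Model k) q).source) :
    chartCoord k q x (constField u x) = chartCoord k q q u := by
  rw [constField_eq_ofChartCoord u hx, chartCoord_ofChartCoord hx]

lemma chartCoord_eq_mvfderiv {q x : N} (hx : x ∈ (chartAt (Model k) q).source)
    (v : TangentSpace (𝓡 k) x) :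
    chartCoord k q x v = mvfderiv (𝓡 k) (extChartAt (𝓡 k) q) x v := by
  rw [chartCoord, TangentBundle.continuousLinearMapAt_trivializationAt hx]
  rfl

lemma mvfderiv_eq_fderiv {F : Type*} [NormedAddCommGroup F] [NormedSpace ℝ F] {g : N → F}
    {q x : N} (hx : x ∈ (chartAt (Model k) q).source)
    (hg : DifferentiableAt ℝ (fun y ↦ g ((extChartAt (𝓡 k) q).symm y)) (extChartAt (𝓡 k) q x))
    (X : TangentSpace (𝓡 k) x) :
    mvfderiv (𝓡 k) g x X = fderiv ℝ (fun y ↦ g ((extChartAt (𝓡 k) q).symm y))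
      (extChartAt (𝓡 k) q x) (chartCoord k q x X) := by
  have hchart := ((contMDiffAt_extChartAt_of_mem hx).mdifferentiableAt (by simp)).hasMFDerivAt
  have hg' : g =ᶠ[nhds x] (fun y ↦ g ((extChartAt (𝓡 k) q).symm y)) ∘ extChartAt (𝓡 k) q := by
    filter_upwards [source_mem_nhds hx] with x' hx'
    simp only [Function.comp_apply, extChartAt_symm_extChartAt hx']
  have hmfderiv :=
    ((HasMFDerivAt.comp x hg.hasFDerivAt.hasMFDerivAt hchart).congr_of_eventuallyEq hg').mfderiv
  rw [chartCoord_eq_mvfderiv hx, mvfderiv, hmfderiv]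
  rfl

lemma fderiv_chartTransition_chartCoord {r q x : N} (hr : x ∈ (chartAt (Model k) r).source)
    (hq : x ∈ (chartAt (Model k) q).source) (v : TangentSpace (𝓡 k) x) :
    fderiv ℝ (chartTransition k r q) (extChartAt (𝓡 k) r x) (chartCoord k r x v) =
      chartCoord k q x v := by
  rw [chartCoord_eq_mvfderiv hq]
  exact (mvfderiv_eq_fderiv hr ((contDiffAt_chartTransition hr hq).differentiableAt (by simp))
    v).symm

lemma fderiv_chartTransition_surjective {r q x : N} (hr : x ∈ (chartAt (Model k) r).source)
    (hq : x ∈ (chartAt (Model k) q).source) :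
    Function.Surjective (fderiv ℝ (chartTransition k r q) (extChartAt (𝓡 k) r x)) := fun u ↦
  ⟨chartCoord k r x (ofChartCoord k q x u), by
    rw [fderiv_chartTransition_chartCoord hr hq, chartCoord_ofChartCoord hq]⟩

end Charts

section MetricInCharts

variable {k : ℕ} {N : Type*} [TopologicalSpace N] [ChartedSpace (Model k) N]
  [IsManifold (𝓡 k) ∞ N] [RiemannianBundle (fun q : N ↦ TangentSpace (𝓡 k) q)]

variable (k) in
/-- The metric tensor in the preferred chart at `q`. -/
def localMetric (q : N) (y : Model k) : Model k →L[ℝ] Model k →L[ℝ] ℝ :=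
  (innerSL ℝ).bilinearComp (ofChartCoord k q ((extChartAt (𝓡 k) q).symm y))
    (ofChartCoord k q ((extChartAt (𝓡 k) q).symm y))

variable (k) in
/-- The Christoffel symbols in the preferred chart at `q`. -/
def localChristoffel (q : N) : Model k → Model k →L[ℝ] Model k →L[ℝ] Model k :=
  leviCivita (localMetric k q)

lemma localMetric_apply (q : N) (y u v : Model k) :
    localMetric k q y u v = inner ℝ (ofChartCoord k q ((extChartAt (𝓡 k) q).symm y) u)
      (ofChartCoord k q ((extChartAt (𝓡 k) q).symm y) v) := rfl

lemma inner_eq_localMetric {q x : N} (hx : x ∈ (chartAt (Model k) q).source)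
    (v w : TangentSpace (𝓡 k) x) :
    inner ℝ v w =
      localMetric k q (extChartAt (𝓡 k) q x) (chartCoord k q x v) (chartCoord k q x w) := by
  rw [localMetric_apply, extChartAt_symm_extChartAt hx, ofChartCoord_chartCoord hx,
    ofChartCoord_chartCoord hx]

lemma localMetric_eq_pullback {r q x : N} (hr : x ∈ (chartAt (Model k) r).source)
    (hq : x ∈ (chartAt (Model k) q).source) (u v : Model k) :
    localMetric k r (extChartAt (𝓡 k) r x) u v =
      localMetric k q (chartTransition k r q (extChartAt (𝓡 k) r x))
        (fderiv ℝ (chartTransition k r q) (extChartAt (𝓡 k) r x) u)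
        (fderiv ℝ (chartTransition k r q) (extChartAt (𝓡 k) r x) v) := by
  rw [chartTransition_extChartAt hr, ← chartCoord_ofChartCoord hr u,
    ← chartCoord_ofChartCoord hr v, fderiv_chartTransition_chartCoord hr hq,
    fderiv_chartTransition_chartCoord hr hq, ← inner_eq_localMetric hr, ← inner_eq_localMetric hq]

lemma eventually_localMetric_eq_pullback {r q x : N} (hr : x ∈ (chartAt (Model k) r).source)
    (hq : x ∈ (chartAt (Model k) q).source) :
    ∀ᶠ y in nhds (extChartAt (𝓡 k) r x), ∀ u v, localMetric k r y u v =
      localMetric k q (chartTransition k r q y) (fderiv ℝ (chartTransition k r q) y u)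
        (fderiv ℝ (chartTransition k r q) y v) := by
  have hmem := extChartAt_mem_target hr
  have hcont := (contMDiffAt_extChartAt_symm hmem).continuousAt
  have hq' : (extChartAt (𝓡 k) r).symm (extChartAt (𝓡 k) r x) ∈ (chartAt (Model k) q).source := by
    rwa [extChartAt_symm_extChartAt hr]
  filter_upwards [target_mem_nhds hmem, hcont (source_mem_nhds hq')] with y hy hyq u v
  simpa only [(extChartAt (𝓡 k) r).right_inv hy] using
    localMetric_eq_pullback (extChartAt_symm_mem_source hy) hyq u v

variable [IsContMDiffRiemannianBundle (𝓡 k) ∞ (Model k) (fun q : N ↦ TangentSpace (𝓡 k) q)]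

lemma contDiffAt_localMetric_apply {q : N} {y : Model k} (hy : y ∈ (extChartAt (𝓡 k) q).target)
    (u v : Model k) : ContDiffAt ℝ ∞ (fun y ↦ localMetric k q y u v) y := by
  have hx := extChartAt_symm_mem_source hy
  have hsec (u : Model k) : ContMDiffAt (𝓡 k) ((𝓡 k).prod 𝓘(ℝ, Model k)) ∞
      (fun x : N ↦
        (⟨x, ofChartCoord k q x u⟩ : TotalSpace (Model k) (fun p : N ↦ TangentSpace (𝓡 k) p)))
      ((extChartAt (𝓡 k) q).symm y) := by
    refine ((trivializationAt (Model k) (fun p : N ↦ TangentSpace (𝓡 k) p)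
      q).contMDiffAt_section_iff hx).2 (contMDiffAt_const (c := u) |>.congr_of_eventuallyEq ?_)
    filter_upwards [source_mem_nhds hx] with x' hx'
    rw [trivializationAt_snd hx', chartCoord_ofChartCoord hx']
  exact (((hsec u).inner_bundle (hsec v)).comp y (contMDiffAt_extChartAt_symm hy)).contDiffAt

lemma isMetricOn_localMetric (q : N) :
    IsMetricOn (localMetric k q) (extChartAt (𝓡 k) q).target where
  isOpen := isOpen_extChartAt_target q
  contDiffOn := contDiffOn_clm_apply.2 fun u ↦ contDiffOn_clm_apply.2 fun v _ hy ↦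
    (contDiffAt_localMetric_apply hy u v).contDiffWithinAt
  symm _ _ _ _ := by rw [localMetric_apply, localMetric_apply, real_inner_comm]
  pos y hy u hu := by
    rw [localMetric_apply]
    refine real_inner_self_pos.2 fun h ↦ hu ?_
    rw [← chartCoord_ofChartCoord (extChartAt_symm_mem_source hy) u, h, map_zero]

lemma christoffelFirst_eq_koszul (q : N) (u v w : TangentSpace (𝓡 k) q) :
    christoffelFirst q u v w = koszul (localMetric k q) (extChartAt (𝓡 k) q q)
      (chartCoord k q q u) (chartCoord k q q v) (chartCoord k q q w) := by
  have hq := mem_chart_source (Model k) q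
  have hy := extChartAt_mem_target hq
  have hderiv (a b c : TangentSpace (𝓡 k) q) :
      mvfderiv (𝓡 k) (fun q' : N ↦ (inner ℝ (constField b q') (constField c q') : ℝ)) q a =
        fderiv ℝ (localMetric k q) (extChartAt (𝓡 k) q q) (chartCoord k q q a)
          (chartCoord k q q b) (chartCoord k q q c) := by
    have heq : (fun y ↦ (inner ℝ (constField b ((extChartAt (𝓡 k) q).symm y))
        (constField c ((extChartAt (𝓡 k) q).symm y)) : ℝ)) =ᶠ[nhds (extChartAt (𝓡 k) q q)]
        fun y ↦ localMetric k q y (chartCoord k q q b) (chartCoord k q q c) := by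
      filter_upwards [target_mem_nhds hy] with y hy
      have hx := extChartAt_symm_mem_source hy
      rw [constField_eq_ofChartCoord b hx, constField_eq_ofChartCoord c hx, localMetric_apply]
    have hdiff := (contDiffAt_localMetric_apply hy (chartCoord k q q b)
      (chartCoord k q q c)).differentiableAt (by simp)
    rw [mvfderiv_eq_fderiv hq (hdiff.congr_of_eventuallyEq heq), heq.fderiv_eq,
      fderiv_clm_apply_apply_const ((isMetricOn_localMetric q).differentiableAt hy)]
  rw [christoffelFirst, hderiv, hderiv, hderiv, koszul_apply]

lemma chartCoord_christoffel (q : N) (u v : TangentSpace (𝓡 k) q) :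
    chartCoord k q q (christoffel q u v) =
      localChristoffel k q (extChartAt (𝓡 k) q q) (chartCoord k q q u) (chartCoord k q q v) := by
  have hq := mem_chart_source (Model k) q
  set z : TangentSpace (𝓡 k) q := ofChartCoord k q q
    (localChristoffel k q (extChartAt (𝓡 k) q q) (chartCoord k q q u) (chartCoord k q q v)) with hz
  have hfirst (w : TangentSpace (𝓡 k) q) : christoffelFirst q u v w = inner ℝ w z := by
    rw [christoffelFirst_eq_koszul, koszul_apply, real_inner_comm, inner_eq_localMetric hq, hz,
      chartCoord_ofChartCoord hq, localChristoffel,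
      (isMetricOn_localMetric q).apply_leviCivita (extChartAt_mem_target hq)]
  have hchristoffel : christoffel q u v = z := by
    simp only [christoffel, hfirst]
    exact (onb k q).sum_repr' z
  rw [hchristoffel, hz, chartCoord_ofChartCoord hq]

lemma contDiffAt_localChristoffel {q : N} {y : Model k} (hy : y ∈ (extChartAt (𝓡 k) q).target) :
    ContDiffAt ℝ ∞ (localChristoffel k q) y :=
  (isMetricOn_localMetric q).contDiffAt_leviCivita hy

end MetricInCharts

section CovariantCalculus

variable {E : Type*} [NormedAddCommGroup E] [NormedSpace ℝ E]
  {F : Type*} [NormedAddCommGroup F] [NormedSpace ℝ F]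
  {H : Type*} [NormedAddCommGroup H] [NormedSpace ℝ H] {z : E}

lemma covDeriv_clm_apply {Γ : F → F →L[ℝ] F →L[ℝ] F} {f : E → F} {A : E → H →L[ℝ] F} {Y : E → H}
    (hA : DifferentiableAt ℝ A z) (hY : DifferentiableAt ℝ Y z) (ξ : E) :
    covDeriv Γ f (fun z ↦ A z (Y z)) z ξ =
      covDeriv Γ f (fun z' ↦ A z' (Y z)) z ξ + A z (fderiv ℝ Y z ξ) := by
  simp only [covDeriv_apply, fderiv_clm_apply hA hY, fderiv_clm_apply_const hA, add_apply,
    ContinuousLinearMap.comp_apply, ContinuousLinearMap.flip_apply]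
  abel

lemma covDeriv_leviCivita_of_pullback {F' : Type*} [NormedAddCommGroup F'] [NormedSpace ℝ F']
    [FiniteDimensional ℝ F] [FiniteDimensional ℝ F'] {G : F → F →L[ℝ] F →L[ℝ] ℝ} {D : Set F}
    {G' : F' → F' →L[ℝ] F' →L[ℝ] ℝ} {D' : Set F'} (hG : IsMetricOn G D) (hG' : IsMetricOn G' D')
    {ψ : F' → F} {f W : E → F'} (hy : f z ∈ D') (hψy : ψ (f z) ∈ D) (hψ : ContDiffAt ℝ 2 ψ (f z))
    (hsurj : Function.Surjective (fderiv ℝ ψ (f z)))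
    (hpull : ∀ᶠ y in nhds (f z), ∀ u v, G' y u v = G (ψ y) (fderiv ℝ ψ y u) (fderiv ℝ ψ y v))
    (hf : DifferentiableAt ℝ f z) (hW : DifferentiableAt ℝ W z) (ξ : E) :
    covDeriv (leviCivita G) (fun z ↦ ψ (f z)) (fun z ↦ fderiv ℝ ψ (f z) (W z)) z ξ =
      fderiv ℝ ψ (f z) (covDeriv (leviCivita G') f W z ξ) := by
  have hdψ := differentiableAt_fderiv hψ
  have hψf : fderiv ℝ (fun z ↦ ψ (f z)) z = (fderiv ℝ ψ (f z)).comp (fderiv ℝ f z) :=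
    fderiv_comp z (hψ.differentiableAt (by simp)) hf
  have hdψf : fderiv ℝ (fun z ↦ fderiv ℝ ψ (f z)) z =
      (fderiv ℝ (fderiv ℝ ψ) (f z)).comp (fderiv ℝ f z) := fderiv_comp z hdψ hf
  have hdψf_diff : DifferentiableAt ℝ (fun z ↦ fderiv ℝ ψ (f z)) z := hdψ.comp z hf
  rw [covDeriv_apply, covDeriv_apply, hψf, fderiv_clm_apply hdψf_diff hW, hdψf, map_add,
    hG.fderiv_leviCivita_of_pullback hG' hy hψy hψ hsurj hpull]
  simp only [add_apply, ContinuousLinearMap.comp_apply, ContinuousLinearMap.flip_apply]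
  abel

end CovariantCalculus

section ChangeOfCharts

variable {n : ℕ} {N : Type*} [TopologicalSpace N] [ChartedSpace (Model n) N] {r q : N}

lemma extChartAt_comp_eventuallyEq {E : Type*} [TopologicalSpace E] {c : E → N} {z : E}
    (hc : ContinuousAt c z)
    (hr : c z ∈ (chartAt (Model n) r).source) :
    (fun z ↦ extChartAt (𝓡 n) q (c z)) =ᶠ[nhds z]
      fun z ↦ chartTransition n r q (extChartAt (𝓡 n) r (c z)) := by
  filter_upwards [hc (source_mem_nhds hr)] with z' hz'
  rw [chartTransition_extChartAt hz']

variable [IsManifold (𝓡 n) ∞ N]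

lemma chartCoord_comp_eventuallyEq {E : Type*} [TopologicalSpace E] {c : E → N}
    {W : ∀ z, TangentSpace (𝓡 n) (c z)} {z : E} (hc : ContinuousAt c z)
    (hr : c z ∈ (chartAt (Model n) r).source) (hq : c z ∈ (chartAt (Model n) q).source) :
    (fun z ↦ chartCoord n q (c z) (W z)) =ᶠ[nhds z] fun z ↦
      fderiv ℝ (chartTransition n r q) (extChartAt (𝓡 n) r (c z)) (chartCoord n r (c z) (W z)) := by
  filter_upwards [hc (source_mem_nhds hr), hc (source_mem_nhds hq)] with z' hr' hq'
  rw [fderiv_chartTransition_chartCoord hr' hq']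

variable {E : Type*} [NormedAddCommGroup E] [NormedSpace ℝ E] {c : E → N}
  {W : ∀ z, TangentSpace (𝓡 n) (c z)} {z : E}

lemma differentiableAt_chartCoord_comp (hc : ContinuousAt c z)
    (hr : c z ∈ (chartAt (Model n) r).source) (hq : c z ∈ (chartAt (Model n) q).source)
    (hf : DifferentiableAt ℝ (fun z ↦ extChartAt (𝓡 n) r (c z)) z)
    (hW : DifferentiableAt ℝ (fun z ↦ chartCoord n r (c z) (W z)) z) :
    DifferentiableAt ℝ (fun z ↦ chartCoord n q (c z) (W z)) z := by
  have hψ : DifferentiableAt ℝ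
      (fun z ↦ fderiv ℝ (chartTransition n r q) (extChartAt (𝓡 n) r (c z))) z :=
    ((contDiffAt_fderiv (contDiffAt_chartTransition hr hq)).differentiableAt (by simp)).comp z hf
  exact (hψ.clm_apply hW).congr_of_eventuallyEq (chartCoord_comp_eventuallyEq hc hr hq)

variable [RiemannianBundle (fun q : N ↦ TangentSpace (𝓡 n) q)]
  [IsContMDiffRiemannianBundle (𝓡 n) ∞ (Model n) (fun q : N ↦ TangentSpace (𝓡 n) q)]

lemma covDeriv_localChristoffel_change_chart (hc : ContinuousAt c z)
    (hr : c z ∈ (chartAt (Model n) r).source) (hq : c z ∈ (chartAt (Model n) q).source)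
    (hf : DifferentiableAt ℝ (fun z ↦ extChartAt (𝓡 n) r (c z)) z)
    (hW : DifferentiableAt ℝ (fun z ↦ chartCoord n r (c z) (W z)) z) (ξ : E) :
    covDeriv (localChristoffel n q) (fun z ↦ extChartAt (𝓡 n) q (c z))
        (fun z ↦ chartCoord n q (c z) (W z)) z ξ =
      fderiv ℝ (chartTransition n r q) (extChartAt (𝓡 n) r (c z))
        (covDeriv (localChristoffel n r) (fun z ↦ extChartAt (𝓡 n) r (c z))
          (fun z ↦ chartCoord n r (c z) (W z)) z ξ) := by
  rw [covDeriv_congr (extChartAt_comp_eventuallyEq hc hr) (chartCoord_comp_eventuallyEq hc hr hq)]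
  refine covDeriv_leviCivita_of_pullback (f := fun z ↦ extChartAt (𝓡 n) r (c z))
    (W := fun z ↦ chartCoord n r (c z) (W z)) (isMetricOn_localMetric q) (isMetricOn_localMetric r)
    (extChartAt_mem_target hr) ?_ ((contDiffAt_chartTransition hr hq).of_le ENat.LEInfty.out)
    (fderiv_chartTransition_surjective hr hq) (eventually_localMetric_eq_pullback hr hq) hf hW ξ
  rw [chartTransition_extChartAt hr]
  exact extChartAt_mem_target hq

end ChangeOfCharts

section MapsInCharts

variable {m n : ℕ}
  {M : Type*} [TopologicalSpace M] [ChartedSpace (Model m) M]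
  {N : Type*} [TopologicalSpace N] [ChartedSpace (Model n) N]

variable (m n) in
/-- A map in the preferred charts at `p` and `q`. -/
def mapInCharts (p : M) (q : N) (φ : M → N) (y : Model m) : Model n :=
  extChartAt (𝓡 n) q (φ ((extChartAt (𝓡 m) p).symm y))

variable {p x : M} {q : N} {φ : M → N}

lemma mapInCharts_extChartAt (hp : x ∈ (chartAt (Model m) p).source) :
    mapInCharts m n p q φ (extChartAt (𝓡 m) p x) = extChartAt (𝓡 n) q (φ x) := by
  rw [mapInCharts, extChartAt_symm_extChartAt hp]

lemma eventually_mem_charts {y : Model m} (hφ : Continuous φ)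
    (hy : y ∈ (extChartAt (𝓡 m) p).target)
    (hq : φ ((extChartAt (𝓡 m) p).symm y) ∈ (chartAt (Model n) q).source) :
    ∀ᶠ y in nhds y, y ∈ (extChartAt (𝓡 m) p).target ∧
      φ ((extChartAt (𝓡 m) p).symm y) ∈ (chartAt (Model n) q).source :=
  (Filter.eventually_mem_set.2 (target_mem_nhds hy)).and
    ((hφ.continuousAt.comp (continuousAt_extChartAt_symm'' hy)) (source_mem_nhds hq))

variable [IsManifold (𝓡 n) ∞ N]

variable (m n) in
/-- The components of a section along a map in the preferred charts at `p` and `q`. -/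
def sectionInCharts (p : M) (q : N) (φ : M → N) (W : ∀ x, TangentSpace (𝓡 n) (φ x))
    (y : Model m) : Model n :=
  chartCoord n q (φ ((extChartAt (𝓡 m) p).symm y)) (W ((extChartAt (𝓡 m) p).symm y))

lemma sectionInCharts_extChartAt {W : ∀ x, TangentSpace (𝓡 n) (φ x)}
    (hp : x ∈ (chartAt (Model m) p).source) :
    sectionInCharts m n p q φ W (extChartAt (𝓡 m) p x) = chartCoord n q (φ x) (W x) := by
  rw [sectionInCharts, extChartAt_symm_extChartAt hp]

variable [IsManifold (𝓡 m) ∞ M]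

lemma differentiableAt_mapInCharts (hp : x ∈ (chartAt (Model m) p).source)
    (hq : φ x ∈ (chartAt (Model n) q).source) (hφ : MDifferentiableAt (𝓡 m) (𝓡 n) φ x) :
    DifferentiableAt ℝ (mapInCharts m n p q φ) (extChartAt (𝓡 m) p x) := by
  have hsymm := (contMDiffAt_extChartAt_symm (extChartAt_mem_target hp)).mdifferentiableAt
    (n := ∞) (by simp)
  have hchart : MDifferentiableAt (𝓡 m) 𝓘(ℝ, Model n) (fun x ↦ extChartAt (𝓡 n) q (φ x))
      ((extChartAt (𝓡 m) p).symm (extChartAt (𝓡 m) p x)) := by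
    rw [extChartAt_symm_extChartAt hp]
    exact ((contMDiffAt_extChartAt_of_mem hq).mdifferentiableAt (by simp)).comp x hφ
  exact (hchart.comp _ hsymm).differentiableAt

lemma contDiffAt_mapInCharts {y : Model m} (hy : y ∈ (extChartAt (𝓡 m) p).target)
    (hq : φ ((extChartAt (𝓡 m) p).symm y) ∈ (chartAt (Model n) q).source)
    (hφ : ContMDiff (𝓡 m) (𝓡 n) ∞ φ) : ContDiffAt ℝ ∞ (mapInCharts m n p q φ) y :=
  ((contMDiffAt_extChartAt_of_mem hq).comp y
    ((hφ _).comp y (contMDiffAt_extChartAt_symm hy))).contDiffAt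

lemma chartCoord_mfderiv (hp : x ∈ (chartAt (Model m) p).source)
    (hq : φ x ∈ (chartAt (Model n) q).source) (hφ : MDifferentiableAt (𝓡 m) (𝓡 n) φ x)
    (X : TangentSpace (𝓡 m) x) :
    chartCoord n q (φ x) (mfderiv (𝓡 m) (𝓡 n) φ x X) =
      fderiv ℝ (mapInCharts m n p q φ) (extChartAt (𝓡 m) p x) (chartCoord m p x X) := by
  have hcomp := mfderiv_comp x
    ((contMDiffAt_extChartAt_of_mem hq).mdifferentiableAt (n := ∞) (by simp)) hφ
  rw [chartCoord_eq_mvfderiv hq]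
  refine Eq.trans ?_ (mvfderiv_eq_fderiv (g := fun x ↦ extChartAt (𝓡 n) q (φ x)) hp
    (differentiableAt_mapInCharts hp hq hφ) X)
  exact (DFunLike.congr_fun hcomp X).symm

variable [RiemannianBundle (fun q : N ↦ TangentSpace (𝓡 n) q)]
  [IsContMDiffRiemannianBundle (𝓡 n) ∞ (Model n) (fun q : N ↦ TangentSpace (𝓡 n) q)]
  {W : ∀ x, TangentSpace (𝓡 n) (φ x)}

lemma chartCoord_self_covAlong (hp : x ∈ (chartAt (Model m) p).source)
    (hφ : MDifferentiableAt (𝓡 m) (𝓡 n) φ x)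
    (hW : DifferentiableAt ℝ (sectionInCharts m n p (φ x) φ W) (extChartAt (𝓡 m) p x))
    (X : TangentSpace (𝓡 m) x) :
    chartCoord n (φ x) (φ x) (covAlong m n φ W x X) =
      covDeriv (localChristoffel n (φ x)) (mapInCharts m n p (φ x) φ)
        (sectionInCharts m n p (φ x) φ W) (extChartAt (𝓡 m) p x) (chartCoord m p x X) := by
  have hr := mem_chart_source (Model n) (φ x)
  have hc : ContinuousAt (fun y ↦ φ ((extChartAt (𝓡 m) p).symm y)) (extChartAt (𝓡 m) p x) :=
    ContinuousAt.comp (g := φ) (by rw [extChartAt_symm_extChartAt hp]; exact hφ.continuousAt)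
      (continuousAt_extChartAt_symm'' (extChartAt_mem_target hp))
  have heq : (fun y ↦ (trivializationAt (Model n) (fun q : N ↦ TangentSpace (𝓡 n) q) (φ x)
      ⟨φ ((extChartAt (𝓡 m) p).symm y), W ((extChartAt (𝓡 m) p).symm y)⟩).2)
      =ᶠ[nhds (extChartAt (𝓡 m) p x)] sectionInCharts m n p (φ x) φ W := by
    have hr' : φ ((extChartAt (𝓡 m) p).symm (extChartAt (𝓡 m) p x)) ∈
        (chartAt (Model n) (φ x)).source := by rwa [extChartAt_symm_extChartAt hp]
    filter_upwards [hc (source_mem_nhds hr')] with y hy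
    exact trivializationAt_snd hy _
  rw [covAlong, trivializationAt_symm hr, map_add, chartCoord_ofChartCoord hr,
    chartCoord_christoffel, chartCoord_mfderiv hp hr hφ,
    mvfderiv_eq_fderiv hp (hW.congr_of_eventuallyEq heq), heq.fderiv_eq, covDeriv_apply,
    sectionInCharts_extChartAt hp, mapInCharts_extChartAt hp]

lemma chartCoord_covAlong (hp : x ∈ (chartAt (Model m) p).source)
    (hq : φ x ∈ (chartAt (Model n) q).source) (hφ : MDifferentiableAt (𝓡 m) (𝓡 n) φ x)
    (hW : DifferentiableAt ℝ (sectionInCharts m n p q φ W) (extChartAt (𝓡 m) p x))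
    (X : TangentSpace (𝓡 m) x) :
    chartCoord n q (φ x) (covAlong m n φ W x X) =
      covDeriv (localChristoffel n q) (mapInCharts m n p q φ) (sectionInCharts m n p q φ W)
        (extChartAt (𝓡 m) p x) (chartCoord m p x X) := by
  have hr := mem_chart_source (Model n) (φ x)
  set c : Model m → N := fun y ↦ φ ((extChartAt (𝓡 m) p).symm y) with hcdef
  have hcx : c (extChartAt (𝓡 m) p x) = φ x := by
    simp only [hcdef, extChartAt_symm_extChartAt hp]
  have hc : ContinuousAt c (extChartAt (𝓡 m) p x) :=
    ContinuousAt.comp (g := φ) (by rw [extChartAt_symm_extChartAt hp]; exact hφ.continuousAt)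
      (continuousAt_extChartAt_symm'' (extChartAt_mem_target hp))
  have hf := differentiableAt_mapInCharts hp hr hφ
  have hWr : DifferentiableAt ℝ (sectionInCharts m n p (φ x) φ W) (extChartAt (𝓡 m) p x) :=
    differentiableAt_chartCoord_comp (c := c) hc (by rwa [hcx]) (by rwa [hcx])
      (differentiableAt_mapInCharts hp hq hφ) hW
  have hchange := covDeriv_localChristoffel_change_chart (r := φ x) (q := q) (c := c)
    (W := fun y ↦ W ((extChartAt (𝓡 m) p).symm y)) hc (by rwa [hcx]) (by rwa [hcx]) hf hWr
    (chartCoord m p x X)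
  rw [hcx] at hchange
  rw [← fderiv_chartTransition_chartCoord hr hq, chartCoord_self_covAlong hp hφ hWr]
  exact hchange.symm

end MapsInCharts

section LeviCivitaInCharts

variable {m : ℕ} {M : Type*} [TopologicalSpace M] [ChartedSpace (Model m) M]
  [IsManifold (𝓡 m) ∞ M]

variable (m) in
/-- The components of a vector field in the preferred chart at `p`. -/
def fieldInChart (p : M) (Y : ∀ x : M, TangentSpace (𝓡 m) x) (y : Model m) : Model m :=
  chartCoord m p ((extChartAt (𝓡 m) p).symm y) (Y ((extChartAt (𝓡 m) p).symm y))

lemma fieldInChart_extChartAt {p x : M} (hp : x ∈ (chartAt (Model m) p).source)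
    (Y : ∀ x : M, TangentSpace (𝓡 m) x) :
    fieldInChart m p Y (extChartAt (𝓡 m) p x) = chartCoord m p x (Y x) := by
  rw [fieldInChart, extChartAt_symm_extChartAt hp]

lemma contDiffAt_fieldInChart_constField {p x : M} (hp : x ∈ (chartAt (Model m) p).source)
    (u : TangentSpace (𝓡 m) x) :
    ContDiffAt ℝ ∞ (fieldInChart m p (constField u)) (extChartAt (𝓡 m) p x) := by
  have hx := mem_chart_source (Model m) x
  have hsmooth : ContDiffAt ℝ ∞ (fun y ↦ fderiv ℝ (chartTransition m x p)
      (chartTransition m p x y) (chartCoord m x x u)) (extChartAt (𝓡 m) p x) := by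
    refine ContDiffAt.clm_apply (ContDiffAt.comp _ ?_ (contDiffAt_chartTransition hp hx))
      contDiffAt_const
    rw [chartTransition_extChartAt hp]
    exact contDiffAt_fderiv (contDiffAt_chartTransition hx hp)
  refine hsmooth.congr_of_eventuallyEq ?_
  filter_upwards [eventually_mem_charts (φ := fun x : M ↦ x) (q := x) continuous_id
    (extChartAt_mem_target hp) (by rwa [extChartAt_symm_extChartAt hp])] with y hy
  rw [fieldInChart, constField_eq_ofChartCoord u hy.2, ← fderiv_chartTransition_chartCoord hy.2
    (extChartAt_symm_mem_source hy.1), chartCoord_ofChartCoord hy.2, chartTransition]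

lemma fieldInChart_constField_eventuallyEq {q : M} {y : Model m}
    (hy : y ∈ (extChartAt (𝓡 m) q).target) (w : TangentSpace (𝓡 m) q) :
    fieldInChart m q (constField w) =ᶠ[nhds y] fun _ ↦ chartCoord m q q w := by
  filter_upwards [target_mem_nhds hy] with y' hy'
  exact chartCoord_constField w (extChartAt_symm_mem_source hy')

lemma mpullbackWithin_constField_eventuallyEq (q : M) (w : TangentSpace (𝓡 m) q) :
    VectorField.mpullbackWithin 𝓘(ℝ, Model m) (𝓡 m) (extChartAt (𝓡 m) q).symm (constField w)
      (range (𝓡 m)) =ᶠ[nhds (extChartAt (𝓡 m) q q)] fun _ ↦ chartCoord m q q w := by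
  filter_upwards [target_mem_nhds (extChartAt_mem_target (mem_chart_source (Model m) q))] with y hy
  have hx := extChartAt_symm_mem_source hy
  have hsymmL := TangentBundle.symmL_trivializationAt (I := 𝓡 m) hx
  rw [(extChartAt (𝓡 m) q).right_inv hy] at hsymmL
  rw [VectorField.mpullbackWithin_apply, constField_eq_ofChartCoord w hx, ofChartCoord, hsymmL]
  exact (isInvertible_mfderivWithin_extChartAt_symm hy).inverse_apply_eq.2 rfl

lemma mlieBracket_constField (q : M) (u v : TangentSpace (𝓡 m) q) :
    VectorField.mlieBracket (𝓡 m) (constField u) (constField v) q = 0 := by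
  have hu := mpullbackWithin_constField_eventuallyEq q u
  have hv := mpullbackWithin_constField_eventuallyEq q v
  rw [VectorField.mlieBracket, VectorField.mlieBracketWithin_apply,
    Filter.EventuallyEq.lieBracketWithin_vectorField_eq
      (hu.filter_mono nhdsWithin_le_nhds) hu.eq_of_nhds
      (hv.filter_mono nhdsWithin_le_nhds) hv.eq_of_nhds]
  have hbracket : VectorField.lieBracketWithin ℝ (fun _ ↦ chartCoord m q q u)
      (fun _ ↦ chartCoord m q q v) ((extChartAt (𝓡 m) q).symm ⁻¹' univ ∩ range (𝓡 m))
      (extChartAt (𝓡 m) q q) = 0 := by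
    simp [VectorField.lieBracketWithin]
  rw [hbracket]
  exact (ContinuousLinearMap.inverse _).map_zero

variable [RiemannianBundle (fun x : M ↦ TangentSpace (𝓡 m) x)]
  [IsContMDiffRiemannianBundle (𝓡 m) ∞ (Model m) (fun x : M ↦ TangentSpace (𝓡 m) x)]

lemma chartCoord_lcConn {p x : M} (hp : x ∈ (chartAt (Model m) p).source)
    {Y : ∀ x : M, TangentSpace (𝓡 m) x}
    (hY : DifferentiableAt ℝ (fieldInChart m p Y) (extChartAt (𝓡 m) p x))
    (X : TangentSpace (𝓡 m) x) :
    chartCoord m p x (lcConn Y x X) =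
      fderiv ℝ (fieldInChart m p Y) (extChartAt (𝓡 m) p x) (chartCoord m p x X)
        + localChristoffel m p (extChartAt (𝓡 m) p x) (chartCoord m p x X)
          (chartCoord m p x (Y x)) := by
  have hcov := chartCoord_covAlong (q := p) (φ := fun x : M ↦ x) (W := Y) hp hp
    mdifferentiableAt_id hY X
  have hid : mapInCharts m m p p (fun x : M ↦ x) =ᶠ[nhds (extChartAt (𝓡 m) p x)] fun y ↦ y := by
    filter_upwards [target_mem_nhds (extChartAt_mem_target hp)] with y hy
    exact (extChartAt (𝓡 m) p).right_inv hy
  rw [covDeriv_congr hid Filter.EventuallyEq.rfl, covDeriv_apply, sectionInCharts_extChartAt hp,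
    fderiv_fun_id] at hcov
  exact hcov

lemma chartCoord_lcConn_constField {q x : M} (hx : x ∈ (chartAt (Model m) q).source)
    (w : TangentSpace (𝓡 m) q) (X : TangentSpace (𝓡 m) x) :
    chartCoord m q x (lcConn (constField w) x X) =
      localChristoffel m q (extChartAt (𝓡 m) q x) (chartCoord m q x X) (chartCoord m q q w) := by
  have hfield := fieldInChart_constField_eventuallyEq (extChartAt_mem_target hx) w
  rw [chartCoord_lcConn hx ((differentiableAt_const _).congr_of_eventuallyEq hfield),
    hfield.fderiv_eq, chartCoord_constField w hx]
  simp

lemma chartCoord_lcConn_lcConn_constField (q : M) (u v w : TangentSpace (𝓡 m) q) :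
    chartCoord m q q (lcConn (fun q' ↦ lcConn (constField w) q' (constField v q')) q u) =
      fderiv ℝ (localChristoffel m q) (extChartAt (𝓡 m) q q) (chartCoord m q q u)
          (chartCoord m q q v) (chartCoord m q q w)
        + localChristoffel m q (extChartAt (𝓡 m) q q) (chartCoord m q q u)
          (localChristoffel m q (extChartAt (𝓡 m) q q) (chartCoord m q q v)
            (chartCoord m q q w)) := by
  have hq := mem_chart_source (Model m) q
  have hy := extChartAt_mem_target hq
  have hΓ := (contDiffAt_localChristoffel hy).differentiableAt (by simp)
  have hinner : fieldInChart m q (fun q' ↦ lcConn (constField w) q' (constField v q'))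
      =ᶠ[nhds (extChartAt (𝓡 m) q q)]
      fun y ↦ localChristoffel m q y (chartCoord m q q v) (chartCoord m q q w) := by
    filter_upwards [target_mem_nhds hy] with y hy
    have hx := extChartAt_symm_mem_source hy
    rw [fieldInChart, chartCoord_lcConn_constField hx, chartCoord_constField v hx,
      (extChartAt (𝓡 m) q).right_inv hy]
  have hdiff := (hΓ.clm_apply (differentiableAt_const (chartCoord m q q v))).clm_apply
    (differentiableAt_const (chartCoord m q q w))
  rw [chartCoord_lcConn hq (hdiff.congr_of_eventuallyEq hinner), hinner.fderiv_eq,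
    fderiv_clm_apply_apply_const hΓ, chartCoord_lcConn_constField hq, chartCoord_constField v hq]

lemma chartCoord_curvature (q : M) (u v w : TangentSpace (𝓡 m) q) :
    chartCoord m q q (curvature q u v w) =
      curvTensor (localChristoffel m q) (extChartAt (𝓡 m) q q) (chartCoord m q q u)
        (chartCoord m q q v) (chartCoord m q q w) := by
  rw [curvature, mlieBracket_constField, map_sub, map_sub, chartCoord_lcConn_lcConn_constField,
    chartCoord_lcConn_lcConn_constField, chartCoord_lcConn_constField (mem_chart_source _ q),
    curvTensor, map_zero, map_zero, zero_apply, sub_zero]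
  abel

end LeviCivitaInCharts

section SecondOrder

variable {m n : ℕ}
  {M : Type*} [TopologicalSpace M] [ChartedSpace (Model m) M] [IsManifold (𝓡 m) ∞ M]
  [RiemannianBundle (fun x : M ↦ TangentSpace (𝓡 m) x)]
  [IsContMDiffRiemannianBundle (𝓡 m) ∞ (Model m) (fun x : M ↦ TangentSpace (𝓡 m) x)]
  {N : Type*} [TopologicalSpace N] [ChartedSpace (Model n) N] [IsManifold (𝓡 n) ∞ N]
  [RiemannianBundle (fun q : N ↦ TangentSpace (𝓡 n) q)]
  [IsContMDiffRiemannianBundle (𝓡 n) ∞ (Model n) (fun q : N ↦ TangentSpace (𝓡 n) q)]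
  {p x : M} {q : N} {φ : M → N}

lemma chartCoord_covAlong_oneForm_sub (hφ : ContMDiff (𝓡 m) (𝓡 n) ∞ φ)
    (hp : x ∈ (chartAt (Model m) p).source) (hq : φ x ∈ (chartAt (Model n) q).source)
    {α : ∀ x, TangentSpace (𝓡 m) x → TangentSpace (𝓡 n) (φ x)}
    {A : Model m → Model m →L[ℝ] Model n} (hA : DifferentiableAt ℝ A (extChartAt (𝓡 m) p x))
    (hα : ∀ x' ∈ (chartAt (Model m) p).source, φ x' ∈ (chartAt (Model n) q).source → ∀ w,
      chartCoord n q (φ x') (α x' w) = A (extChartAt (𝓡 m) p x') (chartCoord m p x' w))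
    (X Y : TangentSpace (𝓡 m) x) :
    chartCoord n q (φ x) (covAlong m n φ (fun x' ↦ α x' (constField Y x')) x X
        - α x (lcConn (constField Y) x X)) =
      covDeriv (localChristoffel n q) (mapInCharts m n p q φ) (fun y ↦ A y (chartCoord m p x Y))
          (extChartAt (𝓡 m) p x) (chartCoord m p x X)
        - A (extChartAt (𝓡 m) p x) (localChristoffel m p (extChartAt (𝓡 m) p x)
            (chartCoord m p x X) (chartCoord m p x Y)) := by
  have hY := (contDiffAt_fieldInChart_constField hp Y).differentiableAt (by simp)
  have hYx : constField Y x = Y := FiberBundle.extend_apply_self _ Y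
  have hsec : sectionInCharts m n p q φ (fun x' ↦ α x' (constField Y x'))
      =ᶠ[nhds (extChartAt (𝓡 m) p x)] fun y ↦ A y (fieldInChart m p (constField Y) y) := by
    filter_upwards [eventually_mem_charts hφ.continuous (extChartAt_mem_target hp)
      (by rwa [extChartAt_symm_extChartAt hp])] with y hy
    rw [sectionInCharts, hα _ (extChartAt_symm_mem_source hy.1) hy.2,
      (extChartAt (𝓡 m) p).right_inv hy.1, fieldInChart]
  rw [map_sub, hα x hp hq, chartCoord_lcConn hp hY, chartCoord_covAlong hp hq
      ((hφ x).mdifferentiableAt (by simp)) ((hA.clm_apply hY).congr_of_eventuallyEq hsec),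
    covDeriv_congr .rfl hsec, covDeriv_clm_apply hA hY, fieldInChart_extChartAt hp, hYx, map_add]
  abel

lemma chartCoord_secondFundamentalForm (hφ : ContMDiff (𝓡 m) (𝓡 n) ∞ φ)
    (hp : x ∈ (chartAt (Model m) p).source) (hq : φ x ∈ (chartAt (Model n) q).source)
    (X Y : TangentSpace (𝓡 m) x) :
    chartCoord n q (φ x) (secondFundamentalForm m n φ x X Y) =
      covDeriv (localChristoffel n q) (mapInCharts m n p q φ)
          (fun y ↦ fderiv ℝ (mapInCharts m n p q φ) y (chartCoord m p x Y))
          (extChartAt (𝓡 m) p x) (chartCoord m p x X)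
        - fderiv ℝ (mapInCharts m n p q φ) (extChartAt (𝓡 m) p x)
          (localChristoffel m p (extChartAt (𝓡 m) p x) (chartCoord m p x X)
            (chartCoord m p x Y)) := by
  have hf := contDiffAt_mapInCharts (extChartAt_mem_target hp)
    (by rwa [extChartAt_symm_extChartAt hp]) hφ
  exact chartCoord_covAlong_oneForm_sub hφ hp hq ((contDiffAt_fderiv hf).differentiableAt (by simp))
    (fun x' hp' hq' w ↦ chartCoord_mfderiv hp' hq' ((hφ x').mdifferentiableAt (by simp)) w) X Y

end SecondOrder

section Slices

variable {E : Type*} [NormedAddCommGroup E] [NormedSpace ℝ E]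
  {F : Type*} [NormedAddCommGroup F] [NormedSpace ℝ F] {Γ : F → F →L[ℝ] F →L[ℝ] F}
  {f W : ℝ × E → F} {t : ℝ} {y : E}

lemma fderiv_slice (hf : DifferentiableAt ℝ f (t, y)) (u : E) :
    fderiv ℝ (fun y ↦ f (t, y)) y u = fderiv ℝ f (t, y) (0, u) :=
  DFunLike.congr_fun (hf.hasFDerivAt.comp y (hasFDerivAt_prodMk_right t y)).fderiv u

lemma fderiv_time (hf : DifferentiableAt ℝ f (t, y)) :
    fderiv ℝ (fun t ↦ f (t, y)) t 1 = fderiv ℝ f (t, y) (1, 0) := by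
  have h : HasFDerivAt (fun t ↦ f (t, y))
      ((fderiv ℝ f (t, y)).comp (ContinuousLinearMap.inl ℝ ℝ E)) t :=
    HasFDerivAt.comp (g := f) t hf.hasFDerivAt (hasFDerivAt_prodMk_left t y)
  rw [h.fderiv]
  rfl

lemma covDeriv_slice (hf : DifferentiableAt ℝ f (t, y)) (hW : DifferentiableAt ℝ W (t, y))
    (u : E) : covDeriv Γ (fun y ↦ f (t, y)) (fun y ↦ W (t, y)) y u =
      covDeriv Γ f W (t, y) (0, u) := by
  rw [covDeriv_apply, fderiv_slice hf, fderiv_slice hW, covDeriv_apply]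

lemma covDeriv_time (hf : DifferentiableAt ℝ f (t, y)) (hW : DifferentiableAt ℝ W (t, y)) :
    covDeriv Γ (fun t ↦ f (t, y)) (fun t ↦ W (t, y)) t 1 = covDeriv Γ f W (t, y) (1, 0) := by
  rw [covDeriv_apply, fderiv_time hf, fderiv_time hW, covDeriv_apply]

/-- The covariant derivative of the one-form `A` along the slices `{t} × E`, with values in vector
fields along `f`, for the connections with Christoffel symbols `Γ` and `γ`. -/
def sliceCovDeriv (Γ : F → F →L[ℝ] F →L[ℝ] F) (f : ℝ × E → F) (A : ℝ × E → ℝ × E →L[ℝ] F)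
    (γ : E → E →L[ℝ] E →L[ℝ] E) (z : ℝ × E) : E →L[ℝ] E →L[ℝ] F :=
  (fderiv ℝ A z + (Γ (f z)).bilinearComp (fderiv ℝ f z) (A z)).bilinearComp
      (ContinuousLinearMap.inr ℝ ℝ E) (ContinuousLinearMap.inr ℝ ℝ E)
    - (ContinuousLinearMap.compL ℝ E E F ((A z).comp (ContinuousLinearMap.inr ℝ ℝ E))).comp (γ z.2)

lemma sliceCovDeriv_apply (Γ : F → F →L[ℝ] F →L[ℝ] F) (f : ℝ × E → F)
    (A : ℝ × E → ℝ × E →L[ℝ] F) (γ : E → E →L[ℝ] E →L[ℝ] E) (z : ℝ × E) (u v : E) :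
    sliceCovDeriv Γ f A γ z u v = fderiv ℝ A z (0, u) (0, v)
      + Γ (f z) (fderiv ℝ f z (0, u)) (A z (0, v)) - A z (0, γ z.2 u v) := rfl

lemma covTrace_slice {ι : Type*} [Fintype ι] {A : ℝ × E → ℝ × E →L[ℝ] F}
    {γ : E → E →L[ℝ] E →L[ℝ] E} {z : ℝ × E} (hA : DifferentiableAt ℝ A z) (e : ι → E) :
    covTrace Γ f A (fun i ↦ (0, e i)) (0, ∑ i, γ z.2 (e i) (e i)) z =
      ∑ i, sliceCovDeriv Γ f A γ z (e i) (e i) := by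
  have hζ : ((0, ∑ i, γ z.2 (e i) (e i)) : ℝ × E) = ∑ i, (0, γ z.2 (e i) (e i)) := by
    simp [Prod.ext_iff, Prod.fst_sum, Prod.snd_sum]
  simp only [covTrace, sliceCovDeriv_apply, covDeriv_apply, fderiv_clm_apply_const hA, hζ, map_sum,
    Finset.sum_sub_distrib]

lemma contDiffAt_sliceCovDeriv_apply {A : ℝ × E → ℝ × E →L[ℝ] F} {γ : E → E →L[ℝ] E →L[ℝ] E}
    {z : ℝ × E} (hΓ : ContDiffAt ℝ ∞ Γ (f z)) (hf : ContDiffAt ℝ ∞ f z) (hA : ContDiffAt ℝ ∞ A z)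
    (hγ : ContDiffAt ℝ ∞ γ z.2) (u v : E) :
    ContDiffAt ℝ ∞ (fun z ↦ sliceCovDeriv Γ f A γ z u v) z := by
  have hγuv : ContDiffAt ℝ ∞ (fun z : ℝ × E ↦ γ z.2 u v) z :=
    ((hγ.comp z contDiffAt_snd).clm_apply contDiffAt_const).clm_apply contDiffAt_const
  exact ((((contDiffAt_fderiv hA).clm_apply contDiffAt_const).clm_apply contDiffAt_const).add
    (((hΓ.comp z hf).clm_apply (contDiffAt_fderiv_apply hf _)).clm_apply
      (hA.clm_apply contDiffAt_const))).sub (hA.clm_apply (contDiffAt_const.prodMk hγuv))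

lemma contDiffAt_of_eventually_eq_covTrace {m : ℕ} {G : Model m → Model m →L[ℝ] Model m →L[ℝ] ℝ}
    {D : Set (Model m)} (hG : IsMetricOn G D) {f τ : ℝ × Model m → F}
    {A : ℝ × Model m → ℝ × Model m →L[ℝ] F} {z : ℝ × Model m} (hz : z.2 ∈ D)
    (hΓ : ContDiffAt ℝ ∞ Γ (f z)) (hf : ContDiffAt ℝ ∞ f z) (hA : ContDiffAt ℝ ∞ A z)
    (hτ : ∀ᶠ z in nhds z, ∃ (k : ℕ) (e : Fin k → Model m), IsParsevalFrame (G z.2) e ∧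
      τ z = covTrace Γ f A (fun i ↦ (0, e i)) (0, ∑ i, leviCivita G z.2 (e i) (e i)) z) :
    ContDiffAt ℝ ∞ τ z := by
  have hD : ∀ᶠ z : ℝ × Model m in nhds z, z.2 ∈ D :=
    continuousAt_snd.eventually (hG.isOpen.mem_nhds hz)
  refine (hG.contDiffAt_metricTrace (p := Prod.snd)
    (B := sliceCovDeriv Γ f A (leviCivita G)) hz contDiffAt_snd fun u v ↦
    contDiffAt_sliceCovDeriv_apply hΓ hf hA (hG.contDiffAt_leviCivita hz) u v).congr_of_eventuallyEq
    ?_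
  filter_upwards [hτ, hD, (hA.of_le (m := 1) (by simp)).eventually (by simp)]
    with z' ⟨k, e, he, hτz⟩ hD' hA'
  rw [hτz, covTrace_slice (hA'.differentiableAt (by simp)),
    he.sum_apply_apply_eq_metricTrace (hG.isInvertible hD')]

end Slices

section Variation

variable {m n : ℕ}
  {M : Type*} [TopologicalSpace M] [ChartedSpace (Model m) M]
  {N : Type*} [TopologicalSpace N] [ChartedSpace (Model n) N]

variable (m n) in
/-- A smooth family of maps `φ_t`, `-ε < t < ε`. -/
def IsVariation (φ : ℝ → M → N) (ε : ℝ) : Prop :=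
  ContMDiffOn (𝓘(ℝ, ℝ).prod (𝓡 m)) (𝓡 n) ∞ (fun z : ℝ × M ↦ φ z.1 z.2) (Ioo (-ε) ε ×ˢ univ)

variable (m n) in
/-- A family of maps in the preferred charts at `p` and `q`. -/
def familyInCharts (p : M) (q : N) (φ : ℝ → M → N) (z : ℝ × Model m) : Model n :=
  mapInCharts m n p q (φ z.1) z.2

variable (m n) in
/-- The set on which a family of maps can be read in the preferred charts at `p` and `q`. -/
def familyDomain (p : M) (q : N) (φ : ℝ → M → N) (ε : ℝ) : Set (ℝ × Model m) :=
  {z | z.1 ∈ Ioo (-ε) ε ∧ z.2 ∈ (extChartAt (𝓡 m) p).target ∧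
    φ z.1 ((extChartAt (𝓡 m) p).symm z.2) ∈ (chartAt (Model n) q).source}

/-- The velocity field `∂φ/∂t` of a family of maps. -/
def velocity (n : ℕ) {M N : Type*} [TopologicalSpace N] [ChartedSpace (Model n) N]
    (φ : ℝ → M → N) (t : ℝ) (x : M) : TangentSpace (𝓡 n) (φ t x) :=
  mfderiv 𝓘(ℝ, ℝ) (𝓡 n) (fun t ↦ φ t x) t (1 : ℝ)

variable {φ : ℝ → M → N} {ε t : ℝ} {p x : M} {q : N} {z : ℝ × Model m}

lemma familyInCharts_extChartAt (hp : x ∈ (chartAt (Model m) p).source) :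
    familyInCharts m n p q φ (t, extChartAt (𝓡 m) p x) = extChartAt (𝓡 n) q (φ t x) :=
  mapInCharts_extChartAt hp

lemma mk_extChartAt_mem_familyDomain (ht : t ∈ Ioo (-ε) ε)
    (hp : x ∈ (chartAt (Model m) p).source) (hq : φ t x ∈ (chartAt (Model n) q).source) :
    (t, extChartAt (𝓡 m) p x) ∈ familyDomain m n p q φ ε :=
  ⟨ht, extChartAt_mem_target hp, by rwa [extChartAt_symm_extChartAt hp]⟩

lemma exists_eq_mk_extChartAt (hz : z ∈ familyDomain m n p q φ ε) :
    ∃ t ∈ Ioo (-ε) ε, ∃ x ∈ (chartAt (Model m) p).source,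
      φ t x ∈ (chartAt (Model n) q).source ∧ z = (t, extChartAt (𝓡 m) p x) :=
  ⟨z.1, hz.1, _, extChartAt_symm_mem_source hz.2.1, hz.2.2,
    Prod.ext rfl ((extChartAt (𝓡 m) p).right_inv hz.2.1).symm⟩

lemma familyInCharts_mem_target (hz : z ∈ familyDomain m n p q φ ε) :
    familyInCharts m n p q φ z ∈ (extChartAt (𝓡 n) q).target := extChartAt_mem_target hz.2.2

lemma IsVariation.contMDiffAt (hφ : IsVariation m n φ ε) (ht : t ∈ Ioo (-ε) ε) (x : M) :
    ContMDiffAt (𝓘(ℝ, ℝ).prod (𝓡 m)) (𝓡 n) ∞ (fun z : ℝ × M ↦ φ z.1 z.2) (t, x) :=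
  ContMDiffOn.contMDiffAt hφ ((isOpen_Ioo.prod isOpen_univ).mem_nhds ⟨ht, mem_univ x⟩)

lemma IsVariation.contMDiff_slice (hφ : IsVariation m n φ ε) (ht : t ∈ Ioo (-ε) ε) :
    ContMDiff (𝓡 m) (𝓡 n) ∞ (φ t) := fun x ↦
  (hφ.contMDiffAt ht x).comp (f := fun x : M ↦ (t, x)) x (contMDiffAt_const.prodMk contMDiffAt_id)

lemma IsVariation.contMDiffAt_curve (hφ : IsVariation m n φ ε) (ht : t ∈ Ioo (-ε) ε) (x : M) :
    ContMDiffAt 𝓘(ℝ, ℝ) (𝓡 n) ∞ (fun t ↦ φ t x) t :=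
  (hφ.contMDiffAt ht x).comp (f := fun t : ℝ ↦ (t, x)) t (contMDiffAt_id.prodMk contMDiffAt_const)

section DomainManifold

variable [IsManifold (𝓡 m) ∞ M]

lemma contMDiffAt_family_symm (hφ : IsVariation m n φ ε) (ht : z.1 ∈ Ioo (-ε) ε)
    (hy : z.2 ∈ (extChartAt (𝓡 m) p).target) :
    ContMDiffAt 𝓘(ℝ, ℝ × Model m) (𝓡 n) ∞
      (fun z : ℝ × Model m ↦ φ z.1 ((extChartAt (𝓡 m) p).symm z.2)) z := by
  have hchart : ContMDiffAt 𝓘(ℝ, ℝ × Model m) (𝓘(ℝ, ℝ).prod (𝓡 m)) ∞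
      (fun z : ℝ × Model m ↦ (z.1, (extChartAt (𝓡 m) p).symm z.2)) z :=
    contDiff_fst.contMDiff.contMDiffAt.prodMk
      (ContMDiffAt.comp z (contMDiffAt_extChartAt_symm hy) contDiff_snd.contMDiff.contMDiffAt)
  exact ContMDiffAt.comp z (hφ.contMDiffAt ht _) hchart

lemma familyDomain_mem_nhds (hφ : IsVariation m n φ ε) (hz : z ∈ familyDomain m n p q φ ε) :
    familyDomain m n p q φ ε ∈ nhds z := by
  filter_upwards [continuousAt_fst.eventually (isOpen_Ioo.mem_nhds hz.1),
    continuousAt_snd.eventually (target_mem_nhds hz.2.1),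
    (contMDiffAt_family_symm hφ hz.1 hz.2.1).continuousAt.eventually (source_mem_nhds hz.2.2)]
    with z' ht hy hq using ⟨ht, hy, hq⟩

variable [IsManifold (𝓡 n) ∞ N]

lemma contDiffAt_familyInCharts (hφ : IsVariation m n φ ε)
    (hz : z ∈ familyDomain m n p q φ ε) : ContDiffAt ℝ ∞ (familyInCharts m n p q φ) z :=
  ((contMDiffAt_extChartAt_of_mem hz.2.2).comp z
    (contMDiffAt_family_symm hφ hz.1 hz.2.1)).contDiffAt

lemma differentiableAt_familyInCharts (hφ : IsVariation m n φ ε)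
    (hz : z ∈ familyDomain m n p q φ ε) : DifferentiableAt ℝ (familyInCharts m n p q φ) z :=
  (contDiffAt_familyInCharts hφ hz).differentiableAt (by simp)

lemma chartCoord_mfderiv_family (hφ : IsVariation m n φ ε) (ht : t ∈ Ioo (-ε) ε)
    (hp : x ∈ (chartAt (Model m) p).source) (hq : φ t x ∈ (chartAt (Model n) q).source)
    (X : TangentSpace (𝓡 m) x) :
    chartCoord n q (φ t x) (mfderiv (𝓡 m) (𝓡 n) (φ t) x X) =
      fderiv ℝ (familyInCharts m n p q φ) (t, extChartAt (𝓡 m) p x) (0, chartCoord m p x X) := by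
  rw [chartCoord_mfderiv hp hq ((hφ.contMDiff_slice ht x).mdifferentiableAt (by simp)),
    ← fderiv_slice (differentiableAt_familyInCharts hφ (mk_extChartAt_mem_familyDomain ht hp hq))]
  rfl

lemma chartCoord_velocity (hφ : IsVariation m n φ ε) (ht : t ∈ Ioo (-ε) ε)
    (hp : x ∈ (chartAt (Model m) p).source) (hq : φ t x ∈ (chartAt (Model n) q).source) :
    chartCoord n q (φ t x) (velocity n φ t x) =
      fderiv ℝ (familyInCharts m n p q φ) (t, extChartAt (𝓡 m) p x) (1, 0) := by
  have hcomp := mfderiv_comp t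
    ((contMDiffAt_extChartAt_of_mem hq).mdifferentiableAt (n := ∞) (by simp))
    ((hφ.contMDiffAt_curve ht x).mdifferentiableAt (by simp))
  have hcurve : (fun s ↦ familyInCharts m n p q φ (s, extChartAt (𝓡 m) p x)) =
      extChartAt (𝓡 n) q ∘ fun s ↦ φ s x := funext fun s ↦ familyInCharts_extChartAt hp
  rw [← fderiv_time (differentiableAt_familyInCharts hφ (mk_extChartAt_mem_familyDomain ht hp hq)),
    hcurve, ← mfderiv_eq_fderiv, hcomp, chartCoord_eq_mvfderiv hq]
  rfl

end DomainManifold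

end Variation

section FamilySections

variable {m n : ℕ}
  {M : Type*} [TopologicalSpace M] [ChartedSpace (Model m) M]
  {N : Type*} [TopologicalSpace N] [ChartedSpace (Model n) N] [IsManifold (𝓡 n) ∞ N]
  {φ : ℝ → M → N} {ε t : ℝ} {p x : M} {q : N} {z : ℝ × Model m}
  {W : ∀ t x, TangentSpace (𝓡 n) (φ t x)}

variable (m n) in
/-- The components of a section along a family of maps in the preferred charts at `p` and `q`. -/
def familySectionInCharts (p : M) (q : N) (φ : ℝ → M → N)
    (W : ∀ t x, TangentSpace (𝓡 n) (φ t x)) (z : ℝ × Model m) : Model n :=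
  sectionInCharts m n p q (φ z.1) (W z.1) z.2

variable (m n) in
/-- A section along a family of maps is smooth if its components in all charts are. -/
def IsSmoothSection (φ : ℝ → M → N) (ε : ℝ) (W : ∀ t x, TangentSpace (𝓡 n) (φ t x)) : Prop :=
  ∀ (p : M) (q : N), ∀ z ∈ familyDomain m n p q φ ε,
    ContDiffAt ℝ ∞ (familySectionInCharts m n p q φ W) z

lemma familySectionInCharts_extChartAt (hp : x ∈ (chartAt (Model m) p).source) :
    familySectionInCharts m n p q φ W (t, extChartAt (𝓡 m) p x) = chartCoord n q (φ t x) (W t x) :=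
  sectionInCharts_extChartAt hp

end FamilySections

section FamilyCalculus

variable {m n : ℕ}
  {M : Type*} [TopologicalSpace M] [ChartedSpace (Model m) M]
  {N : Type*} [TopologicalSpace N] [ChartedSpace (Model n) N] [IsManifold (𝓡 n) ∞ N]
  {φ : ℝ → M → N} {ε t : ℝ} {p x : M} {q : N} {z : ℝ × Model m}
  {W : ∀ t x, TangentSpace (𝓡 n) (φ t x)}

lemma IsSmoothSection.differentiableAt (hW : IsSmoothSection m n φ ε W)
    (hz : z ∈ familyDomain m n p q φ ε) :
    DifferentiableAt ℝ (familySectionInCharts m n p q φ W) z :=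
  (hW p q z hz).differentiableAt (by simp)

lemma contDiffAt_localChristoffel_familyInCharts
    [RiemannianBundle (fun q : N ↦ TangentSpace (𝓡 n) q)]
    [IsContMDiffRiemannianBundle (𝓡 n) ∞ (Model n) (fun q : N ↦ TangentSpace (𝓡 n) q)]
    (hz : z ∈ familyDomain m n p q φ ε) :
    ContDiffAt ℝ ∞ (localChristoffel n q) (familyInCharts m n p q φ z) :=
  contDiffAt_localChristoffel (familyInCharts_mem_target hz)

variable [IsManifold (𝓡 m) ∞ M]

lemma isSmoothSection_velocity (hφ : IsVariation m n φ ε) :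
    IsSmoothSection m n φ ε (velocity n φ) := by
  intro p q z hz
  refine (contDiffAt_fderiv_apply (contDiffAt_familyInCharts hφ hz) (1, 0)).congr_of_eventuallyEq ?_
  filter_upwards [familyDomain_mem_nhds hφ hz] with z' hz'
  obtain ⟨t, ht, x, hp, hq, rfl⟩ := exists_eq_mk_extChartAt hz'
  rw [familySectionInCharts_extChartAt hp, chartCoord_velocity hφ ht hp hq]

variable [RiemannianBundle (fun q : N ↦ TangentSpace (𝓡 n) q)]
  [IsContMDiffRiemannianBundle (𝓡 n) ∞ (Model n) (fun q : N ↦ TangentSpace (𝓡 n) q)]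

lemma IsSmoothSection.contDiffAt_covDeriv (hφ : IsVariation m n φ ε)
    (hW : IsSmoothSection m n φ ε W) (hz : z ∈ familyDomain m n p q φ ε) :
    ContDiffAt ℝ ∞ (covDeriv (localChristoffel n q) (familyInCharts m n p q φ)
      (familySectionInCharts m n p q φ W)) z :=
  Riem.contDiffAt_covDeriv (contDiffAt_localChristoffel_familyInCharts hz)
    (contDiffAt_familyInCharts hφ hz) (hW p q z hz)

lemma chartCoord_covAlong_family (hφ : IsVariation m n φ ε) (hW : IsSmoothSection m n φ ε W)
    (ht : t ∈ Ioo (-ε) ε) (hp : x ∈ (chartAt (Model m) p).source)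
    (hq : φ t x ∈ (chartAt (Model n) q).source) (X : TangentSpace (𝓡 m) x) :
    chartCoord n q (φ t x) (covAlong m n (φ t) (W t) x X) =
      covDeriv (localChristoffel n q) (familyInCharts m n p q φ)
        (familySectionInCharts m n p q φ W) (t, extChartAt (𝓡 m) p x) (0, chartCoord m p x X) := by
  have hz := mk_extChartAt_mem_familyDomain ht hp hq
  have hWt : DifferentiableAt ℝ (sectionInCharts m n p q (φ t) (W t)) (extChartAt (𝓡 m) p x) :=
    (hW.differentiableAt hz).comp (f := fun y ↦ (t, y)) _
      (hasFDerivAt_prodMk_right _ _).differentiableAt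
  rw [chartCoord_covAlong hp hq ((hφ.contMDiff_slice ht x).mdifferentiableAt (by simp)) hWt,
    ← covDeriv_slice (differentiableAt_familyInCharts hφ hz) (hW.differentiableAt hz)]
  rfl

variable (n) in
/-- The covariant derivative `∇̄_{∂/∂t} W` of a section along a family of maps. -/
def covTime (φ : ℝ → M → N) (W : ∀ t x, TangentSpace (𝓡 n) (φ t x)) (t : ℝ) (x : M) :
    TangentSpace (𝓡 n) (φ t x) :=
  ofChartCoord n (φ t x) (φ t x) (covDeriv (localChristoffel n (φ t x))
    (fun s ↦ extChartAt (𝓡 n) (φ t x) (φ s x)) (fun s ↦ chartCoord n (φ t x) (φ s x) (W s x)) t 1)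

lemma chartCoord_covTime (hφ : IsVariation m n φ ε) (hW : IsSmoothSection m n φ ε W)
    (ht : t ∈ Ioo (-ε) ε) (hp : x ∈ (chartAt (Model m) p).source)
    (hq : φ t x ∈ (chartAt (Model n) q).source) :
    chartCoord n q (φ t x) (covTime n φ W t x) =
      covDeriv (localChristoffel n q) (familyInCharts m n p q φ)
        (familySectionInCharts m n p q φ W) (t, extChartAt (𝓡 m) p x) (1, 0) := by
  have hz := mk_extChartAt_mem_familyDomain ht hp hq
  have hr := mem_chart_source (Model n) (φ t x)
  have hf := differentiableAt_familyInCharts hφ hz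
  have hWd := hW.differentiableAt hz
  have htime : DifferentiableAt ℝ (fun s ↦ (s, extChartAt (𝓡 m) p x)) t :=
    (hasFDerivAt_prodMk_left _ _).differentiableAt
  have hft := DifferentiableAt.comp (g := familyInCharts m n p q φ) t hf htime
  have hWt := DifferentiableAt.comp (g := familySectionInCharts m n p q φ W) t hWd htime
  have hcovt := covDeriv_time (Γ := localChristoffel n q) hf hWd
  simp only [Function.comp_def, familyInCharts_extChartAt hp, familySectionInCharts_extChartAt hp]
    at hft hWt hcovt
  have hchange := covDeriv_localChristoffel_change_chart (c := fun s ↦ φ s x)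
    (W := fun s ↦ W s x) (r := q) (q := φ t x) (hφ.contMDiffAt_curve ht x).continuousAt hq hr
    hft hWt 1
  rw [covTime, hchange, hcovt, ← chartCoord_ofChartCoord hq (covDeriv _ _ _ _ _),
    fderiv_chartTransition_chartCoord hq hr, ofChartCoord_chartCoord hr]

section Traces

variable [RiemannianBundle (fun x : M ↦ TangentSpace (𝓡 m) x)]

variable (m) in
/-- The components of the orthonormal basis at `x` in the preferred chart at `p`. -/
def onbInChart (p x : M) (i : Fin (Module.finrank ℝ (TangentSpace (𝓡 m) x))) : Model m :=
  chartCoord m p x (onb m x i)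

lemma isParsevalFrame_onbInChart (hp : x ∈ (chartAt (Model m) p).source) :
    IsParsevalFrame (localMetric m p (extChartAt (𝓡 m) p x)) (onbInChart m p x) := by
  intro u
  have hrepr := congrArg (chartCoord m p x) ((onb m x).sum_repr' (ofChartCoord m p x u))
  rw [chartCoord_ofChartCoord hp, map_sum] at hrepr
  refine Eq.trans (Finset.sum_congr rfl fun i _ ↦ ?_) hrepr
  rw [map_smul, real_inner_comm, inner_eq_localMetric hp, chartCoord_ofChartCoord hp, onbInChart]

variable [IsContMDiffRiemannianBundle (𝓡 m) ∞ (Model m) (fun x : M ↦ TangentSpace (𝓡 m) x)]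

lemma chartCoord_covAlong_oneForm_sub_family (hφ : IsVariation m n φ ε) (ht : t ∈ Ioo (-ε) ε)
    (hp : x ∈ (chartAt (Model m) p).source) (hq : φ t x ∈ (chartAt (Model n) q).source)
    {α : ∀ x, TangentSpace (𝓡 m) x → TangentSpace (𝓡 n) (φ t x)}
    {A : ℝ × Model m → ℝ × Model m →L[ℝ] Model n}
    (hA : DifferentiableAt ℝ A (t, extChartAt (𝓡 m) p x))
    (hα : ∀ x' ∈ (chartAt (Model m) p).source, φ t x' ∈ (chartAt (Model n) q).source → ∀ w,
      chartCoord n q (φ t x') (α x' w) =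
        A (t, extChartAt (𝓡 m) p x') (0, chartCoord m p x' w))
    (X Y : TangentSpace (𝓡 m) x) :
    chartCoord n q (φ t x) (covAlong m n (φ t) (fun x' ↦ α x' (constField Y x')) x X
        - α x (lcConn (constField Y) x X)) =
      sliceCovDeriv (localChristoffel n q) (familyInCharts m n p q φ) A (localChristoffel m p)
        (t, extChartAt (𝓡 m) p x) (chartCoord m p x X) (chartCoord m p x Y) := by
  have hf := differentiableAt_familyInCharts hφ (mk_extChartAt_mem_familyDomain ht hp hq)
  have hAt : DifferentiableAt ℝ (fun y ↦ (A (t, y)).comp (ContinuousLinearMap.inr ℝ ℝ (Model m)))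
      (extChartAt (𝓡 m) p x) :=
    (hA.comp (f := fun y ↦ (t, y)) _ (hasFDerivAt_prodMk_right _ _).differentiableAt).clm_comp
      (differentiableAt_const _)
  have hslice := covDeriv_slice (Γ := localChristoffel n q) hf
    (hA.clm_apply (differentiableAt_const (0, chartCoord m p x Y))) (chartCoord m p x X)
  rw [covDeriv_apply (z := (_, _)), fderiv_clm_apply_const hA] at hslice
  rw [chartCoord_covAlong_oneForm_sub (hφ.contMDiff_slice ht) hp hq hAt hα, sliceCovDeriv_apply,
    ← hslice]
  rfl

variable (m) in
/-- The components `∑ Γ(e_i, e_i)` of the vector `∑ ∇_{e_i} e_i` at `x` in the preferred chart at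
`p`, for the extensions of the `e_i` with constant components in that chart. -/
def christoffelTrace (p x : M) : Model m :=
  ∑ i, localChristoffel m p (extChartAt (𝓡 m) p x) (onbInChart m p x i) (onbInChart m p x i)

lemma chartCoord_sum_covAlong_oneForm_sub (hφ : IsVariation m n φ ε) (ht : t ∈ Ioo (-ε) ε)
    (hp : x ∈ (chartAt (Model m) p).source) (hq : φ t x ∈ (chartAt (Model n) q).source)
    {α : ∀ x, TangentSpace (𝓡 m) x → TangentSpace (𝓡 n) (φ t x)}
    {A : ℝ × Model m → ℝ × Model m →L[ℝ] Model n}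
    (hA : DifferentiableAt ℝ A (t, extChartAt (𝓡 m) p x))
    (hα : ∀ x' ∈ (chartAt (Model m) p).source, φ t x' ∈ (chartAt (Model n) q).source → ∀ w,
      chartCoord n q (φ t x') (α x' w) =
        A (t, extChartAt (𝓡 m) p x') (0, chartCoord m p x' w)) :
    chartCoord n q (φ t x) (∑ i, (covAlong m n (φ t) (fun x' ↦ α x' (constField (onb m x i) x')) x
        (onb m x i) - α x (lcConn (constField (onb m x i)) x (onb m x i)))) =
      covTrace (localChristoffel n q) (familyInCharts m n p q φ) A (fun i ↦ (0, onbInChart m p x i))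
        (0, christoffelTrace m p x) (t, extChartAt (𝓡 m) p x) := by
  rw [christoffelTrace, covTrace_slice (γ := localChristoffel m p)
    (z := (t, extChartAt (𝓡 m) p x)) hA, map_sum]
  exact Finset.sum_congr rfl fun i _ ↦
    chartCoord_covAlong_oneForm_sub_family hφ ht hp hq hA hα _ _

lemma chartCoord_tension (hφ : IsVariation m n φ ε) (ht : t ∈ Ioo (-ε) ε)
    (hp : x ∈ (chartAt (Model m) p).source) (hq : φ t x ∈ (chartAt (Model n) q).source) :
    chartCoord n q (φ t x) (tension m n (φ t) x) =
      covTrace (localChristoffel n q) (familyInCharts m n p q φ)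
        (fderiv ℝ (familyInCharts m n p q φ)) (fun i ↦ (0, onbInChart m p x i))
        (0, christoffelTrace m p x) (t, extChartAt (𝓡 m) p x) :=
  chartCoord_sum_covAlong_oneForm_sub hφ ht hp hq
    ((contDiffAt_fderiv (contDiffAt_familyInCharts hφ
      (mk_extChartAt_mem_familyDomain ht hp hq))).differentiableAt (by simp))
    fun _ hp' hq' ↦ chartCoord_mfderiv_family hφ ht hp' hq'

lemma chartCoord_roughLaplacian (hφ : IsVariation m n φ ε) (hW : IsSmoothSection m n φ ε W)
    (ht : t ∈ Ioo (-ε) ε) (hp : x ∈ (chartAt (Model m) p).source)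
    (hq : φ t x ∈ (chartAt (Model n) q).source) :
    chartCoord n q (φ t x) (roughLaplacian m n (φ t) (W t) x) =
      -covTrace (localChristoffel n q) (familyInCharts m n p q φ)
        (covDeriv (localChristoffel n q) (familyInCharts m n p q φ)
          (familySectionInCharts m n p q φ W)) (fun i ↦ (0, onbInChart m p x i))
        (0, christoffelTrace m p x) (t, extChartAt (𝓡 m) p x) := by
  rw [roughLaplacian, map_neg]
  exact congrArg Neg.neg (chartCoord_sum_covAlong_oneForm_sub hφ ht hp hq
    ((hW.contDiffAt_covDeriv hφ (mk_extChartAt_mem_familyDomain ht hp hq)).differentiableAt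
      (by simp)) fun _ hp' hq' ↦ chartCoord_covAlong_family hφ hW ht hp' hq')

lemma contDiffAt_familySectionInCharts_of_eq_covTrace (hφ : IsVariation m n φ ε)
    (hz : z ∈ familyDomain m n p q φ ε) {A : ℝ × Model m → ℝ × Model m →L[ℝ] Model n}
    (hA : ContDiffAt ℝ ∞ A z)
    (hW : ∀ t ∈ Ioo (-ε) ε, ∀ x ∈ (chartAt (Model m) p).source,
      φ t x ∈ (chartAt (Model n) q).source → chartCoord n q (φ t x) (W t x) =
        covTrace (localChristoffel n q) (familyInCharts m n p q φ) A
          (fun i ↦ (0, onbInChart m p x i)) (0, christoffelTrace m p x)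
          (t, extChartAt (𝓡 m) p x)) :
    ContDiffAt ℝ ∞ (familySectionInCharts m n p q φ W) z := by
  refine contDiffAt_of_eventually_eq_covTrace (isMetricOn_localMetric p) hz.2.1
    (contDiffAt_localChristoffel_familyInCharts hz) (contDiffAt_familyInCharts hφ hz) hA ?_
  filter_upwards [familyDomain_mem_nhds hφ hz] with z' hz'
  obtain ⟨t, ht, x, hp, hq, rfl⟩ := exists_eq_mk_extChartAt hz'
  exact ⟨_, onbInChart m p x, isParsevalFrame_onbInChart hp,
    (familySectionInCharts_extChartAt hp).trans (hW t ht x hp hq)⟩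

lemma isSmoothSection_tension (hφ : IsVariation m n φ ε) :
    IsSmoothSection m n φ ε (fun t ↦ tension m n (φ t)) := fun _ _ _ hz ↦
  contDiffAt_familySectionInCharts_of_eq_covTrace hφ hz
    (contDiffAt_fderiv (contDiffAt_familyInCharts hφ hz))
    fun _ ht _ hp hq ↦ chartCoord_tension hφ ht hp hq

lemma isSmoothSection_roughLaplacian (hφ : IsVariation m n φ ε)
    (hW : IsSmoothSection m n φ ε W) :
    IsSmoothSection m n φ ε (fun t ↦ roughLaplacian m n (φ t) (W t)) := by
  intro p q z hz
  have hneg : ContDiffAt ℝ ∞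
      (familySectionInCharts m n p q φ fun t x ↦ -roughLaplacian m n (φ t) (W t) x) z :=
    contDiffAt_familySectionInCharts_of_eq_covTrace hφ hz (hW.contDiffAt_covDeriv hφ hz)
      fun _ ht _ hp hq ↦ by rw [map_neg, chartCoord_roughLaplacian hφ hW ht hp hq, neg_neg]
  refine hneg.neg.congr_of_eventuallyEq (Filter.Eventually.of_forall fun z ↦ ?_)
  simp only [familySectionInCharts, sectionInCharts, map_neg, neg_neg]

end Traces

end FamilyCalculus

section Measure

lemma restrict_iSup_eq_of_restrict_inter_eq {X ι : Type*} [MeasurableSpace X] {μ : ι → Measure X}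
    {U : ι → Set X} (hU : ∀ i, MeasurableSet (U i)) (hnull : ∀ i, μ i (U i)ᶜ = 0)
    (hinter : ∀ i j, (μ i).restrict (U i ∩ U j) = (μ j).restrict (U i ∩ U j)) (i : ι) :
    (⨆ j, μ j).restrict (U i) = μ i := by
  have hself (j : ι) : (μ j).restrict (U j) = μ j :=
    Measure.restrict_eq_self_of_ae_mem (hnull j)
  have hle : ⨆ j, μ j ≤ μ i + (⨆ j, μ j).restrict (U i)ᶜ := by
    refine iSup_le fun j ↦ ?_
    rw [← Measure.restrict_add_restrict_compl (μ := μ j) (hU i)]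
    refine add_le_add ?_ (Measure.restrict_mono le_rfl (le_iSup μ j))
    rw [← hself j, Measure.restrict_restrict (hU i), ← hinter i j]
    exact Measure.restrict_le_self
  apply le_antisymm
  · calc (⨆ j, μ j).restrict (U i)
        ≤ (μ i + (⨆ j, μ j).restrict (U i)ᶜ).restrict (U i) := Measure.restrict_mono le_rfl hle
      _ = μ i := by
        rw [Measure.restrict_add, hself, Measure.restrict_restrict (hU i), inter_compl_self,
          Measure.restrict_empty, add_zero]
  · exact (hself i).ge.trans (Measure.restrict_mono le_rfl (le_iSup μ i))

lemma det_gram_of_pullback {k : ℕ} {g g' : Model k →L[ℝ] Model k →L[ℝ] ℝ}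
    {L : Model k →L[ℝ] Model k} (h : ∀ u v, g' u v = g (L u) (L v)) :
    (gram g').det = L.det ^ 2 * (gram g).det := by
  set J : Matrix (Fin k) (Fin k) ℝ := Matrix.of fun c a ↦ L (coordVec a) c with hJ
  have hdet : J.det = L.det := by
    rw [ContinuousLinearMap.det,
      ← LinearMap.det_toMatrix (EuclideanSpace.basisFun (Fin k) ℝ).toBasis]
    congr 1
  have hmul : gram g' = J.transpose * gram g * J := by
    ext a b
    rw [gram, Matrix.of_apply, h, apply_eq_sum_gram, Matrix.mul_apply]
    simp only [Matrix.mul_apply, Matrix.transpose_apply, hJ, Matrix.of_apply, Finset.sum_mul]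
    exact Finset.sum_comm
  rw [hmul, Matrix.det_mul, Matrix.det_mul, Matrix.det_transpose, hdet]
  ring

end Measure

section Volume

variable {k : ℕ} {N : Type*} [TopologicalSpace N] [ChartedSpace (Model k) N]

variable (k) in
/-- The part of `A` in the domain of the preferred chart at `q`, in coordinates. -/
def chartPreimage (q : N) (A : Set N) : Set (Model k) :=
  (extChartAt (𝓡 k) q).symm ⁻¹' A ∩ (extChartAt (𝓡 k) q).target

lemma chartTransition_image_chartPreimage {r q : N} {A : Set N}
    (hr : A ⊆ (chartAt (Model k) r).source) (hq : A ⊆ (chartAt (Model k) q).source) :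
    chartTransition k r q '' chartPreimage k r A = chartPreimage k q A := by
  ext y
  constructor
  · rintro ⟨y, ⟨hyA, -⟩, rfl⟩
    refine ⟨?_, extChartAt_mem_target (hq hyA)⟩
    rwa [mem_preimage, chartTransition, extChartAt_symm_extChartAt (hq hyA)]
  · rintro ⟨hyA, hy⟩
    refine ⟨extChartAt (𝓡 k) r ((extChartAt (𝓡 k) q).symm y),
      ⟨?_, extChartAt_mem_target (hr hyA)⟩, ?_⟩
    · rwa [mem_preimage, extChartAt_symm_extChartAt (hr hyA)]
    · rw [chartTransition_extChartAt (hr hyA), (extChartAt (𝓡 k) q).right_inv hy]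

lemma injOn_chartTransition {r q : N} {A : Set N} (hq : A ⊆ (chartAt (Model k) q).source) :
    InjOn (chartTransition k r q) (chartPreimage k r A) := by
  rintro y ⟨hyA, hy⟩ y' ⟨hyA', hy'⟩ h
  have hsymm := congrArg (extChartAt (𝓡 k) q).symm h
  rw [chartTransition, chartTransition, extChartAt_symm_extChartAt (hq hyA),
    extChartAt_symm_extChartAt (hq hyA')] at hsymm
  rw [← (extChartAt (𝓡 k) r).right_inv hy, hsymm, (extChartAt (𝓡 k) r).right_inv hy']

lemma measurableSet_chartPreimage [MeasurableSpace N] [BorelSpace N] (q : N) {A : Set N}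
    (hA : MeasurableSet A) : MeasurableSet (chartPreimage k q A) := by
  have hsymm : Measurable ((extChartAt (𝓡 k) q).target.domRestrict (extChartAt (𝓡 k) q).symm) :=
    (continuousOn_iff_continuous_domRestrict.1 (continuousOn_extChartAt_symm q)).measurable
  convert (isOpen_extChartAt_target q).measurableSet.subtype_image (hsymm hA) using 1
  ext y
  simp [chartPreimage, and_comm]

lemma aemeasurable_extChartAt_symm
    [MeasurableSpace N] [BorelSpace N] (q : N) {f : Model k → ENNReal} :
    AEMeasurable (extChartAt (𝓡 k) q).symm
      ((volume.restrict (extChartAt (𝓡 k) q).target).withDensity f) :=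
  ((continuousOn_extChartAt_symm q).aemeasurable
    (isOpen_extChartAt_target q).measurableSet).mono_ac (withDensity_absolutelyContinuous _ _)

variable [IsManifold (𝓡 k) ∞ N] [RiemannianBundle (fun q : N ↦ TangentSpace (𝓡 k) q)]

variable (k) in
/-- The density `√(det g_ij)` of the Riemannian measure in the preferred chart at `q`. -/
def volumeDensity (q : N) (y : Model k) : ℝ := √(gram (localMetric k q y)).det

lemma volumeDensity_eq_abs_det_mul {r q x : N} (hr : x ∈ (chartAt (Model k) r).source)
    (hq : x ∈ (chartAt (Model k) q).source) :
    volumeDensity k r (extChartAt (𝓡 k) r x) =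
      |(fderiv ℝ (chartTransition k r q) (extChartAt (𝓡 k) r x)).det|
        * volumeDensity k q (chartTransition k r q (extChartAt (𝓡 k) r x)) := by
  rw [volumeDensity, volumeDensity, det_gram_of_pullback (localMetric_eq_pullback hr hq),
    Real.sqrt_mul (sq_nonneg _), Real.sqrt_sq_eq_abs]

section ChartVolume

variable [MeasurableSpace N]

lemma chartVolume_eq_map_withDensity (q : N) : chartVolume k q =
    ((volume.restrict (extChartAt (𝓡 k) q).target).withDensity fun y ↦
      ENNReal.ofReal (volumeDensity k q y)).map (extChartAt (𝓡 k) q).symm := by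
  rw [chartVolume]
  congr 1
  refine withDensity_congr_ae ?_
  filter_upwards [ae_restrict_mem (isOpen_extChartAt_target q).measurableSet] with y hy
  simp only [volumeDensity, gram, localMetric_apply, coordField,
    trivializationAt_symm (extChartAt_symm_mem_source hy)]

variable [BorelSpace N]

lemma chartVolume_apply (q : N) {A : Set N} (hA : MeasurableSet A) :
    chartVolume k q A = ∫⁻ y in chartPreimage k q A, ENNReal.ofReal (volumeDensity k q y) := by
  rw [chartVolume_eq_map_withDensity, Measure.map_apply_of_aemeasurable
    (aemeasurable_extChartAt_symm q) hA, withDensity_apply', chartPreimage,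
    Measure.restrict_restrict' (isOpen_extChartAt_target q).measurableSet]

lemma chartVolume_compl_source (q : N) : chartVolume k q (chartAt (Model k) q).sourceᶜ = 0 := by
  have hempty : chartPreimage k q (chartAt (Model k) q).sourceᶜ = ∅ :=
    eq_empty_of_forall_notMem fun _ hy ↦ hy.1 (extChartAt_symm_mem_source hy.2)
  rw [chartVolume_apply q (chartAt (Model k) q).open_source.measurableSet.compl, hempty,
    Measure.restrict_empty, lintegral_zero_measure]

lemma chartVolume_eq_of_subset {r q : N} {A : Set N} (hA : MeasurableSet A)
    (hr : A ⊆ (chartAt (Model k) r).source) (hq : A ⊆ (chartAt (Model k) q).source) :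
    chartVolume k r A = chartVolume k q A := by
  have hmeas := measurableSet_chartPreimage (k := k) r hA
  have hderiv : ∀ y ∈ chartPreimage k r A, HasFDerivWithinAt (chartTransition k r q)
      (fderiv ℝ (chartTransition k r q) y) (chartPreimage k r A) y := by
    rintro y ⟨hyA, hy⟩
    have h := contDiffAt_chartTransition (k := k) (hr hyA) (hq hyA)
    rw [(extChartAt (𝓡 k) r).right_inv hy] at h
    exact (h.differentiableAt (by simp)).hasFDerivAt.hasFDerivWithinAt
  rw [chartVolume_apply r hA, chartVolume_apply q hA,
    ← chartTransition_image_chartPreimage hr hq, lintegral_image_eq_lintegral_abs_det_fderiv_mul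
      volume hmeas hderiv (injOn_chartTransition hq)]
  refine setLIntegral_congr_fun hmeas ?_
  rintro y ⟨hyA, hy⟩
  have h := volumeDensity_eq_abs_det_mul (k := k) (hr hyA) (hq hyA)
  rw [(extChartAt (𝓡 k) r).right_inv hy] at h
  simp only [h, ENNReal.ofReal_mul (abs_nonneg _)]

lemma riemannianVolume_restrict_source (p : N) :
    (riemannianVolume k N).restrict (chartAt (Model k) p).source = chartVolume k p := by
  have hU (q : N) : MeasurableSet (chartAt (Model k) q).source :=
    (chartAt (Model k) q).open_source.measurableSet
  refine restrict_iSup_eq_of_restrict_inter_eq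
    (U := fun q : N ↦ (chartAt (Model k) q).source) hU chartVolume_compl_source (fun r q ↦ ?_) p
  ext A hA
  rw [Measure.restrict_apply hA, Measure.restrict_apply hA]
  exact chartVolume_eq_of_subset (hA.inter ((hU r).inter (hU q)))
    (inter_subset_right.trans inter_subset_left) (inter_subset_right.trans inter_subset_right)

end ChartVolume

variable [IsContMDiffRiemannianBundle (𝓡 k) ∞ (Model k) (fun q : N ↦ TangentSpace (𝓡 k) q)]

lemma volumeDensity_pos {q : N} {y : Model k} (hy : y ∈ (extChartAt (𝓡 k) q).target) :
    0 < volumeDensity k q y :=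
  Real.sqrt_pos.2 ((isMetricOn_localMetric q).det_gram_pos hy)

lemma contDiffAt_volumeDensity {q : N} {y : Model k} (hy : y ∈ (extChartAt (𝓡 k) q).target) :
    ContDiffAt ℝ ∞ (volumeDensity k q) y :=
  (isMetricOn_localMetric q).contDiffAt_sqrt_det_gram hy

lemma continuousOn_volumeDensity (q : N) :
    ContinuousOn (volumeDensity k q) (extChartAt (𝓡 k) q).target :=
  fun _ hy ↦ (contDiffAt_volumeDensity hy).continuousAt.continuousWithinAt

variable [MeasurableSpace N] [BorelSpace N]

lemma integral_riemannianVolume_of_support_subset (p : N) {f : N → ℝ} (hf : Continuous f)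
    (hsupp : Function.support f ⊆ (chartAt (Model k) p).source) :
    ∫ x, f x ∂(riemannianVolume k N) =
      ∫ y in (extChartAt (𝓡 k) p).target,
        volumeDensity k p y * f ((extChartAt (𝓡 k) p).symm y) := by
  have htarget := (isOpen_extChartAt_target (I := 𝓡 k) p).measurableSet
  rw [← setIntegral_eq_integral_of_forall_compl_eq_zero fun x hx ↦
      Function.notMem_support.1 fun h ↦ hx (hsupp h), riemannianVolume_restrict_source,
    chartVolume_eq_map_withDensity, integral_map (aemeasurable_extChartAt_symm p)
      hf.aestronglyMeasurable, integral_withDensity_eq_integral_toReal_smul₀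
      ((continuousOn_volumeDensity p).aemeasurable htarget).ennreal_ofReal (by simp)]
  refine setIntegral_congr_fun htarget fun y hy ↦ ?_
  simp only [ENNReal.toReal_ofReal (volumeDensity_pos hy).le, smul_eq_mul]

lemma finiteAtFilter_riemannianVolume (x : N) :
    (riemannianVolume k N).FiniteAtFilter (nhds x) := by
  have hx := mem_chart_source (Model k) x
  obtain ⟨K, hK, hxK, hKtarget⟩ := exists_compact_subset
    (isOpen_extChartAt_target (I := 𝓡 k) x) (extChartAt_mem_target hx)
  set U : Set N := (chartAt (Model k) x).source ∩ extChartAt (𝓡 k) x ⁻¹' interior K with hU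
  have hUopen : IsOpen U := by
    simpa [hU] using (continuousOn_extChartAt (I := 𝓡 k) x).isOpen_inter_preimage
      (isOpen_extChartAt_source x) isOpen_interior
  have hUK : chartPreimage k x U ⊆ K := by
    rintro y ⟨⟨-, hyK⟩, hy⟩
    rw [mem_preimage, (extChartAt (𝓡 k) x).right_inv hy] at hyK
    exact interior_subset hyK
  refine ⟨U, hUopen.mem_nhds ⟨hx, hxK⟩, ?_⟩
  calc riemannianVolume k N U = chartVolume k x U := by
        rw [← riemannianVolume_restrict_source x, Measure.restrict_apply hUopen.measurableSet,
          inter_eq_left.2 inter_subset_left]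
    _ = ∫⁻ y in chartPreimage k x U, ENNReal.ofReal (volumeDensity k x y) :=
        chartVolume_apply x hUopen.measurableSet
    _ ≤ ∫⁻ y in K, ENNReal.ofReal (volumeDensity k x y) := lintegral_mono_set hUK
    _ < ⊤ := (((continuousOn_volumeDensity x).mono hKtarget).integrableOn_compact
        hK).lintegral_lt_top

instance isFiniteMeasure_riemannianVolume [CompactSpace N] :
    IsFiniteMeasure (riemannianVolume k N) :=
  haveI : IsLocallyFiniteMeasure (riemannianVolume k N) := ⟨finiteAtFilter_riemannianVolume⟩
  inferInstance

end Volume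

lemma integral_fderiv_eq_zero_of_hasCompactSupport {E : Type*} [NormedAddCommGroup E]
    [NormedSpace ℝ E] [FiniteDimensional ℝ E] [MeasurableSpace E] [BorelSpace E] {μ : Measure E}
    [μ.IsAddHaarMeasure] {w : E → ℝ} (hw : ContDiff ℝ 1 w) (hc : HasCompactSupport w) (v : E) :
    ∫ y, fderiv ℝ w y v ∂μ = 0 := by
  have hcont : Continuous fun y ↦ fderiv ℝ w y v :=
    (hw.continuous_fderiv (by simp)).clm_apply continuous_const
  have h := integral_mul_fderiv_eq_neg_fderiv_mul_of_integrable (μ := μ) (f := w)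
    (g := fun _ ↦ (1 : ℝ)) (v := v)
    (by simpa using hcont.integrable_of_hasCompactSupport (hc.fderiv_apply (𝕜 := ℝ) v)) (by simp)
    (by simpa using hw.continuous.integrable_of_hasCompactSupport hc)
    (fun x _ ↦ (hw.differentiable (by simp)) x) (fun x _ ↦ differentiableAt_const _)
  simpa using h.symm

lemma setIntegral_fderiv_eq_zero {E : Type*} [NormedAddCommGroup E] [NormedSpace ℝ E]
    [FiniteDimensional ℝ E] [MeasurableSpace E] [BorelSpace E] {μ : Measure E}
    [μ.IsAddHaarMeasure] {D K : Set E} (hD : IsOpen D) (hK : IsCompact K) (hKD : K ⊆ D) {w : E → ℝ}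
    (hw : ∀ y ∈ D, ContDiffAt ℝ 1 w y) (hwK : ∀ y ∈ D, y ∉ K → w y = 0) (v : E) :
    IntegrableOn (fun y ↦ fderiv ℝ w y v) D μ ∧ ∫ y in D, fderiv ℝ w y v ∂μ = 0 := by
  set w' : E → ℝ := D.indicator w
  have hon : ∀ y ∈ D, w' =ᶠ[nhds y] w := fun y hy ↦ by
    filter_upwards [hD.mem_nhds hy] with y' hy' using indicator_of_mem hy' _
  have hzero : ∀ y ∉ K, w' y = 0 := fun y hy ↦ by
    by_cases hyD : y ∈ D
    · rw [(hon y hyD).self_of_nhds, hwK y hyD hy]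
    · exact indicator_of_notMem hyD _
  have hoff : ∀ y ∉ D, w' =ᶠ[nhds y] fun _ ↦ 0 := fun y hy ↦ by
    filter_upwards [hK.isClosed.isOpen_compl.mem_nhds fun h ↦ hy (hKD h)] with y' hy'
      using hzero y' hy'
  have hsmooth : ContDiff ℝ 1 w' := contDiff_iff_contDiffAt.2 fun y ↦ by
    by_cases hy : y ∈ D
    · exact (hw y hy).congr_of_eventuallyEq (hon y hy)
    · exact contDiffAt_const.congr_of_eventuallyEq (hoff y hy)
  have hcompact : HasCompactSupport w' := HasCompactSupport.intro hK hzero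
  have hfderiv_on : EqOn (fun y ↦ fderiv ℝ w' y v) (fun y ↦ fderiv ℝ w y v) D := fun y hy ↦ by
    simp only [(hon y hy).fderiv_eq]
  have hfderiv_off : ∀ y ∉ D, fderiv ℝ w' y v = 0 := fun y hy ↦ by
    simp [(hoff y hy).fderiv_eq]
  have hcont : Continuous fun y ↦ fderiv ℝ w' y v :=
    (hsmooth.continuous_fderiv (by simp)).clm_apply continuous_const
  refine ⟨(hcont.integrable_of_hasCompactSupport
    (hcompact.fderiv_apply (𝕜 := ℝ) v)).integrableOn.congr_fun hfderiv_on hD.measurableSet, ?_⟩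
  rw [← setIntegral_congr_fun hD.measurableSet hfderiv_on,
    setIntegral_eq_integral_of_forall_compl_eq_zero hfderiv_off,
    integral_fderiv_eq_zero_of_hasCompactSupport hsmooth hcompact]

section Divergence

variable {m : ℕ} {M : Type*} [TopologicalSpace M] [ChartedSpace (Model m) M]
  [IsManifold (𝓡 m) ∞ M] {α : ∀ x : M, TangentSpace (𝓡 m) x →ₗ[ℝ] ℝ} {ρ : M → ℝ} {p x : M}

variable (m) in
/-- A one-form in the preferred chart at `p`. -/
def oneFormInChart (p : M) (α : ∀ x : M, TangentSpace (𝓡 m) x →ₗ[ℝ] ℝ) (y : Model m) :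
    Model m →L[ℝ] ℝ :=
  LinearMap.toContinuousLinearMap ((α ((extChartAt (𝓡 m) p).symm y)).comp
    (ofChartCoord m p ((extChartAt (𝓡 m) p).symm y)).toLinearMap)

lemma oneFormInChart_apply (y u : Model m) : oneFormInChart m p α y u =
    α ((extChartAt (𝓡 m) p).symm y) (ofChartCoord m p ((extChartAt (𝓡 m) p).symm y) u) := rfl

lemma oneFormInChart_extChartAt (hx : x ∈ (chartAt (Model m) p).source)
    (X : TangentSpace (𝓡 m) x) :
    oneFormInChart m p α (extChartAt (𝓡 m) p x) (chartCoord m p x X) = α x X := by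
  rw [oneFormInChart_apply, extChartAt_symm_extChartAt hx, ofChartCoord_chartCoord hx]

lemma contDiffAt_comp_extChartAt_symm (hρ : ContMDiff (𝓡 m) 𝓘(ℝ, ℝ) ∞ ρ) {y : Model m}
    (hy : y ∈ (extChartAt (𝓡 m) p).target) :
    ContDiffAt ℝ ∞ (fun y ↦ ρ ((extChartAt (𝓡 m) p).symm y)) y :=
  (hρ.contMDiffAt.comp y (contMDiffAt_extChartAt_symm hy)).contDiffAt

/-- A family of covectors whose coefficients in every preferred chart are smooth. -/
def IsSmoothOneForm (α : ∀ x : M, TangentSpace (𝓡 m) x →ₗ[ℝ] ℝ) : Prop :=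
  ∀ p : M, ∀ y ∈ (extChartAt (𝓡 m) p).target, ContDiffAt ℝ ∞ (oneFormInChart m p α) y

lemma IsSmoothOneForm.smul (hα : IsSmoothOneForm α) (hρ : ContMDiff (𝓡 m) 𝓘(ℝ, ℝ) ∞ ρ) :
    IsSmoothOneForm (fun x ↦ ρ x • α x) :=
  fun p y hy ↦ (contDiffAt_comp_extChartAt_symm hρ hy).smul (hα p y hy)

lemma exists_smoothPartitionOfUnity_subordinate_charts [T2Space M] [CompactSpace M] :
    ∃ (t : Finset M) (ρ : SmoothPartitionOfUnity t (𝓡 m) M univ),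
      ρ.IsSubordinate fun p ↦ (chartAt (Model m) (p : M)).source := by
  obtain ⟨t, -, ht⟩ := isCompact_univ.elim_nhds_subcover
    (fun p : M ↦ (chartAt (Model m) p).source) fun p _ ↦ source_mem_nhds (mem_chart_source _ p)
  refine ⟨t, SmoothPartitionOfUnity.exists_isSubordinate (𝓡 m) isClosed_univ _
    (fun p ↦ (chartAt (Model m) (p : M)).open_source) fun x hx ↦ ?_⟩
  obtain ⟨p, hp, hx⟩ := mem_iUnion₂.1 (ht hx)
  exact mem_iUnion.2 ⟨⟨p, hp⟩, hx⟩

variable [RiemannianBundle (fun x : M ↦ TangentSpace (𝓡 m) x)]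

variable (m) in
/-- The divergence `∑ (∇_{e_i} α)(e_i)` of a one-form, computed in the preferred chart at `p`. -/
def divergenceInChart (p : M) (α : ∀ x : M, TangentSpace (𝓡 m) x →ₗ[ℝ] ℝ) (x : M) : ℝ :=
  coordDiv (onbInChart m p x) (christoffelTrace m p x) (oneFormInChart m p α)
    (extChartAt (𝓡 m) p x)

lemma divergenceInChart_smul (hα : IsSmoothOneForm α) (hρ : ContMDiff (𝓡 m) 𝓘(ℝ, ℝ) ∞ ρ)
    (hx : x ∈ (chartAt (Model m) p).source) :
    divergenceInChart m p (fun x ↦ ρ x • α x) x = ρ x * divergenceInChart m p α x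
      + ∑ i, α x (onb m x i) * mvfderiv (𝓡 m) ρ x (onb m x i) := by
  have hy := extChartAt_mem_target hx
  have hρd := (contDiffAt_comp_extChartAt_symm hρ hy).differentiableAt (by simp)
  have hαd (u : Model m) := ((hα p _ hy).differentiableAt (by simp)).clm_apply
    (differentiableAt_const u)
  have hsmul (y u : Model m) : oneFormInChart m p (fun x ↦ ρ x • α x) y u =
      ρ ((extChartAt (𝓡 m) p).symm y) * oneFormInChart m p α y u := rfl
  simp only [divergenceInChart, coordDiv, hsmul, fderiv_fun_mul hρd (hαd _),
    mvfderiv_eq_fderiv hx hρd, add_apply, smul_apply, smul_eq_mul, Finset.sum_add_distrib,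
    onbInChart, oneFormInChart_extChartAt hx, extChartAt_symm_extChartAt hx]
  rw [mul_sub, Finset.mul_sum]
  ring

/-- `D` is the divergence of `α` in every preferred chart. -/
def HasDivergence (α : ∀ x : M, TangentSpace (𝓡 m) x →ₗ[ℝ] ℝ) (D : M → ℝ) : Prop :=
  ∀ p x : M, x ∈ (chartAt (Model m) p).source → divergenceInChart m p α x = D x

lemma HasDivergence.smul {D : M → ℝ} (hα : IsSmoothOneForm α) (hD : HasDivergence α D)
    (hρ : ContMDiff (𝓡 m) 𝓘(ℝ, ℝ) ∞ ρ) :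
    HasDivergence (fun x ↦ ρ x • α x)
      (fun x ↦ ρ x * D x + ∑ i, α x (onb m x i) * mvfderiv (𝓡 m) ρ x (onb m x i)) :=
  fun p x hx ↦ by rw [divergenceInChart_smul hα hρ hx, hD p x hx]

variable [IsContMDiffRiemannianBundle (𝓡 m) ∞ (Model m) (fun x : M ↦ TangentSpace (𝓡 m) x)]

variable (m) in
/-- The components `√(det g_ij) α^b` of the vector density of a one-form in the preferred chart
at `p`. -/
def fluxInChart (p : M) (α : ∀ x : M, TangentSpace (𝓡 m) x →ₗ[ℝ] ℝ) (b : Fin m) (y : Model m) : ℝ :=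
  volumeDensity m p y * (localMetric m p y).inverse (oneFormInChart m p α y) b

lemma contDiffAt_fluxInChart (hα : IsSmoothOneForm α) {y : Model m}
    (hy : y ∈ (extChartAt (𝓡 m) p).target) (b : Fin m) :
    ContDiffAt ℝ ∞ (fluxInChart m p α b) y :=
  (contDiffAt_volumeDensity hy).mul ((EuclideanSpace.proj (𝕜 := ℝ) b).contDiff.contDiffAt.comp y
    (((isMetricOn_localMetric p).contDiffAt_inverse hy).clm_apply (hα p y hy)))

lemma sum_fderiv_fluxInChart (hα : IsSmoothOneForm α) (hx : x ∈ (chartAt (Model m) p).source) :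
    ∑ b, fderiv ℝ (fluxInChart m p α b) (extChartAt (𝓡 m) p x) (coordVec b) =
      volumeDensity m p (extChartAt (𝓡 m) p x) * divergenceInChart m p α x :=
  have hy := extChartAt_mem_target hx
  (isMetricOn_localMetric p).sum_fderiv_sqrt_det_gram_mul_inverse hy (isParsevalFrame_onbInChart hx)
    ((hα p _ hy).differentiableAt (by simp))

lemma continuousAt_divergenceInChart (hα : IsSmoothOneForm α)
    (hx : x ∈ (chartAt (Model m) p).source) : ContinuousAt (divergenceInChart m p α) x := by
  have hy := extChartAt_mem_target hx
  have hchart := (contMDiffAt_extChartAt_of_mem (k := m) hx).continuousAt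
  have hflux : ContinuousAt (fun y ↦ ∑ b, fderiv ℝ (fluxInChart m p α b) y (coordVec b))
      (extChartAt (𝓡 m) p x) :=
    tendsto_finsetSum _ fun b _ ↦ ((contDiffAt_fderiv
      (contDiffAt_fluxInChart hα hy b)).continuousAt.clm_apply continuousAt_const)
  have hquot := ContinuousAt.comp (f := extChartAt (𝓡 m) p)
    (hflux.div (contDiffAt_volumeDensity hy).continuousAt (volumeDensity_pos hy).ne') hchart
  refine hquot.congr ?_
  filter_upwards [source_mem_nhds hx] with x' hx'
  simp only [Function.comp_apply, Pi.div_apply, sum_fderiv_fluxInChart hα hx']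
  exact mul_div_cancel_left₀ _ (volumeDensity_pos (extChartAt_mem_target hx')).ne'

lemma HasDivergence.continuous {D : M → ℝ} (hα : IsSmoothOneForm α) (hD : HasDivergence α D) :
    Continuous D := continuous_iff_continuousAt.2 fun x ↦ by
  have hx := mem_chart_source (Model m) x
  refine (continuousAt_divergenceInChart hα hx).congr ?_
  filter_upwards [source_mem_nhds hx] with x' hx' using hD x x' hx'

variable [CompactSpace M] [MeasurableSpace M] [BorelSpace M]

lemma HasDivergence.integral_eq_zero_of_subset_source {D : M → ℝ} (hα : IsSmoothOneForm α)
    (hD : HasDivergence α D) {K : Set M} (hK : IsClosed K) (hKp : K ⊆ (chartAt (Model m) p).source)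
    (hαK : ∀ x ∉ K, α x = 0) (hDK : ∀ x ∉ K, D x = 0) :
    ∫ x, D x ∂(riemannianVolume m M) = 0 := by
  have htarget := isOpen_extChartAt_target (I := 𝓡 m) p
  have hflux (b : Fin m) := setIntegral_fderiv_eq_zero (μ := volume) (v := coordVec b) htarget
    (K := extChartAt (𝓡 m) p '' K) (w := fluxInChart m p α b)
    (hK.isCompact.image_of_continuousOn ((continuousOn_extChartAt p).mono (by simpa using hKp)))
    (image_subset_iff.2 fun x hx ↦ extChartAt_mem_target (hKp hx))
    (fun y hy ↦ (contDiffAt_fluxInChart hα hy b).of_le (by simp)) fun y hy hyK ↦ by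
      have hx : (extChartAt (𝓡 m) p).symm y ∉ K := fun h ↦
        hyK ⟨_, h, (extChartAt (𝓡 m) p).right_inv hy⟩
      have hzero : oneFormInChart m p α y = 0 := by
        ext u
        rw [oneFormInChart_apply, hαK _ hx]
        rfl
      simp [fluxInChart, hzero]
  calc ∫ x, D x ∂(riemannianVolume m M)
      = ∫ y in (extChartAt (𝓡 m) p).target,
          volumeDensity m p y * D ((extChartAt (𝓡 m) p).symm y) :=
        integral_riemannianVolume_of_support_subset p (hD.continuous hα) fun x hx ↦
          hKp (by_contra fun h ↦ hx (hDK x h))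
    _ = ∫ y in (extChartAt (𝓡 m) p).target,
          ∑ b, fderiv ℝ (fluxInChart m p α b) y (coordVec b) := by
        refine setIntegral_congr_fun htarget.measurableSet fun y hy ↦ ?_
        have hx := extChartAt_symm_mem_source hy
        have h := sum_fderiv_fluxInChart hα hx
        rw [(extChartAt (𝓡 m) p).right_inv hy, hD p _ hx] at h
        exact h.symm
    _ = 0 := by
        rw [integral_finsetSum _ fun b _ ↦ (hflux b).1]
        exact Finset.sum_eq_zero fun b _ ↦ (hflux b).2

theorem HasDivergence.integral_eq_zero [T2Space M] {D : M → ℝ} (hα : IsSmoothOneForm α)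
    (hD : HasDivergence α D) : ∫ x, D x ∂(riemannianVolume m M) = 0 := by
  obtain ⟨t, ρ, hρ⟩ := exists_smoothPartitionOfUnity_subordinate_charts (m := m) (M := M)
  have hsum (x : M) : ∑ p : t, ρ p x = 1 := by
    rw [← finsum_eq_sum_of_fintype]
    exact ρ.sum_eq_one (mem_univ x)
  set D' : t → M → ℝ := fun p x ↦
    ρ p x * D x + ∑ i, α x (onb m x i) * mvfderiv (𝓡 m) (ρ p) x (onb m x i)
  have hD' (p : t) : HasDivergence (fun x ↦ ρ p x • α x) (D' p) := hD.smul hα (ρ p).contMDiff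
  have hα' (p : t) : IsSmoothOneForm (fun x ↦ ρ p x • α x) := hα.smul (ρ p).contMDiff
  have hintegral (p : t) : ∫ x, D' p x ∂(riemannianVolume m M) = 0 := by
    refine (hD' p).integral_eq_zero_of_subset_source (hα' p) (isClosed_tsupport (ρ p)) (hρ p)
      (fun x hx ↦ by rw [image_eq_zero_of_notMem_tsupport hx, zero_smul]) fun x hx ↦ ?_
    have hzero : ρ p =ᶠ[nhds x] fun _ ↦ 0 := notMem_tsupport_iff_eventuallyEq.1 hx
    have hderiv (X : TangentSpace (𝓡 m) x) : mvfderiv (𝓡 m) (ρ p) x X = 0 := by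
      rw [mvfderiv, hzero.mfderiv_eq, mfderiv_const]
      rfl
    simp [D', hzero.self_of_nhds, hderiv]
  have hderiv_sum (x : M) (X : TangentSpace (𝓡 m) x) : ∑ p : t, mvfderiv (𝓡 m) (ρ p) x X = 0 := by
    have hx := mem_chart_source (Model m) x
    have hd (p : t) := (contDiffAt_comp_extChartAt_symm (ρ p).contMDiff
      (extChartAt_mem_target hx)).differentiableAt (by simp)
    simp only [mvfderiv_eq_fderiv hx (hd _)]
    rw [← sum_apply, ← fderiv_fun_sum fun p _ ↦ hd p]
    simp only [hsum, fderiv_fun_const, Pi.zero_apply, zero_apply]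
  have hDsum : D = fun x ↦ ∑ p : t, D' p x := by
    funext x
    rw [Finset.sum_add_distrib, ← Finset.sum_mul, hsum, one_mul, Finset.sum_comm]
    simp only [← Finset.mul_sum, hderiv_sum, mul_zero, Finset.sum_const_zero, add_zero]
  rw [hDsum, integral_finsetSum _ fun p _ ↦
    ((hD' p).continuous (hα' p)).integrable_of_hasCompactSupport
      (HasCompactSupport.of_compactSpace _)]
  exact Finset.sum_eq_zero fun p _ ↦ hintegral p

end Divergence

section InducedConnection

variable {m n : ℕ} {M : Type*} [TopologicalSpace M] [ChartedSpace (Model m) M]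
  {N : Type*} [TopologicalSpace N] [ChartedSpace (Model n) N] [IsManifold (𝓡 n) ∞ N]
  [RiemannianBundle (fun q : N ↦ TangentSpace (𝓡 n) q)]
  [IsContMDiffRiemannianBundle (𝓡 n) ∞ (Model n) (fun q : N ↦ TangentSpace (𝓡 n) q)]

lemma covAlong_eq_ofChartCoord (φ : M → N) (W : ∀ x, TangentSpace (𝓡 n) (φ x)) (x : M)
    (X : TangentSpace (𝓡 m) x) :
    covAlong m n φ W x X = ofChartCoord n (φ x) (φ x)
      (mvfderiv (𝓡 m) (fun x' ↦ (trivializationAt (Model n) (fun q : N ↦ TangentSpace (𝓡 n) q)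
          (φ x) ⟨φ x', W x'⟩).2) x X
        + localChristoffel n (φ x) (extChartAt (𝓡 n) (φ x) (φ x))
          (chartCoord n (φ x) (φ x) (mfderiv (𝓡 m) (𝓡 n) φ x X))
          (chartCoord n (φ x) (φ x) (W x))) := by
  have hq := mem_chart_source (Model n) (φ x)
  rw [covAlong, trivializationAt_symm hq, map_add, ← chartCoord_christoffel,
    ofChartCoord_chartCoord hq]

variable (m n) in
/-- The induced connection `X ↦ ∇̄_X W` at `x` as a linear map. -/
def covAlongLinearMap (φ : M → N) (W : ∀ x, TangentSpace (𝓡 n) (φ x)) (x : M) :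
    TangentSpace (𝓡 m) x →ₗ[ℝ] TangentSpace (𝓡 n) (φ x) where
  toFun := covAlong m n φ W x
  map_add' X Y := by
    simp only [covAlong_eq_ofChartCoord, map_add, add_apply]
    abel
  map_smul' c X := by
    simp only [covAlong_eq_ofChartCoord, map_smul, smul_apply, map_add, smul_add, RingHom.id_apply]

lemma covAlong_neg (φ : M → N) (W : ∀ x, TangentSpace (𝓡 n) (φ x)) (x : M)
    (X : TangentSpace (𝓡 m) x) :
    covAlong m n φ (fun x ↦ -W x) x X = -covAlong m n φ W x X := by
  have hneg : (fun x' ↦ (trivializationAt (Model n) (fun q : N ↦ TangentSpace (𝓡 n) q)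
      (φ x) ⟨φ x', -W x'⟩).2) = fun x' ↦ -(trivializationAt (Model n)
        (fun q : N ↦ TangentSpace (𝓡 n) q) (φ x) ⟨φ x', W x'⟩).2 :=
    funext fun x' ↦ by
      simp only [TangentBundle.trivializationAt_apply]
      exact map_neg (fderivWithin ℝ _ _ _ : Model n →L[ℝ] Model n) _
  simp only [covAlong_eq_ofChartCoord, hneg, mvfderiv_fun_neg, map_neg, neg_apply, map_add, neg_add]

lemma covAlong_zero (φ : M → N) (x : M) (X : TangentSpace (𝓡 m) x) :
    covAlong m n φ (fun x ↦ (0 : TangentSpace (𝓡 n) (φ x))) x X = 0 := by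
  have hzero : (fun x' ↦ (trivializationAt (Model n) (fun q : N ↦ TangentSpace (𝓡 n) q)
      (φ x) ⟨φ x', (0 : TangentSpace (𝓡 n) (φ x'))⟩).2) = fun _ ↦ 0 :=
    funext fun x' ↦ by
      simp only [TangentBundle.trivializationAt_apply]
      exact map_zero (fderivWithin ℝ _ _ _ : Model n →L[ℝ] Model n)
  simp only [covAlong_eq_ofChartCoord, hzero, mvfderiv_const, map_zero, zero_apply, add_zero]

end InducedConnection

section Energy

variable {m n : ℕ} {M : Type*} [TopologicalSpace M] [ChartedSpace (Model m) M]
  [IsManifold (𝓡 m) ∞ M] [RiemannianBundle (fun x : M ↦ TangentSpace (𝓡 m) x)]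
  {N : Type*} [TopologicalSpace N] [ChartedSpace (Model n) N] [IsManifold (𝓡 n) ∞ N]
  [RiemannianBundle (fun q : N ↦ TangentSpace (𝓡 n) q)]
  {φ : M → N} {W : ∀ x, TangentSpace (𝓡 n) (φ x)} {x : M}

variable (m n) in
/-- A section of `φ⁻¹TN` as a form of mixed degree. -/
def sectionForm (φ : M → N) (W : ∀ x, TangentSpace (𝓡 n) (φ x)) : ∀ p, FormAlong m n φ p
  | 0 => fun x _ ↦ W x
  | _ + 1 => fun _ _ ↦ 0

lemma covForm_differentialForm_one (X : TangentSpace (𝓡 m) x) (Y : Fin 1 → TangentSpace (𝓡 m) x) :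
    covForm m n φ (differentialForm m n φ 1) x X Y = secondFundamentalForm m n φ x X (Y 0) := by
  simp [covForm, secondFundamentalForm, differentialForm]

lemma codiff_differentialForm_one :
    codiff m n φ (differentialForm m n φ 1) = fun x _ ↦ -tension m n φ x := by
  funext x Y
  simp only [codiff, covForm_differentialForm_one, tension, Fin.cons_zero]

lemma extD_sectionForm_zero :
    extD m n φ (sectionForm m n φ W 0) = fun x Y ↦ covAlong m n φ W x (Y 0) := by
  funext x Y
  simp [extD, covForm, sectionForm]

variable [IsContMDiffRiemannianBundle (𝓡 n) ∞ (Model n) (fun q : N ↦ TangentSpace (𝓡 n) q)]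

lemma covForm_zero {p : ℕ} (X : TangentSpace (𝓡 m) x) (Y : Fin p → TangentSpace (𝓡 m) x) :
    covForm m n φ (fun x _ ↦ (0 : TangentSpace (𝓡 n) (φ x))) x X Y = 0 := by
  rw [covForm, covAlong_zero, Finset.sum_const_zero, sub_zero]

lemma extD_zero (φ : M → N) (p : ℕ) :
    extD m n φ (p := p) (fun x _ ↦ (0 : TangentSpace (𝓡 n) (φ x))) = fun _ _ ↦ 0 := by
  funext x Y
  simp only [extD, covForm_zero, smul_zero, Finset.sum_const_zero]

lemma codiff_zero (φ : M → N) (p : ℕ) :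
    codiff m n φ (p := p) (fun x _ ↦ (0 : TangentSpace (𝓡 n) (φ x))) = fun _ _ ↦ 0 := by
  funext x Y
  simp only [codiff, covForm_zero, Finset.sum_const_zero, neg_zero]

lemma dPlusDelta_sectionForm_one :
    dPlusDelta m n φ (sectionForm m n φ W) 1 = fun x Y ↦ covAlong m n φ W x (Y 0) := by
  funext x Y
  change extD m n φ (sectionForm m n φ W 0) x Y + codiff m n φ (fun _ _ ↦ 0) x Y = _
  rw [codiff_zero, add_zero, extD_sectionForm_zero]

lemma dPlusDelta_sectionForm_of_ne_one : ∀ {p : ℕ}, p ≠ 1 →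
    dPlusDelta m n φ (sectionForm m n φ W) p = fun _ _ ↦ 0
  | 0, _ => codiff_zero φ 0
  | 1, hp => absurd rfl hp
  | p + 2, _ => by
    funext x Y
    change extD m n φ (fun _ _ ↦ 0) x Y + codiff m n φ (fun _ _ ↦ 0) x Y = 0
    rw [extD_zero, codiff_zero, add_zero]

lemma formNormSq_dPlusDelta_sectionForm (W : ∀ x, TangentSpace (𝓡 n) (φ x)) (x : M) :
    formNormSq m n φ (dPlusDelta m n φ (sectionForm m n φ W)) x = covNormSq m n φ W x := by
  rw [formNormSq, covNormSq]
  rcases Nat.eq_zero_or_pos m with rfl | hm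
  · -- The sum over the degrees `p ≤ m` has no term `p = 1`, but there are no frame vectors either.
    have : IsEmpty (Fin (Module.finrank ℝ (TangentSpace (𝓡 0) x))) := by
      rw [show Module.finrank ℝ (TangentSpace (𝓡 0) x) = 0 from
        (finrank_euclideanSpace_fin : Module.finrank ℝ (Model 0) = 0)]
      infer_instance
    rw [Finset.univ_eq_empty (α := Fin (Module.finrank ℝ (TangentSpace (𝓡 0) x)))]
    simp [dPlusDelta_sectionForm_of_ne_one zero_ne_one]
  · rw [Finset.sum_eq_single_of_mem 1 (Finset.mem_range.2 (by omega))
      (fun p _ hp ↦ by simp [dPlusDelta_sectionForm_of_ne_one hp]), dPlusDelta_sectionForm_one]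
    simp only [Nat.factorial_one, Nat.cast_one, div_one, one_mul]
    exact Fintype.sum_equiv (Equiv.funUnique (Fin 1) _) _ _ fun i ↦ rfl

variable [IsContMDiffRiemannianBundle (𝓡 m) ∞ (Model m) (fun x : M ↦ TangentSpace (𝓡 m) x)]

lemma secondFundamentalForm_symm (hφ : ContMDiff (𝓡 m) (𝓡 n) ∞ φ) (x : M)
    (X Y : TangentSpace (𝓡 m) x) :
    secondFundamentalForm m n φ x X Y = secondFundamentalForm m n φ x Y X := by
  have hp := mem_chart_source (Model m) x
  have hq := mem_chart_source (Model n) (φ x)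
  have hq' : φ ((extChartAt (𝓡 m) x).symm (extChartAt (𝓡 m) x x)) ∈
      (chartAt (Model n) (φ x)).source := by rwa [extChartAt_symm_extChartAt hp]
  refine chartCoord_injective hq ?_
  rw [chartCoord_secondFundamentalForm hφ hp hq, chartCoord_secondFundamentalForm hφ hp hq,
    covDeriv_fderiv_comm (Γ := localChristoffel n (φ x)) (f := mapInCharts m n x (φ x) φ)
      ((isMetricOn_localMetric _).leviCivita_symm (extChartAt_mem_target hq'))
      ((contDiffAt_mapInCharts (extChartAt_mem_target hp) hq' hφ).of_le ENat.LEInfty.out)]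
  congr 2
  exact (isMetricOn_localMetric _).leviCivita_symm (extChartAt_mem_target hp) _ _

lemma extD_differentialForm_one (hφ : ContMDiff (𝓡 m) (𝓡 n) ∞ φ) :
    extD m n φ (differentialForm m n φ 1) = fun _ _ ↦ 0 := by
  funext x Y
  have hsum : extD m n φ (differentialForm m n φ 1) x Y = _ :=
    Fin.sum_univ_two fun i : Fin 2 ↦ (-1 : ℝ) ^ (i : ℕ) •
      covForm m n φ (differentialForm m n φ 1) x (Y i) (i.removeNth Y)
  rw [hsum, covForm_differentialForm_one, covForm_differentialForm_one,
    secondFundamentalForm_symm hφ x (Y 1)]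
  simp [Fin.removeNth]

lemma dPlusDelta_differentialForm (hφ : ContMDiff (𝓡 m) (𝓡 n) ∞ φ) :
    dPlusDelta m n φ (differentialForm m n φ) = sectionForm m n φ fun x ↦ -tension m n φ x := by
  funext p
  match p with
  | 0 => exact codiff_differentialForm_one
  | 1 | p + 3 =>
    funext x Y
    change extD m n φ (fun _ _ ↦ 0) x Y + codiff m n φ (fun _ _ ↦ 0) x Y = 0
    rw [extD_zero, codiff_zero, add_zero]
  | 2 =>
    funext x Y
    change extD m n φ (differentialForm m n φ 1) x Y + codiff m n φ (fun _ _ ↦ 0) x Y = 0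
    rw [extD_differentialForm_one hφ, codiff_zero, add_zero]

theorem trienergyDensity_eq_covNormSq_tension (hφ : ContMDiff (𝓡 m) (𝓡 n) ∞ φ) :
    trienergyDensity m n φ = covNormSq m n φ (tension m n φ) := by
  funext x
  simp only [trienergyDensity, dPlusDelta_differentialForm hφ, formNormSq_dPlusDelta_sectionForm,
    covNormSq, covAlong_neg, norm_neg]

theorem trienergy_eq_integral_covNormSq_tension [MeasurableSpace M]
    (hφ : ContMDiff (𝓡 m) (𝓡 n) ∞ φ) :
    trienergy m n φ = (1 / 2) * ∫ x, covNormSq m n φ (tension m n φ) x ∂(riemannianVolume m M) := by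
  rw [trienergy, trienergyDensity_eq_covNormSq_tension hφ]

end Energy

section ParametricIntegral

variable {E : Type*} [NormedAddCommGroup E] [NormedSpace ℝ E] {H : Type*} [TopologicalSpace H]
  {I : ModelWithCorners ℝ E H} {M : Type*} [TopologicalSpace M] [ChartedSpace H M]
  {ψ : ℝ → M → ℝ} {S : Set ℝ} {t : ℝ}

lemma continuousOn_deriv_of_contMDiffOn [IsManifold I 1 M] (hS : IsOpen S)
    (hψ : ContMDiffOn (𝓘(ℝ, ℝ).prod I) 𝓘(ℝ, ℝ) 1 (fun z : ℝ × M ↦ ψ z.1 z.2) (S ×ˢ univ)) :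
    ContinuousOn (fun z : ℝ × M ↦ deriv (fun t ↦ ψ t z.2) z.1) (S ×ˢ univ) := fun z hz ↦ by
  have hψz := hψ.contMDiffAt ((hS.prod isOpen_univ).mem_nhds hz)
  have hswap : ContMDiffAt ((𝓘(ℝ, ℝ).prod I).prod 𝓘(ℝ, ℝ)) 𝓘(ℝ, ℝ) 1
      (Function.uncurry fun (z : ℝ × M) t ↦ ψ t z.2) (z, z.1) :=
    ContMDiffAt.comp (g := fun z : ℝ × M ↦ ψ z.1 z.2) (z, z.1) hψz
      (contMDiffAt_snd.prodMk (contMDiffAt_snd.comp _ contMDiffAt_fst))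
  have hderiv : ContMDiffAt (𝓘(ℝ, ℝ).prod I) 𝓘(ℝ, ℝ →L[ℝ] ℝ) 0
      (fun z : ℝ × M ↦ fderiv ℝ (fun t ↦ ψ t z.2) z.1) z := by
    have hmfderiv := hswap.mfderiv (m := 0) (fun (z : ℝ × M) t ↦ ψ t z.2) Prod.fst contMDiffAt_fst
      (by simp)
    simp only [mfderiv_eq_fderiv] at hmfderiv
    exact (inTangentCoordinates_model_space (𝕜 := ℝ) Prod.fst (fun z : ℝ × M ↦ ψ z.1 z.2)
      (fun z ↦ fderiv ℝ (fun t ↦ ψ t z.2) z.1) z) ▸ hmfderiv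
  simpa only [fderiv_apply_one_eq_deriv] using
    (hderiv.continuousAt.clm_apply (continuousAt_const (y := (1 : ℝ)))).continuousWithinAt

lemma continuous_of_contMDiffOn
    (hψ : ContMDiffOn (𝓘(ℝ, ℝ).prod I) 𝓘(ℝ, ℝ) 1 (fun z : ℝ × M ↦ ψ z.1 z.2) (S ×ˢ univ))
    (ht : t ∈ S) : Continuous (ψ t) :=
  hψ.continuousOn.comp_continuous (by fun_prop : Continuous fun x : M ↦ (t, x))
    fun x ↦ ⟨ht, mem_univ x⟩

variable [CompactSpace M] [MeasurableSpace M] [BorelSpace M] {μ : Measure M} [IsFiniteMeasure μ]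

lemma integrable_of_continuous {f : M → ℝ} (hf : Continuous f) : Integrable f μ :=
  hf.integrable_of_hasCompactSupport (HasCompactSupport.of_compactSpace _)

lemma hasDerivAt_integral_of_contMDiffOn [IsManifold I 1 M] (hS : IsOpen S)
    (hψ : ContMDiffOn (𝓘(ℝ, ℝ).prod I) 𝓘(ℝ, ℝ) 1 (fun z : ℝ × M ↦ ψ z.1 z.2) (S ×ˢ univ))
    (ht : t ∈ S) :
    Integrable (fun x ↦ deriv (fun t ↦ ψ t x) t) μ ∧
      HasDerivAt (fun t ↦ ∫ x, ψ t x ∂μ) (∫ x, deriv (fun t ↦ ψ t x) t ∂μ) t := by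
  have hderiv := continuousOn_deriv_of_contMDiffOn hS hψ
  have hcont (s : ℝ) (hs : s ∈ S) : Continuous (ψ s) := continuous_of_contMDiffOn hψ hs
  obtain ⟨r, hr, hrS⟩ := Metric.nhds_basis_closedBall.mem_iff.1 (hS.mem_nhds ht)
  obtain ⟨C, hC⟩ := ((isCompact_closedBall t r).prod
    (isCompact_univ (X := M))).exists_bound_of_continuousOn (hderiv.mono (prod_mono_left hrS))
  refine hasDerivAt_integral_of_dominated_loc_of_deriv_le (bound := fun _ ↦ C)
    (F' := fun t x ↦ deriv (fun t ↦ ψ t x) t) (Metric.closedBall_mem_nhds t hr) ?_ ?_ ?_ ?_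
    (integrable_const C) ?_
  · filter_upwards [hS.mem_nhds ht] with s hs using (hcont s hs).aestronglyMeasurable
  · exact integrable_of_continuous (hcont t ht)
  · exact (hderiv.comp_continuous (by fun_prop : Continuous fun x : M ↦ (t, x))
      fun x ↦ ⟨ht, mem_univ x⟩).aestronglyMeasurable
  · exact .of_forall fun x s hs ↦ hC (s, x) ⟨hs, mem_univ x⟩
  · refine .of_forall fun x s hs ↦ DifferentiableAt.hasDerivAt ?_
    have hψx : ContMDiffAt 𝓘(ℝ, ℝ) 𝓘(ℝ, ℝ) 1 (fun t ↦ ψ t x) s :=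
      (hψ.contMDiffAt ((hS.prod isOpen_univ).mem_nhds ⟨hrS hs, mem_univ x⟩)).comp
        (f := fun t : ℝ ↦ (t, x)) s (contMDiffAt_id.prodMk contMDiffAt_const)
    exact hψx.contDiffAt.differentiableAt (by simp)

end ParametricIntegral

section Slices

variable {E : Type*} [NormedAddCommGroup E] [NormedSpace ℝ E] {ι : Type*} [Fintype ι]

lemma coordDiv_congr {α β : E → E →L[ℝ] ℝ} {z : E} (h : α =ᶠ[nhds z] β) (e : ι → E) (ζ : E) :
    coordDiv e ζ α z = coordDiv e ζ β z := by
  have he (v : E) : (fun z ↦ α z v) =ᶠ[nhds z] fun z ↦ β z v := h.fun_comp fun A ↦ A v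
  simp only [coordDiv, (he _).fderiv_eq, h.self_of_nhds]

lemma coordDiv_slice {α : ℝ × E → ℝ × E →L[ℝ] ℝ} {t : ℝ} {y : E}
    (hα : DifferentiableAt ℝ α (t, y)) (e : ι → E) (ζ : E) :
    coordDiv e ζ (fun y ↦ (α (t, y)).comp (ContinuousLinearMap.inr ℝ ℝ E)) y =
      coordDiv (fun i ↦ ((0 : ℝ), e i)) (0, ζ) α (t, y) := by
  have hslice (v : E) := fderiv_slice (f := fun z ↦ α z (0, v))
    (hα.clm_apply (differentiableAt_const _)) v
  simp only [coordDiv, ← hslice, ContinuousLinearMap.comp_apply, ContinuousLinearMap.inr_apply]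

end Slices

section FirstVariation

variable {m n : ℕ} {M : Type*} [TopologicalSpace M] [ChartedSpace (Model m) M]
  {N : Type*} [TopologicalSpace N] [ChartedSpace (Model n) N] [IsManifold (𝓡 n) ∞ N]
  [RiemannianBundle (fun q : N ↦ TangentSpace (𝓡 n) q)]
  {φ : ℝ → M → N} {ε t : ℝ} {p x : M} {q : N} {W : ∀ t x, TangentSpace (𝓡 n) (φ t x)}

lemma inner_eq_localMetric_family (hp : x ∈ (chartAt (Model m) p).source)
    (hq : φ t x ∈ (chartAt (Model n) q).source) (v w : TangentSpace (𝓡 n) (φ t x)) :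
    inner ℝ v w = localMetric n q (familyInCharts m n p q φ (t, extChartAt (𝓡 m) p x))
      (chartCoord n q (φ t x) v) (chartCoord n q (φ t x) w) := by
  rw [familyInCharts_extChartAt hp, inner_eq_localMetric hq]

variable [IsManifold (𝓡 m) ∞ M] [RiemannianBundle (fun x : M ↦ TangentSpace (𝓡 m) x)]
  [IsContMDiffRiemannianBundle (𝓡 n) ∞ (Model n) (fun q : N ↦ TangentSpace (𝓡 n) q)]

lemma covNormSq_family (hφ : IsVariation m n φ ε) (hW : IsSmoothSection m n φ ε W)
    (ht : t ∈ Ioo (-ε) ε) (hp : x ∈ (chartAt (Model m) p).source)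
    (hq : φ t x ∈ (chartAt (Model n) q).source) :
    covNormSq m n (φ t) (W t) x =
      ∑ i, localMetric n q (familyInCharts m n p q φ (t, extChartAt (𝓡 m) p x))
        (covDeriv (localChristoffel n q) (familyInCharts m n p q φ)
          (familySectionInCharts m n p q φ W) (t, extChartAt (𝓡 m) p x) (0, onbInChart m p x i))
        (covDeriv (localChristoffel n q) (familyInCharts m n p q φ)
          (familySectionInCharts m n p q φ W) (t, extChartAt (𝓡 m) p x)
          (0, onbInChart m p x i)) :=
  Finset.sum_congr rfl fun i _ ↦ by
    rw [← real_inner_self_eq_norm_sq, inner_eq_localMetric_family hp hq,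
      chartCoord_covAlong_family hφ hW ht hp hq, onbInChart]

lemma deriv_covNormSq_family (hφ : IsVariation m n φ ε) (hW : IsSmoothSection m n φ ε W)
    (ht : t ∈ Ioo (-ε) ε) (hp : x ∈ (chartAt (Model m) p).source)
    (hq : φ t x ∈ (chartAt (Model n) q).source) :
    deriv (fun t ↦ covNormSq m n (φ t) (W t) x) t =
      fderiv ℝ (fun z ↦ ∑ i, localMetric n q (familyInCharts m n p q φ z)
        (covDeriv (localChristoffel n q) (familyInCharts m n p q φ)
          (familySectionInCharts m n p q φ W) z (0, onbInChart m p x i))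
        (covDeriv (localChristoffel n q) (familyInCharts m n p q φ)
          (familySectionInCharts m n p q φ W) z (0, onbInChart m p x i)))
        (t, extChartAt (𝓡 m) p x) (1, 0) := by
  have hz := mk_extChartAt_mem_familyDomain ht hp hq
  have hcov (ξ : ℝ × Model m) := (hW.contDiffAt_covDeriv hφ hz).clm_apply
    (contDiffAt_const (c := ξ))
  have hmetric := ((isMetricOn_localMetric q).contDiffAt (familyInCharts_mem_target hz)).comp _
    (contDiffAt_familyInCharts hφ hz)
  have hdensity := ContDiffAt.sum (s := Finset.univ) fun i _ ↦
    (hmetric.clm_apply (hcov (0, onbInChart m p x i))).clm_apply (hcov (0, onbInChart m p x i))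
  refine Eq.trans (Filter.EventuallyEq.deriv_eq ?_)
    (fderiv_apply_one_eq_deriv.symm.trans (fderiv_time (hdensity.differentiableAt (by simp))))
  filter_upwards [isOpen_Ioo.mem_nhds ht, (hφ.contMDiffAt_curve ht x).continuousAt.eventually
    (source_mem_nhds hq)] with s hs hqs using covNormSq_family hφ hW hs hp hqs

variable [IsContMDiffRiemannianBundle (𝓡 m) ∞ (Model m) (fun x : M ↦ TangentSpace (𝓡 m) x)]

lemma contMDiffOn_covNormSq (hφ : IsVariation m n φ ε) (hW : IsSmoothSection m n φ ε W) :
    ContMDiffOn (𝓘(ℝ, ℝ).prod (𝓡 m)) 𝓘(ℝ, ℝ) ∞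
      (fun z : ℝ × M ↦ covNormSq m n (φ z.1) (W z.1) z.2) (Ioo (-ε) ε ×ˢ univ) := by
  rintro ⟨t, x⟩ ⟨ht, -⟩
  have hp := mem_chart_source (Model m) x
  have hq := mem_chart_source (Model n) (φ t x)
  have hz := mk_extChartAt_mem_familyDomain ht hp hq
  set f := familyInCharts m n x (φ t x) φ
  set A := covDeriv (localChristoffel n (φ t x)) f (familySectionInCharts m n x (φ t x) φ W)
  have hA := hW.contDiffAt_covDeriv hφ hz
  have hmetric := ((isMetricOn_localMetric (φ t x)).contDiffAt (familyInCharts_mem_target hz)).comp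
    _ (contDiffAt_familyInCharts hφ hz)
  let slice (z : ℝ × Model m) : Model m →L[ℝ] Model n :=
    (A z).comp (ContinuousLinearMap.inr ℝ ℝ (Model m))
  let B (z : ℝ × Model m) : Model m →L[ℝ] Model m →L[ℝ] ℝ :=
    (localMetric n (φ t x) (f z)).bilinearComp (slice z) (slice z)
  have htrace := (isMetricOn_localMetric x).contDiffAt_metricTrace (p := Prod.snd) (B := B) hz.2.1
    contDiffAt_snd fun u v ↦ (hmetric.clm_apply (hA.clm_apply contDiffAt_const)).clm_apply
      (hA.clm_apply contDiffAt_const)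
  have hchart : ContMDiffAt (𝓘(ℝ, ℝ).prod (𝓡 m)) 𝓘(ℝ, ℝ × Model m) ∞
      (fun z : ℝ × M ↦ (z.1, extChartAt (𝓡 m) x z.2)) (t, x) := contMDiffAt_fst.prodMk_space
    (ContMDiffAt.comp (t, x) (contMDiffAt_extChartAt_of_mem hp) contMDiffAt_snd)
  refine ((htrace.contMDiffAt.comp (t, x) hchart).congr_of_eventuallyEq ?_).contMDiffWithinAt
  filter_upwards [continuousAt_fst.eventually (isOpen_Ioo.mem_nhds ht),
    continuousAt_snd.eventually (source_mem_nhds hp),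
    (hφ.contMDiffAt ht x).continuousAt.eventually (source_mem_nhds hq)] with w hwt hwp hwq
  rw [covNormSq_family hφ hW hwt hwp hwq]
  exact (isParsevalFrame_onbInChart hwp).sum_apply_apply_eq_metricTrace
    ((isMetricOn_localMetric x).isInvertible (extChartAt_mem_target hwp))
    (B (w.1, extChartAt (𝓡 m) x w.2))

end FirstVariation

section FirstVariationForm

variable {m n : ℕ}
  {M : Type*} [TopologicalSpace M] [ChartedSpace (Model m) M] [IsManifold (𝓡 m) ∞ M]
  [RiemannianBundle (fun x : M ↦ TangentSpace (𝓡 m) x)]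
  {N : Type*} [TopologicalSpace N] [ChartedSpace (Model n) N] [IsManifold (𝓡 n) ∞ N]
  [RiemannianBundle (fun q : N ↦ TangentSpace (𝓡 n) q)]
  [IsContMDiffRiemannianBundle (𝓡 n) ∞ (Model n) (fun q : N ↦ TangentSpace (𝓡 n) q)]
  {φ : ℝ → M → N} {ε t : ℝ} {p x : M} {q : N} {z : ℝ × Model m}

variable (m n) in
/-- The one-form `⟨∇̄τ, ∇̄_{∂/∂t} τ⟩ + ⟨∇̄V, Δ̄τ⟩ - ⟨∇̄Δ̄τ, V⟩` at time `t`, where `τ` is the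
tension field and `V` the velocity field of `φ`. Its divergence is the difference of the two
integrands in the first variation formula. -/
def firstVariationForm (φ : ℝ → M → N) (t : ℝ) (x : M) : TangentSpace (𝓡 m) x →ₗ[ℝ] ℝ :=
  (innerₗ _ (covTime n φ (fun t ↦ tension m n (φ t)) t x)).comp
      (covAlongLinearMap m n (φ t) (tension m n (φ t)) x)
    + (innerₗ _ (roughLaplacian m n (φ t) (tension m n (φ t)) x)).comp
        (covAlongLinearMap m n (φ t) (velocity n φ t) x)
    - (innerₗ _ (velocity n φ t x)).comp
        (covAlongLinearMap m n (φ t) (roughLaplacian m n (φ t) (tension m n (φ t))) x)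

variable (m n) in
/-- The coordinate expression of `firstVariationForm` as a one-form on space-time. -/
def firstVariationFormInCharts (p : M) (q : N) (φ : ℝ → M → N) :
    ℝ × Model m → ℝ × Model m →L[ℝ] ℝ :=
  variationForm (localMetric n q) (familyInCharts m n p q φ)
    (familySectionInCharts m n p q φ fun t ↦ tension m n (φ t))
    (familySectionInCharts m n p q φ fun t ↦ roughLaplacian m n (φ t) (tension m n (φ t))) (1, 0)

variable [IsContMDiffRiemannianBundle (𝓡 m) ∞ (Model m) (fun x : M ↦ TangentSpace (𝓡 m) x)]

lemma firstVariationForm_apply_eq_inCharts (hφ : IsVariation m n φ ε) (ht : t ∈ Ioo (-ε) ε)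
    (hp : x ∈ (chartAt (Model m) p).source) (hq : φ t x ∈ (chartAt (Model n) q).source)
    (X : TangentSpace (𝓡 m) x) :
    firstVariationForm m n φ t x X =
      firstVariationFormInCharts m n p q φ (t, extChartAt (𝓡 m) p x) (0, chartCoord m p x X) := by
  have hτ := isSmoothSection_tension (m := m) hφ
  have hV := isSmoothSection_velocity hφ
  have hvelocity : familySectionInCharts m n p q φ (velocity n φ)
      =ᶠ[nhds (t, extChartAt (𝓡 m) p x)] fun z ↦ fderiv ℝ (familyInCharts m n p q φ) z (1, 0) := by
    filter_upwards [familyDomain_mem_nhds hφ (mk_extChartAt_mem_familyDomain ht hp hq)] with z hz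
    obtain ⟨s, hs, y, hyp, hyq, rfl⟩ := exists_eq_mk_extChartAt hz
    rw [familySectionInCharts_extChartAt hyp, chartCoord_velocity hφ hs hyp hyq]
  have happly : firstVariationForm m n φ t x X =
      inner ℝ (covTime n φ (fun t ↦ tension m n (φ t)) t x)
          (covAlong m n (φ t) (tension m n (φ t)) x X)
        + inner ℝ (roughLaplacian m n (φ t) (tension m n (φ t)) x)
            (covAlong m n (φ t) (velocity n φ t) x X)
        - inner ℝ (velocity n φ t x)
            (covAlong m n (φ t) (roughLaplacian m n (φ t) (tension m n (φ t))) x X) := rfl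
  rw [happly, real_inner_comm (covAlong m n (φ t) (tension m n (φ t)) x X),
    real_inner_comm (covAlong m n (φ t) (velocity n φ t) x X),
    real_inner_comm (covAlong m n (φ t) _ x X), firstVariationFormInCharts, variationForm]
  simp only [sub_apply, add_apply, metricPairing_apply, inner_eq_localMetric_family hp hq,
    chartCoord_covTime hφ hτ ht hp hq, chartCoord_velocity hφ ht hp hq,
    familySectionInCharts_extChartAt hp]
  rw [chartCoord_covAlong_family hφ hτ ht hp hq, chartCoord_covAlong_family hφ hV ht hp hq,
    chartCoord_covAlong_family hφ (isSmoothSection_roughLaplacian hφ hτ) ht hp hq,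
    covDeriv_congr .rfl hvelocity]
  rfl

lemma contDiffAt_firstVariationFormInCharts (hφ : IsVariation m n φ ε)
    (hz : z ∈ familyDomain m n p q φ ε) :
    ContDiffAt ℝ ∞ (firstVariationFormInCharts m n p q φ) z :=
  have hτ := isSmoothSection_tension (m := m) hφ
  contDiffAt_variationForm (isMetricOn_localMetric q) (familyInCharts_mem_target hz)
    (contDiffAt_familyInCharts hφ hz) (hτ p q z hz)
    (isSmoothSection_roughLaplacian hφ hτ p q z hz) (1, 0)

lemma oneFormInChart_firstVariationForm_eventuallyEq (hφ : IsVariation m n φ ε) {y : Model m}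
    (hz : (t, y) ∈ familyDomain m n p q φ ε) :
    oneFormInChart m p (firstVariationForm m n φ t) =ᶠ[nhds y] fun y ↦
      (firstVariationFormInCharts m n p q φ (t, y)).comp
        (ContinuousLinearMap.inr ℝ ℝ (Model m)) := by
  have hslice : ContinuousAt (fun y : Model m ↦ (t, y)) y := by fun_prop
  filter_upwards [hslice.eventually (familyDomain_mem_nhds hφ hz)] with y' hz'
  have hp := extChartAt_symm_mem_source hz'.2.1
  ext u
  rw [oneFormInChart_apply, firstVariationForm_apply_eq_inCharts hφ hz'.1 hp hz'.2.2,
    chartCoord_ofChartCoord hp, (extChartAt (𝓡 m) p).right_inv hz'.2.1]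
  rfl

lemma isSmoothOneForm_firstVariationForm (hφ : IsVariation m n φ ε) (ht : t ∈ Ioo (-ε) ε) :
    IsSmoothOneForm (firstVariationForm m n φ t) := by
  intro p y hy
  have hz : (t, y) ∈ familyDomain m n p (φ t ((extChartAt (𝓡 m) p).symm y)) φ ε :=
    ⟨ht, hy, mem_chart_source _ _⟩
  exact (((contDiffAt_firstVariationFormInCharts hφ hz).comp (f := fun y ↦ (t, y)) y
    (contDiffAt_const.prodMk contDiffAt_id)).clm_comp contDiffAt_const).congr_of_eventuallyEq
      (oneFormInChart_firstVariationForm_eventuallyEq hφ hz)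

lemma divergenceInChart_firstVariationForm (hφ : IsVariation m n φ ε) (ht : t ∈ Ioo (-ε) ε)
    (hp : x ∈ (chartAt (Model m) p).source) (hq : φ t x ∈ (chartAt (Model n) q).source) :
    divergenceInChart m p (firstVariationForm m n φ t) x =
      coordDiv (fun i ↦ (0, onbInChart m p x i)) (0, christoffelTrace m p x)
        (firstVariationFormInCharts m n p q φ) (t, extChartAt (𝓡 m) p x) := by
  have hz := mk_extChartAt_mem_familyDomain ht hp hq
  rw [divergenceInChart,
    coordDiv_congr (oneFormInChart_firstVariationForm_eventuallyEq hφ hz),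
    coordDiv_slice ((contDiffAt_firstVariationFormInCharts hφ hz).differentiableAt (by simp))]

lemma covDeriv_time_tension (hφ : IsVariation m n φ ε) (ht : t ∈ Ioo (-ε) ε)
    (hp : x ∈ (chartAt (Model m) p).source) (hq : φ t x ∈ (chartAt (Model n) q).source) :
    covDeriv (localChristoffel n q) (familyInCharts m n p q φ)
        (familySectionInCharts m n p q φ fun t ↦ tension m n (φ t))
        (t, extChartAt (𝓡 m) p x) (1, 0) =
      covTrace (localChristoffel n q) (familyInCharts m n p q φ)
          (covDeriv (localChristoffel n q) (familyInCharts m n p q φ)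
            fun z ↦ fderiv ℝ (familyInCharts m n p q φ) z (1, 0))
          (fun i ↦ (0, onbInChart m p x i)) (0, christoffelTrace m p x) (t, extChartAt (𝓡 m) p x)
        + ∑ i, curvTensor (localChristoffel n q)
            (familyInCharts m n p q φ (t, extChartAt (𝓡 m) p x))
            (fderiv ℝ (familyInCharts m n p q φ) (t, extChartAt (𝓡 m) p x) (1, 0))
            (fderiv ℝ (familyInCharts m n p q φ) (t, extChartAt (𝓡 m) p x) (0, onbInChart m p x i))
            (fderiv ℝ (familyInCharts m n p q φ) (t, extChartAt (𝓡 m) p x)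
              (0, onbInChart m p x i)) := by
  have hz := mk_extChartAt_mem_familyDomain ht hp hq
  have hf := contDiffAt_familyInCharts hφ hz
  have hfd := hf.differentiableAt (by simp)
  have hΓ := contDiffAt_localChristoffel_familyInCharts hz
  have hsymm : ∀ᶠ y in nhds (familyInCharts m n p q φ (t, extChartAt (𝓡 m) p x)),
      ∀ u v, localChristoffel n q y u v = localChristoffel n q y v u := by
    filter_upwards [target_mem_nhds (familyInCharts_mem_target hz)] with y hy
      using (isMetricOn_localMetric q).leviCivita_symm hy
  have htrace : DifferentiableAt ℝ (covTrace (localChristoffel n q) (familyInCharts m n p q φ)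
      (fderiv ℝ (familyInCharts m n p q φ)) (fun i ↦ (0, onbInChart m p x i))
      (0, christoffelTrace m p x)) (t, extChartAt (𝓡 m) p x) :=
    ((ContDiffAt.sum fun i _ ↦ contDiffAt_covDeriv_apply hΓ hf (contDiffAt_fderiv_apply hf _) _).sub
      (contDiffAt_fderiv_apply hf _)).differentiableAt (by simp)
  have htension : (fun s ↦ familySectionInCharts m n p q φ (fun t ↦ tension m n (φ t))
      (s, extChartAt (𝓡 m) p x)) =ᶠ[nhds t] fun s ↦ covTrace (localChristoffel n q)
        (familyInCharts m n p q φ) (fderiv ℝ (familyInCharts m n p q φ))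
        (fun i ↦ (0, onbInChart m p x i)) (0, christoffelTrace m p x)
        (s, extChartAt (𝓡 m) p x) := by
    filter_upwards [isOpen_Ioo.mem_nhds ht, (hφ.contMDiffAt_curve ht x).continuousAt.eventually
      (source_mem_nhds hq)] with s hs hqs
    rw [familySectionInCharts_extChartAt hp, chartCoord_tension hφ hs hp hqs]
  rw [← covDeriv_covTrace_fderiv hΓ hsymm hf, ← covDeriv_time hfd htrace,
    ← covDeriv_congr .rfl htension,
    covDeriv_time hfd ((isSmoothSection_tension hφ).differentiableAt hz)]

lemma chartCoord_tritension (hφ : IsVariation m n φ ε) (ht : t ∈ Ioo (-ε) ε)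
    (hp : x ∈ (chartAt (Model m) p).source) :
    chartCoord n (φ t x) (φ t x) (tritension m n (φ t) x) =
      -covTrace (localChristoffel n (φ t x)) (familyInCharts m n p (φ t x) φ)
          (covDeriv (localChristoffel n (φ t x)) (familyInCharts m n p (φ t x) φ)
            (familySectionInCharts m n p (φ t x) φ fun t ↦
              roughLaplacian m n (φ t) (tension m n (φ t))))
          (fun i ↦ (0, onbInChart m p x i)) (0, christoffelTrace m p x) (t, extChartAt (𝓡 m) p x)
        - ∑ i, curvTensor (localChristoffel n (φ t x))
            (familyInCharts m n p (φ t x) φ (t, extChartAt (𝓡 m) p x))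
            (familySectionInCharts m n p (φ t x) φ
              (fun t ↦ roughLaplacian m n (φ t) (tension m n (φ t))) (t, extChartAt (𝓡 m) p x))
            (fderiv ℝ (familyInCharts m n p (φ t x) φ) (t, extChartAt (𝓡 m) p x)
              (0, onbInChart m p x i))
            (fderiv ℝ (familyInCharts m n p (φ t x) φ) (t, extChartAt (𝓡 m) p x)
              (0, onbInChart m p x i))
        - ∑ i, curvTensor (localChristoffel n (φ t x))
            (familyInCharts m n p (φ t x) φ (t, extChartAt (𝓡 m) p x))
            (covDeriv (localChristoffel n (φ t x)) (familyInCharts m n p (φ t x) φ)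
              (familySectionInCharts m n p (φ t x) φ fun t ↦ tension m n (φ t))
              (t, extChartAt (𝓡 m) p x) (0, onbInChart m p x i))
            (familySectionInCharts m n p (φ t x) φ (fun t ↦ tension m n (φ t))
              (t, extChartAt (𝓡 m) p x))
            (fderiv ℝ (familyInCharts m n p (φ t x) φ) (t, extChartAt (𝓡 m) p x)
              (0, onbInChart m p x i)) := by
  have hq := mem_chart_source (Model n) (φ t x)
  have hτ := isSmoothSection_tension (m := m) hφ
  simp only [tritension, jacobiOperator, map_sub, map_sum, chartCoord_curvature,
    chartCoord_roughLaplacian hφ (isSmoothSection_roughLaplacian hφ hτ) ht hp hq,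
    chartCoord_covAlong_family hφ hτ ht hp hq, chartCoord_mfderiv_family hφ ht hp hq,
    familySectionInCharts_extChartAt hp, familyInCharts_extChartAt hp, onbInChart]

theorem hasDivergence_firstVariationForm (hφ : IsVariation m n φ ε) (ht : t ∈ Ioo (-ε) ε) :
    HasDivergence (firstVariationForm m n φ t) (fun x ↦
      (1 / 2) * deriv (fun t ↦ covNormSq m n (φ t) (tension m n (φ t)) x) t
        + inner ℝ (tritension m n (φ t) x) (velocity n φ t x)) := by
  intro p x hp
  have hq := mem_chart_source (Model n) (φ t x)
  have hz := mk_extChartAt_mem_familyDomain ht hp hq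
  have hτ := isSmoothSection_tension (m := m) hφ
  have hΛ := isSmoothSection_roughLaplacian hφ hτ
  have hΛτ : familySectionInCharts m n p (φ t x) φ
      (fun t ↦ roughLaplacian m n (φ t) (tension m n (φ t))) (t, extChartAt (𝓡 m) p x) =
      -covTrace (localChristoffel n (φ t x)) (familyInCharts m n p (φ t x) φ)
          (covDeriv (localChristoffel n (φ t x)) (familyInCharts m n p (φ t x) φ)
            (familySectionInCharts m n p (φ t x) φ fun t ↦ tension m n (φ t)))
          (fun i ↦ (0, onbInChart m p x i)) (0, christoffelTrace m p x)
          (t, extChartAt (𝓡 m) p x) := by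
    rw [familySectionInCharts_extChartAt hp, chartCoord_roughLaplacian hφ hτ ht hp hq]
  have hdensity := (isMetricOn_localMetric (φ t x)).half_fderiv_sum_covDeriv_sq_eq_coordDiv
    (familyInCharts_mem_target hz) (contDiffAt_familyInCharts hφ hz) (hτ p _ _ hz) (hΛ p _ _ hz)
    (1, 0) (fun i ↦ (0, onbInChart m p x i)) (0, christoffelTrace m p x)
    (covDeriv_time_tension hφ ht hp hq) hΛτ
  symm
  rw [← eq_sub_iff_add_eq, divergenceInChart_firstVariationForm hφ ht hp hq,
    deriv_covNormSq_family hφ hτ ht hp hq, inner_eq_localMetric_family hp hq,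
    chartCoord_velocity hφ ht hp hq, chartCoord_tritension hφ ht hp]
  exact hdensity

end FirstVariationForm

section FirstVariationFormula

variable {m n : ℕ}
  {M : Type*} [TopologicalSpace M] [CompactSpace M] [MeasurableSpace M] [BorelSpace M]
  [ChartedSpace (Model m) M] [IsManifold (𝓡 m) ∞ M]
  [RiemannianBundle (fun x : M ↦ TangentSpace (𝓡 m) x)]
  [IsContMDiffRiemannianBundle (𝓡 m) ∞ (Model m) (fun x : M ↦ TangentSpace (𝓡 m) x)]
  {N : Type*} [TopologicalSpace N] [ChartedSpace (Model n) N] [IsManifold (𝓡 n) ∞ N]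
  [RiemannianBundle (fun q : N ↦ TangentSpace (𝓡 n) q)]
  [IsContMDiffRiemannianBundle (𝓡 n) ∞ (Model n) (fun q : N ↦ TangentSpace (𝓡 n) q)]
  {φ : ℝ → M → N} {ε t : ℝ}

lemma integrable_covNormSq_tension (hφ : IsVariation m n φ ε) (ht : t ∈ Ioo (-ε) ε) :
    Integrable (covNormSq m n (φ t) (tension m n (φ t))) (riemannianVolume m M) :=
  integrable_of_continuous <|
    continuous_of_contMDiffOn (ψ := fun t ↦ covNormSq m n (φ t) (tension m n (φ t)))
      ((contMDiffOn_covNormSq hφ (isSmoothSection_tension hφ)).of_le (by norm_cast)) ht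

lemma hasDerivAt_integral_covNormSq_tension (hφ : IsVariation m n φ ε) (ht : t ∈ Ioo (-ε) ε) :
    Integrable (fun x ↦ deriv (fun t ↦ covNormSq m n (φ t) (tension m n (φ t)) x) t)
        (riemannianVolume m M) ∧
      HasDerivAt (fun t ↦ ∫ x, covNormSq m n (φ t) (tension m n (φ t)) x ∂(riemannianVolume m M))
        (∫ x, deriv (fun t ↦ covNormSq m n (φ t) (tension m n (φ t)) x) t
          ∂(riemannianVolume m M)) t :=
  hasDerivAt_integral_of_contMDiffOn isOpen_Ioo
    ((contMDiffOn_covNormSq hφ (isSmoothSection_tension hφ)).of_le (by norm_cast)) ht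

lemma integrable_inner_tritension_velocity (hφ : IsVariation m n φ ε) (ht : t ∈ Ioo (-ε) ε) :
    Integrable (fun x ↦ inner ℝ (tritension m n (φ t) x) (velocity n φ t x))
      (riemannianVolume m M) := by
  have hD : Integrable _ (riemannianVolume m M) := integrable_of_continuous <|
    (hasDivergence_firstVariationForm hφ ht).continuous (isSmoothOneForm_firstVariationForm hφ ht)
  refine (hD.sub ((hasDerivAt_integral_covNormSq_tension hφ ht).1.const_mul (1 / 2))).congr ?_
  exact .of_forall fun x ↦ add_sub_cancel_left _ _

variable [T2Space M]

theorem hasDerivAt_trienergy (hφ : IsVariation m n φ ε) (ht : t ∈ Ioo (-ε) ε) :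
    HasDerivAt (fun t ↦ trienergy m n (φ t))
      (-∫ x, inner ℝ (tritension m n (φ t) x) (velocity n φ t x) ∂(riemannianVolume m M)) t := by
  obtain ⟨hint, hderiv⟩ := hasDerivAt_integral_covNormSq_tension hφ ht
  have hdiv := (hasDivergence_firstVariationForm hφ ht).integral_eq_zero
    (isSmoothOneForm_firstVariationForm hφ ht)
  rw [integral_add (hint.const_mul _) (integrable_inner_tritension_velocity hφ ht),
    integral_const_mul] at hdiv
  rw [← eq_neg_of_add_eq_zero_left hdiv]
  refine (hderiv.const_mul (1 / 2)).congr_of_eventuallyEq ?_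
  filter_upwards [isOpen_Ioo.mem_nhds ht] with t ht using
    trienergy_eq_integral_covNormSq_tension (hφ.contMDiff_slice ht)

end FirstVariationFormula

end Riem

end

theorem theorem2p1_general {m n : ℕ}
    {M : Type*} [TopologicalSpace M] [T2Space M] [CompactSpace M]
    [MeasurableSpace M] [BorelSpace M]
    [ChartedSpace (EuclideanSpace ℝ (Fin m)) M] [IsManifold (𝓡 m) ∞ M]
    [RiemannianBundle (fun x : M ↦ TangentSpace (𝓡 m) x)]
    [IsContMDiffRiemannianBundle (𝓡 m) ∞ (EuclideanSpace ℝ (Fin m))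
      (fun x : M ↦ TangentSpace (𝓡 m) x)]
    {N : Type*} [TopologicalSpace N]
    [ChartedSpace (EuclideanSpace ℝ (Fin n)) N] [IsManifold (𝓡 n) ∞ N]
    [RiemannianBundle (fun q : N ↦ TangentSpace (𝓡 n) q)]
    [IsContMDiffRiemannianBundle (𝓡 n) ∞ (EuclideanSpace ℝ (Fin n))
      (fun q : N ↦ TangentSpace (𝓡 n) q)]
    {φ : ℝ → M → N} {ε : ℝ} (hφ : Riem.IsVariation m n φ ε) {t : ℝ} (ht : t ∈ Ioo (-ε) ε) :
    (Integrable (Riem.trienergyDensity m n (φ t)) (Riem.riemannianVolume m M) ∧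
      Integrable (Riem.covNormSq m n (φ t) (Riem.tension m n (φ t)))
        (Riem.riemannianVolume m M) ∧
      Riem.trienergy m n (φ t) =
        (1 / 2) * ∫ x, Riem.covNormSq m n (φ t) (Riem.tension m n (φ t)) x
          ∂(Riem.riemannianVolume m M)) ∧
    Integrable (fun x ↦ inner ℝ (Riem.tritension m n (φ t) x) (Riem.velocity n φ t x))
      (Riem.riemannianVolume m M) ∧
    HasDerivAt (fun t ↦ Riem.trienergy m n (φ t))
      (-∫ x, inner ℝ (Riem.tritension m n (φ t) x) (Riem.velocity n φ t x)
        ∂(Riem.riemannianVolume m M)) t := by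
  have hφt := hφ.contMDiff_slice ht
  have hdensity := Riem.integrable_covNormSq_tension hφ ht
  refine ⟨⟨?_, hdensity, Riem.trienergy_eq_integral_covNormSq_tension hφt⟩,
    Riem.integrable_inner_tritension_velocity hφ ht, Riem.hasDerivAt_trienergy hφ ht⟩
  rwa [Riem.trienergyDensity_eq_covNormSq_tension hφt]

theorem theorem2p1 {m n : ℕ}
    {M : Type*} [TopologicalSpace M] [T2Space M] [CompactSpace M]
    [MeasurableSpace M] [BorelSpace M]
    [ChartedSpace (EuclideanSpace ℝ (Fin m)) M] [IsManifold (𝓡 m) ∞ M]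
    [RiemannianBundle (fun x : M ↦ TangentSpace (𝓡 m) x)]
    [IsContMDiffRiemannianBundle (𝓡 m) ∞ (EuclideanSpace ℝ (Fin m))
      (fun x : M ↦ TangentSpace (𝓡 m) x)]
    {N : Type*} [TopologicalSpace N] [T2Space N]
    [ChartedSpace (EuclideanSpace ℝ (Fin n)) N] [IsManifold (𝓡 n) ∞ N]
    [RiemannianBundle (fun q : N ↦ TangentSpace (𝓡 n) q)]
    [IsContMDiffRiemannianBundle (𝓡 n) ∞ (EuclideanSpace ℝ (Fin n))
      (fun q : N ↦ TangentSpace (𝓡 n) q)]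
    (φ : ℝ → M → N) (ε : ℝ) (hε : 0 < ε)
    (hφ : ContMDiffOn (𝓘(ℝ, ℝ).prod (𝓡 m)) (𝓡 n) ∞ (fun z : ℝ × M ↦ φ z.1 z.2)
      (Ioo (-ε) ε ×ˢ univ)) :
    (∀ t ∈ Ioo (-ε) ε,
      Integrable (Riem.trienergyDensity m n (φ t)) (Riem.riemannianVolume m M) ∧
      Integrable (Riem.covNormSq m n (φ t) (Riem.tension m n (φ t)))
        (Riem.riemannianVolume m M) ∧
      Riem.trienergy m n (φ t) =
        (1 / 2) * ∫ x, Riem.covNormSq m n (φ t) (Riem.tension m n (φ t)) x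
          ∂(Riem.riemannianVolume m M)) ∧
    Integrable (fun x ↦ inner ℝ (Riem.tritension m n (φ 0) x) (Riem.variationField n φ x))
      (Riem.riemannianVolume m M) ∧
    HasDerivAt (fun t ↦ Riem.trienergy m n (φ t))
      (-∫ x, inner ℝ (Riem.tritension m n (φ 0) x) (Riem.variationField n φ x)
        ∂(Riem.riemannianVolume m M)) 0 :=
  ⟨fun _ ht ↦ (theorem2p1_general hφ ht).1, (theorem2p1_general hφ ⟨neg_lt_zero.2 hε, hε⟩).2⟩
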